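/- **Setting.** Let $d\ge 1$, $[d]=\{1,\dots,d\}$, and let $\vec\varphi=(\vec\varphi^1,\dots,\vec\varphi^d)$ be probability measures on $\{0,1,\dots\}^d$; let $\vec\xi^i=(\xi^{i,1},\dots,\xi^{i,d})$ have law $\vec\varphi^i$. Assume that all means $\mathbb E[\xi^{i,j}]$ are finite, that the matrix $M=(\mathbb E[\xi^{i,j}])_{i,j}$ is irreducible (for all $i,j$ there is $n$ with $(M^n)_{i,j}>0$), that $\mathbb P(\sum_j\xi^{i,j}=1)<1$ for some $i$, and that $\vec\varphi$ is subcritical or critical: the Perron–Frobenius eigenvalue (spectral radius) of $M$ is at most $1$. Fix $i_0\in[d]$. **The tree.** Let $T$ be a multitype Bienaymé–Galton–Watson tree with offspring distribution $\vec\varphi$ started from a single individual of type $i_0$: a (a priori possibly infinite) random plane tree, with finite numbers of children and with types in $[d]$, whose root has type $i_0$ and such that, for each $n$, given the typed tree up to generation $n$, the vectors (number of children of each type) of the vertices of generation $n$ are independent, with law $\vec\varphi^i$ for a vertex of type $i$. Let $\widetilde T$ be obtained from $T$ by adding a vertex $\widetilde\rho$ joined to the root of $T$ only. Equip $\widetilde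 T$ with the graph distance, the root $\widetilde\rho$ and the measures $\mu_j(A)=\#\{v\in A: v\ne\widetilde\rho,\ v\text{ has type }j\}$, $j\in[d]$. **Subdecorations.** Let $\vec X^i(m)=\sum_{k=1}^m(\vec\xi^i_k-\vec\epsilon_i)$ with $\vec\xi^i_1,\vec\xi^i_2,\dots$ i.i.d. of law $\vec\varphi^i$, where $\vec\epsilon_i$ is the $i$-th basis vector, and let $\tau=\min\{m:X^{i,i}(m)=-1\}$, which is a.s. finite. A *subdecoration of type $i$* is obtained from the excursion $(\vec X^i(m);0\le m\le\tau)$ as follows. Let $\mathtt t$ be the plane tree with Łukasiewicz path $X^{i,i}$, with vertices $v_1,\dots,v_\tau$ in depth-first order, and add a new root $v_0$ joined to $v_1$. The space is $\{v_0,\dots,v_\tau\}$ with the graph distance and the root $v_0$; its $i$-th measure is the counting measure on $\{v_1,\dots,v_\tau\}$ and the other $d-1$ measures are null. For $j\ne i$ let $L_j$ be the tuple containing, for $m=1,\dots,\tau$ in this order, the vertex $v_m$ exactly $X^{i,j}(m)-X^{i,j}(m-1)$ times. Given the excursion, let $\pi^j$, $j\neq i$, be independent uniform permutations of the positions in the tuples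 $L_j$. The marked points $(x_\ell)_{\ell\ge1}$ are: $x_{j+md}=$ the entry number $\pi^j(m+1)$ of $L_j$ for $j\ne i$ and $0\le m<\#L_j$; all other $x_\ell$ equal $v_0$. **The decoration $\mathcal D^{i_0,\vec\varphi}$.** It is indexed by $\mathbb U=\bigcup_{n\ge0}\{1,2,\dots\}^n$. $\mathcal D(\emptyset)$ is a random subdecoration of type $i_0$. Given $\mathcal D(\mathbf p)$ for all words $\mathbf p$ of length at most $h$, proceed independently for each $\mathbf p$ of length $h$: if $\mathcal D(\mathbf p)$ is of type $i$ then for each $j\ne i$ take $\#L_j$ i.i.d. subdecorations of type $j$ (independently for the different $j$), where $L_j$ is the tuple of $\mathcal D(\mathbf p)$, arrange them in decreasing order of cardinality, and let $\mathcal D(\mathbf p(j+(m-1)d))$ be the $m$-th of them for $1\le m\le\#L_j$. The arrangement uses a fixed, arbitrary (measurable) rule for breaking ties, which is a function of $j$ and of the list of subdecorations to be arranged. All other children $\mathcal D(\mathbf p\ell)$, and all children of trivial subdecorations, are trivial: one point with null measures. **Gluing.** The glued decoration $\mathscr G(\mathcal D^{i_0,\vec\varphi})$ is the Cauchy completion of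 the space obtained from the disjoint union of all $\mathcal D(\mathbf p)$ by identifying, for all $\mathbf p\in\mathbb U$ and $\ell\ge1$, the mark $x_\ell$ of $\mathcal D(\mathbf p)$ with the root of $\mathcal D(\mathbf p\ell)$. It carries the glued distance (the sum, over the subdecorations on the way from one point to the other, of the distances covered in them), the root of $\mathcal D(\emptyset)$, and as $j$-th measure the sum over $\mathbf p$ of the images of the $j$-th measures of $\mathcal D(\mathbf p)$. **Lemma.** Almost surely $\mathscr G(\mathcal D^{i_0,\vec\varphi})$ and $\widetilde T$ are compact with finite measures, and as random rooted metric spaces with $d$ measures, considered up to root- and measure-preserving isometry, they have the same law: $$\mathscr G(\mathcal D^{i_0,\vec\varphi})\overset{d}{=}\widetilde T .$$ -/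

import Mathlib

open MeasureTheory ProbabilityTheory

namespace MBGW

noncomputable section

/-! ### Rooted metric measure spaces -/

/-- A rooted metric space carrying a vector `(μ_j)` of `d` Borel measures. -/
structure PMMSpace (d : ℕ) where
  /-- the set of points -/
  carrier : Type
  /-- the metric -/
  metric : MetricSpace carrier
  /-- the root -/
  root : carrier
  /-- the coordinates of the vector-valued Borel measure -/
  mass : Fin d → @Measure carrier (borel carrier)

attribute [instance] PMMSpace.metric

/-- Isomorphism: a bijective isometry preserving the root and each of the `d` measures. -/
def PMMSpace.Iso {d : ℕ} (X Y : PMMSpace d) : Prop :=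
  ∃ f : X.carrier ≃ᵢ Y.carrier, f X.root = Y.root ∧
    ∀ j, @Measure.map _ _ (borel X.carrier) (borel Y.carrier) f (X.mass j) = Y.mass j

theorem borel_measurable {X Y : Type} [TopologicalSpace X] [TopologicalSpace Y] {f : X → Y}
    (hf : Continuous f) : @Measurable X Y (borel X) (borel Y) f := by
  let _ : MeasurableSpace X := borel X
  let _ : MeasurableSpace Y := borel Y
  have _ : BorelSpace X := ⟨rfl⟩
  have _ : BorelSpace Y := ⟨rfl⟩
  exact hf.measurable

theorem PMMSpace.iso_equivalence (d : ℕ) : Equivalence (PMMSpace.Iso (d := d)) where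
  refl X := by
    refine ⟨IsometryEquiv.refl _, rfl, fun j => ?_⟩
    let _ : MeasurableSpace X.carrier := borel _
    exact Measure.map_id
  symm := by
    rintro X Y ⟨f, h0, h⟩
    refine ⟨f.symm, by rw [← h0, f.symm_apply_apply], fun j => ?_⟩
    let _ : MeasurableSpace X.carrier := borel _
    let _ : MeasurableSpace Y.carrier := borel _
    rw [← h j, Measure.map_map (borel_measurable f.symm.continuous) (borel_measurable f.continuous)]
    have : (f.symm ∘ f : X.carrier → X.carrier) = id := by
      funext x
      simp
    rw [this, Measure.map_id]
  trans := by
    rintro X Y Z ⟨f, f0, hf⟩ ⟨g, g0, hg⟩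
    refine ⟨f.trans g, by simp [f0, g0], fun j => ?_⟩
    let _ : MeasurableSpace X.carrier := borel _
    let _ : MeasurableSpace Y.carrier := borel _
    let _ : MeasurableSpace Z.carrier := borel _
    rw [← hg j, ← hf j,
      Measure.map_map (borel_measurable g.continuous) (borel_measurable f.continuous)]
    rfl

/-- Isomorphism of rooted metric measure spaces as an equivalence relation. -/
instance PMMSpace.setoid (d : ℕ) : Setoid (PMMSpace d) := ⟨_, PMMSpace.iso_equivalence d⟩

/-- Isomorphism classes of rooted metric measure spaces with `d` measures. -/
def PMMClass (d : ℕ) := Quotient (PMMSpace.setoid d)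

/-- The isomorphism class of a space. -/
def PMMSpace.cls {d : ℕ} (X : PMMSpace d) : PMMClass d := Quotient.mk _ X

/-- Every set of isomorphism classes is measurable. Equality of laws for this σ-field is the
strongest possible one: it contains equality of laws for every smaller σ-field, in particular for
the Borel σ-field of the Gromov-Hausdorff-Prohorov topology. -/
instance (d : ℕ) : MeasurableSpace (PMMClass d) := ⊤

/-- The space is compact and its `d` measures are finite. -/
def PMMSpace.IsCompactFinite {d : ℕ} (X : PMMSpace d) : Prop :=
  CompactSpace X.carrier ∧ ∀ j, X.mass j Set.univ < ⊤

/-- The graph distance of a connected graph. -/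
abbrev graphMetric {V : Type} (G : SimpleGraph V) (hG : G.Connected) : MetricSpace V where
  dist u v := (G.dist u v : ℝ)
  dist_self u := by simp
  dist_comm u v := by rw [SimpleGraph.dist_comm]
  dist_triangle u v w := by exact_mod_cast hG.dist_triangle
  eq_of_dist_eq_zero {u v} h := by
    rw [Nat.cast_eq_zero] at h
    exact hG.dist_eq_zero_iff.mp h

/-- The vertices of a connected graph `G` as a rooted metric measure space: the graph distance, the
root `r`, and as `j`-th measure the counting measure on `S j`, that is, `A ↦ #(A ∩ S j)`. -/
def graphSpace {d : ℕ} {V : Type} (G : SimpleGraph V) (hG : G.Connected) (r : V)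
    (S : Fin d → Set V) : PMMSpace d where
  carrier := V
  metric := graphMetric G hG
  root := r
  mass j :=
    letI := graphMetric G hG
    @Measure.sum _ _ (borel V) fun v : S j => @Measure.dirac _ (borel V) v.1

/-! ### Gluing along the Ulam tree

The letters of the Ulam tree are numbered from `0`, so that the usual letter `ℓ ≥ 1` is `ℓ - 1`
here; likewise the types are `0, …, d - 1`. The vertices of the Ulam tree are finite words, and
the `ℓ`-th child of `p` is `p ++ [ℓ]`. -/

/-- A rooted metric measure space with an infinite sequence of marked points. -/
structure MarkedSpace (d : ℕ) extends PMMSpace d where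
  /-- the marked points -/
  mark : ℕ → carrier

/-- A decoration of the Ulam tree. -/
abbrev Decoration (d : ℕ) := List ℕ → MarkedSpace d

namespace Decoration

variable {d : ℕ} (D : Decoration d)

open Classical in
/-- The point `z` of `D p`, as a point of the product of all the subdecorations: at each strict
prefix `q` of `p` the coordinate is the marked point of `D q` over which `p` sits, at `p` it is
`z`, and everywhere else it is the root. In particular the mark `ℓ` of `D p` and the root of
`D (p ++ [ℓ])` are the same point. -/
def embed (p : List ℕ) (z : (D p).carrier) : ∀ q, (D q).carrier :=
  Function.update
    (fun q => if q <+: p then (D q).mark (p.getD q.length 0) else (D q).root) p z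

/-- The glued subdecorated space: the union of all the embedded subdecorations. -/
def GluedStar : Type := {y : ∀ q, (D q).carrier // ∃ p z, y = D.embed p z}

/-- The inclusion of a subdecoration in the glued subdecorated space. -/
def incl (p : List ℕ) (z : (D p).carrier) : D.GluedStar := ⟨D.embed p z, p, z, rfl⟩

theorem embed_of_not_prefix {p q : List ℕ} (z : (D p).carrier) (h : ¬ q <+: p) :
    D.embed p z q = (D q).root := by
  have hne : q ≠ p := by
    rintro rfl
    exact h List.prefix_rfl
  simp [embed, Function.update_of_ne hne, h]

theorem finite_support (y y' : D.GluedStar) :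
    (Function.support fun q => dist (y.1 q) (y'.1 q)).Finite := by
  obtain ⟨y, p, z, rfl⟩ := y
  obtain ⟨y', p', z', rfl⟩ := y'
  refine Set.Finite.subset ((p.inits ++ p'.inits).toFinset.finite_toSet) fun q hq => ?_
  by_contra hcon
  simp only [List.coe_toFinset, List.mem_append, List.mem_inits, Set.mem_ofPred_eq, not_or] at hcon
  apply hq
  simp [D.embed_of_not_prefix z hcon.1, D.embed_of_not_prefix z' hcon.2]

theorem summable_dist (y y' : D.GluedStar) : Summable fun q => dist (y.1 q) (y'.1 q) :=
  summable_of_hasFiniteSupport (D.finite_support y y')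

/-- The distance of the glued subdecorated space is the `ℓ¹`-distance of the coordinates (the sum
has finitely many nonzero terms): one adds up the distances covered in the subdecorations on the
way from one point to the other. -/
instance : MetricSpace D.GluedStar where
  dist y y' := ∑' q, dist (y.1 q) (y'.1 q)
  dist_self y := by simp
  dist_comm y y' := by simp only [dist_comm]
  dist_triangle y y' y'' := by
    rw [← (D.summable_dist y y').tsum_add (D.summable_dist y' y'')]
    exact (D.summable_dist y y'').tsum_le_tsum (fun q => dist_triangle _ _ _)
      ((D.summable_dist y y').add (D.summable_dist y' y''))
  eq_of_dist_eq_zero {y y'} h := by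
    apply Subtype.ext
    funext q
    have h0 := ((D.summable_dist y y').hasSum_iff.mpr h)
    rw [hasSum_zero_iff_of_nonneg (fun q => dist_nonneg)] at h0
    exact dist_eq_zero.mp (congrFun h0 q)

/-- The glued decoration: the Cauchy completion of the glued subdecorated space, with the root of
`D []`, and with the sum over `p` of the images of the measures of the subdecorations. -/
def glued : PMMSpace d where
  carrier := UniformSpace.Completion D.GluedStar
  metric := inferInstance
  root := ((D.incl [] (D []).root : D.GluedStar) : UniformSpace.Completion D.GluedStar)
  mass j := @Measure.sum _ _ (borel (UniformSpace.Completion D.GluedStar)) fun p : List ℕ =>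
    @Measure.map _ _ (borel (D p).carrier) (borel (UniformSpace.Completion D.GluedStar))
      (fun z => (D.incl p z : UniformSpace.Completion D.GluedStar)) ((D p).mass j)

end Decoration

/-! ### Random walks and their excursions -/

/-- Finite `ℤ^d`-valued paths `(X(0), …, X(n))`. -/
def Path (d : ℕ) : Type := Σ n : ℕ, (Fin (n + 1) → Fin d → ℤ)

instance (d : ℕ) : MeasurableSpace (Path d) := ⊤

instance (d : ℕ) : Countable (Path d) :=
  inferInstanceAs (Countable (Σ n : ℕ, (Fin (n + 1) → Fin d → ℤ)))

/-- The length `n` of the path `(X(0), …, X(n))`. -/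
def Path.len {d : ℕ} (w : Path d) : ℕ := w.1

/-- The value `X^j(m)`, for `m ≤ n` (and `X^j(n)` for `m > n`). -/
def Path.val {d : ℕ} (w : Path d) (m : ℕ) (j : Fin d) : ℤ :=
  w.2 ⟨min m w.1, by omega⟩ j

variable {d : ℕ}

/-- The walk `X^i(m) = ∑_{k < m} (ξ_k - ε_i)`. -/
def walk (i : Fin d) (ξ : ℕ → Fin d → ℕ) (m : ℕ) (j : Fin d) : ℤ :=
  ∑ k ∈ Finset.range m, ((ξ k j : ℤ) - if j = i then 1 else 0)

/-- The hitting time `τ^i(1)` of `-1` by the `i`-th coordinate (`0` if there is none). -/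
def hit (i : Fin d) (ξ : ℕ → Fin d → ℕ) : ℕ := sInf {m | walk i ξ m i = -1}

/-- The excursion `(X^i(m); m = 0, …, τ^i(1))`. -/
def excursion (i : Fin d) (ξ : ℕ → Fin d → ℕ) : Path d :=
  ⟨hit i ξ, fun m => walk i ξ m⟩

theorem measurable_walk (i : Fin d) (m : ℕ) (j : Fin d) :
    Measurable fun ξ : ℕ → Fin d → ℕ => walk i ξ m j := by
  unfold walk
  refine Finset.measurable_sum _ fun k _ => ?_
  have h : Measurable fun ξ : ℕ → Fin d → ℕ => ξ k j :=
    (measurable_pi_apply j).comp (measurable_pi_apply k)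
  exact (measurable_from_top (f := fun x : ℕ => (x : ℤ) - if j = i then 1 else 0)).comp h

theorem measurable_hit (i : Fin d) : Measurable fun ξ : ℕ → Fin d → ℕ => hit i ξ := by
  have hm : ∀ m, MeasurableSet {ξ : ℕ → Fin d → ℕ | walk i ξ m i = -1} := fun m =>
    measurable_walk i m i (measurableSet_singleton _)
  refine measurable_to_countable' fun n => ?_
  have : (fun ξ : ℕ → Fin d → ℕ => hit i ξ) ⁻¹' {n} =
      {ξ | (walk i ξ n i = -1 ∧ ∀ m < n, ¬ walk i ξ m i = -1) ∨
        (n = 0 ∧ ∀ m, ¬ walk i ξ m i = -1)} := by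
    ext ξ
    simp only [Set.mem_preimage, Set.mem_singleton_iff, Set.mem_ofPred_eq]
    constructor
    · rintro rfl
      by_cases hne : {m | walk i ξ m i = -1}.Nonempty
      · exact Or.inl ⟨Nat.sInf_mem hne, fun m hm => Nat.notMem_of_lt_sInf hm⟩
      · rw [Set.not_nonempty_iff_eq_empty] at hne
        exact Or.inr ⟨by simp [hit, hne], fun m hm => by
          have : m ∈ {m | walk i ξ m i = -1} := hm
          rw [hne] at this
          exact this⟩
    · rintro (⟨h1, h2⟩ | ⟨rfl, h⟩)
      · apply le_antisymm (Nat.sInf_le h1)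
        by_contra hlt
        exact h2 _ (not_le.mp hlt) (Nat.sInf_mem (s := {m | walk i ξ m i = -1}) ⟨n, h1⟩)
      · have : {m | walk i ξ m i = -1} = ∅ := Set.eq_empty_iff_forall_notMem.mpr h
        simp [hit, this]
  rw [this]
  have h1 : MeasurableSet {ξ : ℕ → Fin d → ℕ | ∀ m < n, ¬ walk i ξ m i = -1} := by
    have : {ξ : ℕ → Fin d → ℕ | ∀ m < n, ¬ walk i ξ m i = -1} =
        ⋂ m : ℕ, ⋂ _ : m < n, {ξ | walk i ξ m i = -1}ᶜ := by ext; simp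
    rw [this]
    exact MeasurableSet.iInter fun m => MeasurableSet.iInter fun _ => (hm m).compl
  have h2 : MeasurableSet {ξ : ℕ → Fin d → ℕ | ∀ m, ¬ walk i ξ m i = -1} := by
    have : {ξ : ℕ → Fin d → ℕ | ∀ m, ¬ walk i ξ m i = -1} =
        ⋂ m, {ξ | walk i ξ m i = -1}ᶜ := by ext; simp
    rw [this]
    exact MeasurableSet.iInter fun m => (hm m).compl
  exact ((hm n).inter h1).union ((MeasurableSet.const _).inter h2)

theorem measurable_excursion (i : Fin d) : Measurable (excursion i) := by
  refine measurable_to_countable' ?_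
  rintro ⟨n, x⟩
  have : excursion i ⁻¹' {⟨n, x⟩} =
      {ξ | hit i ξ = n} ∩ ⋂ m : Fin (n + 1), ⋂ j, {ξ | walk i ξ m j = x m j} := by
    ext ξ
    simp only [Set.mem_preimage, Set.mem_singleton_iff, Set.mem_inter_iff, Set.mem_ofPred_eq,
      Set.mem_iInter]
    constructor
    · intro h
      have h1 : hit i ξ = n := congrArg Sigma.fst h
      subst h1
      have h2 := eq_of_heq (Sigma.mk.inj h).2
      exact ⟨rfl, fun m j => congrFun (congrFun h2 m) j⟩
    · rintro ⟨rfl, h⟩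
      exact congrArg (Sigma.mk _) (funext fun m => funext fun j => h m j)
  rw [this]
  exact (measurable_hit i (measurableSet_singleton n)).inter
    (MeasurableSet.iInter fun m => MeasurableSet.iInter fun j =>
      measurable_walk i m j (measurableSet_singleton _))

/-- The excursion measure: the law of `(X^i(m); m = 0, …, τ^i(1))` when the steps of the walk are
`ξ_k - ε_i` with `ξ_0, ξ_1, …` i.i.d. of law `φ i`. -/
def excursionLaw (φ : Fin d → PMF (Fin d → ℕ)) (i : Fin d) : Measure (Path d) :=
  (Measure.infinitePi fun _ : ℕ => (φ i).toMeasure).map (excursion i)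

instance (φ : Fin d → PMF (Fin d → ℕ)) (i : Fin d) : IsProbabilityMeasure (excursionLaw φ i) :=
  Measure.isProbabilityMeasure_map (measurable_excursion i).aemeasurable

/-! ### Subdecorations -/

/-- The vertices `v_0, v_1, …, v_n` of the planted tree coded by a path of length `n`: `v_0` is the
planted root, and `v_1, …, v_n` are the vertices of the tree in depth-first order. -/
abbrev Path.Vertex (w : Path d) := Fin (w.len + 1)

open Classical in
/-- The index of the parent of `v_m`, `m ≥ 1`, in the planted tree whose Łukasiewicz path is
`X = X^i`. For `1 ≤ k < m`, `v_k` is an ancestor of `v_m` in the tree if and only if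
`X(k - 1) = min {X(r) : k - 1 ≤ r ≤ m - 1}`; the parent of `v_m` is the last ancestor, and it is
`v_0` if there is none, that is, if `m = 1`. -/
def Path.parent (w : Path d) (i : Fin d) (m : ℕ) : ℕ :=
  Nat.findGreatest (fun k => 1 ≤ k ∧ ∀ r, k - 1 ≤ r → r ≤ m - 1 → w.val (k - 1) i ≤ w.val r i)
    (m - 1)

/-- The planted tree whose Łukasiewicz path is the `i`-th coordinate of the path. -/
def Path.graph (w : Path d) (i : Fin d) : SimpleGraph w.Vertex :=
  SimpleGraph.fromRel fun a b => b ≠ 0 ∧ (a : ℕ) = w.parent i b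

theorem Path.graph_connected (w : Path d) (i : Fin d) : (w.graph i).Connected := by
  have key : ∀ m : ℕ, ∀ h : m < w.len + 1, (w.graph i).Reachable ⟨m, h⟩ 0 := by
    intro m
    induction m using Nat.strong_induction_on with
    | _ m ih =>
      intro h
      rcases Nat.eq_zero_or_pos m with rfl | hm
      · exact SimpleGraph.Reachable.refl _
      · have hlt : w.parent i m < m := by
          have : w.parent i m ≤ m - 1 := Nat.findGreatest_le _
          omega
        refine SimpleGraph.Reachable.trans ?_ (ih _ hlt (by omega))
        apply SimpleGraph.Adj.reachable
        rw [Path.graph, SimpleGraph.fromRel_adj]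
        refine ⟨fun hh => ?_, Or.inr ⟨fun hh => ?_, rfl⟩⟩
        · have := congrArg Fin.val hh
          simp only at this
          omega
        · have := congrArg Fin.val hh
          simp only [Fin.val_zero] at this
          omega
  have _ : Nonempty w.Vertex := ⟨0⟩
  exact ⟨fun u v => (key u u.2).trans (key v v.2).symm⟩

/-- The tuple `L_j` containing, for `m = 1, …, n` in this order, the vertex `v_m` exactly
`X^j(m) - X^j(m-1)` many times. -/
def Path.slots (w : Path d) (j : Fin d) : List w.Vertex :=
  (List.finRange w.len).flatMap fun m : Fin w.len =>
    List.replicate (w.val ((m : ℕ) + 1) j - w.val m j).toNat m.succ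

/-- The data of a subdecoration of type `i`: a path `X`, and for each `j ≠ i` a permutation `π^j`
of the positions in the tuple `L_j`. -/
structure Sample (d : ℕ) (i : Fin d) where
  /-- the path `X` -/
  path : Path d
  /-- the permutations `π^j` -/
  perm : ∀ j : {j // j ≠ i}, Equiv.Perm (Fin (path.slots j).length)

instance (i : Fin d) : MeasurableSpace (Sample d i) := ⊤

/-- The law of a subdecoration of type `i`: the path is drawn from the excursion measure and, given
the path, the permutations are independent and uniform. -/
def sampleLaw (φ : Fin d → PMF (Fin d → ℕ)) (i : Fin d) : Measure (Sample d i) :=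
  (excursionLaw φ i).bind fun w =>
    ((PMF.uniformOfFintype (∀ j : {j // j ≠ i}, Equiv.Perm (Fin (w.slots j).length))).map
      (fun π => (⟨w, π⟩ : Sample d i))).toMeasure

instance (φ : Fin d → PMF (Fin d → ℕ)) (i : Fin d) : IsProbabilityMeasure (sampleLaw φ i) :=
  isProbabilityMeasure_bind measurable_from_top.aemeasurable (Filter.Eventually.of_forall
    fun _ => PMF.toMeasure.isProbabilityMeasure _)

/-- The number of points of a subdecoration, the planted root included. -/
def Sample.size {i : Fin d} (c : Sample d i) : ℕ := Fintype.card c.path.Vertex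

/-- The number of marked points of type `j ≠ i` of a subdecoration of type `i`. -/
def Sample.numSlots {i : Fin d} (c : Sample d i) (j : Fin d) : ℕ := (c.path.slots j).length

/-- The type `j` of a letter `ℓ = j + m d` of the Ulam tree. -/
def letterType (i : Fin d) (ℓ : ℕ) : Fin d := ⟨ℓ % d, Nat.mod_lt _ i.pos⟩

/-- The subdecoration of type `i`: the planted tree with its graph distance, the planted root, the
counting measure on `v_1, …, v_n` as `i`-th measure and null measures otherwise; if
`ℓ = j + m d` with `j ≠ i` and `m < #L_j`, the mark `x_ℓ` is the entry number `π^j(m)` of `L_j`,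
and all the other marks are the planted root. -/
def Sample.space {i : Fin d} (c : Sample d i) : MarkedSpace d where
  toPMMSpace := graphSpace (c.path.graph i) (c.path.graph_connected i) 0
    (fun j => {v | v ≠ 0 ∧ j = i})
  mark ℓ :=
    if h : letterType i ℓ ≠ i ∧ ℓ / d < (c.path.slots (letterType i ℓ)).length then
      (c.path.slots (letterType i ℓ)).get (c.perm ⟨letterType i ℓ, h.1⟩ ⟨ℓ / d, h.2⟩)
    else (0 : c.path.Vertex)

/-- The trivial subdecoration: one point and null measures. -/
def trivialSpace (d : ℕ) : MarkedSpace d where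
  carrier := Unit
  metric := inferInstance
  root := ()
  mass _ := 0
  mark _ := ()

/-! ### The random decoration -/

/-- A rule for arranging finitely many subdecorations of type `j` in decreasing order of their
cardinality, with ties broken arbitrarily: the `m`-th subdecoration in the new order is
`s (perm j n s m)`. The ties may be broken by looking at the whole subdecorations, marks included.
(The rule is automatically measurable, since the set of samples is countable.) -/
structure SortRule (d : ℕ) where
  /-- the arrangement -/
  perm (j : Fin d) (n : ℕ) (s : Fin n → Sample d j) : Equiv.Perm (Fin n)
  /-- the cardinalities decrease -/
  antitone (j : Fin d) (n : ℕ) (s : Fin n → Sample d j) :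
    Antitone fun m => (s (perm j n s m)).size

/-- The randomness of the decoration: a sample `D(∅)` of type `i₀`, and for each `p`, each type `j`
and each `m` a sample `X^j_{p,m}` of type `j`. -/
abbrev Samples (d : ℕ) (i₀ : Fin d) : Type :=
  Sample d i₀ × (∀ a : List ℕ × Fin d × ℕ, Sample d a.2.1)

/-- All the samples are independent. -/
def samplesLaw (φ : Fin d → PMF (Fin d → ℕ)) (i₀ : Fin d) : Measure (Samples d i₀) :=
  (sampleLaw φ i₀).prod (Measure.infinitePi fun a : List ℕ × Fin d × ℕ => sampleLaw φ a.2.1)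

/-- The subdecoration (`none` for the trivial one) at the `ℓ`-th child of `p`, given the one at `p`.
If the latter has type `i`, if `ℓ = j + m d` with `j ≠ i`, and if there are `K > m` marked points of
type `j`, one takes the entry number `m` in the decreasing rearrangement of `X^j_{p,0}, …,
X^j_{p,K-1}`; otherwise the child is trivial. -/
def childSample (σ : SortRule d) (s : ∀ a : List ℕ × Fin d × ℕ, Sample d a.2.1) (p : List ℕ) :
    Option (Σ i, Sample d i) → ℕ → Option (Σ i, Sample d i)
  | none, _ => none
  | some ⟨i, c⟩, ℓ =>
    if h : letterType i ℓ ≠ i ∧ ℓ / d < c.numSlots (letterType i ℓ) then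
      some ⟨letterType i ℓ, s (p, letterType i ℓ,
        σ.perm (letterType i ℓ) (c.numSlots (letterType i ℓ))
          (fun k => s (p, letterType i ℓ, k)) ⟨ℓ / d, h.2⟩)⟩
    else none

/-- The subdecoration at `p ++ q`, given the subdecoration `x` at `p`. -/
def descend (σ : SortRule d) (s : ∀ a : List ℕ × Fin d × ℕ, Sample d a.2.1) :
    List ℕ → Option (Σ i, Sample d i) → List ℕ → Option (Σ i, Sample d i)
  | _, x, [] => x
  | p, x, ℓ :: q => descend σ s (p ++ [ℓ]) (childSample σ s p x ℓ) q

/-- The random decoration started from type `i₀`. -/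
def decoration (σ : SortRule d) {i₀ : Fin d} (s : Samples d i₀) : Decoration d := fun p =>
  match descend σ s.2 [] (some ⟨i₀, s.1⟩) p with
  | none => trivialSpace d
  | some ⟨_, c⟩ => c.space

/-! ### Multitype Bienaymé-Galton-Watson trees -/

/-- A multitype plane tree, possibly infinite, in which each vertex has finitely many children:
`label v` is the type of the word `v` if it is a vertex of the tree, and `none` otherwise. The
children of `v` are `v ++ [0], …, v ++ [n - 1]`. -/
structure MultitypeTree (d : ℕ) where
  /-- the type of a vertex, `none` off the tree -/
  label : List ℕ → Option (Fin d)
  /-- the root is a vertex -/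
  root_mem : label [] ≠ none
  /-- the parent of a vertex is a vertex -/
  parent_mem : ∀ v k, label (v ++ [k]) ≠ none → label v ≠ none
  /-- a vertex has finitely many children, numbered consecutively -/
  children : ∀ v, label v ≠ none → ∃ n, ∀ k, label (v ++ [k]) ≠ none ↔ k < n

namespace MultitypeTree

/-- The σ-field generated by the events "`v` is a vertex of type `i`". -/
instance : MeasurableSpace (MultitypeTree d) :=
  MeasurableSpace.comap label (@MeasurableSpace.pi (List ℕ) (fun _ => Option (Fin d)) fun _ => ⊤)

/-- The vertices of the tree. -/
abbrev Vertex (t : MultitypeTree d) : Type := {v : List ℕ // t.label v ≠ none}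

/-- The type of a vertex. -/
def type (t : MultitypeTree d) (v : t.Vertex) : Fin d :=
  (t.label v.1).get (Option.isSome_iff_ne_none.mpr v.2)

/-- The vector of the numbers of children of `v` of each type. -/
def childVector (t : MultitypeTree d) (v : List ℕ) (j : Fin d) : ℕ :=
  Set.ncard {k | t.label (v ++ [k]) = some j}

/-- The two trees have the same vertices, with the same types, up to generation `n`. -/
def AgreeUpTo (n : ℕ) (t t' : MultitypeTree d) : Prop :=
  ∀ v : List ℕ, v.length ≤ n → t.label v = t'.label v

/-- The planted tree: the tree with an additional vertex `none`, joined to the root. -/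
def plantedGraph (t : MultitypeTree d) : SimpleGraph (Option t.Vertex) :=
  SimpleGraph.fromRel fun a b =>
    match a, b with
    | none, some v => v.1 = []
    | some u, some v => ∃ k, v.1 = u.1 ++ [k]
    | _, none => False

theorem plantedGraph_connected (t : MultitypeTree d) : t.plantedGraph.Connected := by
  have key : ∀ v : List ℕ, ∀ h : t.label v ≠ none, t.plantedGraph.Reachable (some ⟨v, h⟩) none := by
    intro v
    induction v using List.reverseRecOn with
    | nil =>
      intro h
      apply SimpleGraph.Adj.reachable
      simp [plantedGraph, SimpleGraph.fromRel_adj]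
    | append_singleton u k ih =>
      intro h
      refine SimpleGraph.Reachable.trans ?_ (ih (t.parent_mem u k h))
      apply SimpleGraph.Adj.reachable
      simp [plantedGraph, SimpleGraph.fromRel_adj]
  have _ : Nonempty (Option t.Vertex) := ⟨none⟩
  have key' : ∀ a, t.plantedGraph.Reachable a none := by
    rintro (_ | ⟨v, h⟩)
    · exact SimpleGraph.Reachable.refl _
    · exact key v h
  exact ⟨fun a b => (key' a).trans (key' b).symm⟩

/-- The planted tree as a metric measure space: the graph distance, the additional vertex as root,
and for each `j` the counting measure on the vertices of type `j`. -/
def planted (t : MultitypeTree d) : PMMSpace d :=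
  graphSpace t.plantedGraph t.plantedGraph_connected none
    (fun j => {a | ∃ v : t.Vertex, a = some v ∧ t.type v = j})

end MultitypeTree

/-- `T` is a multitype Bienaymé-Galton-Watson tree with offspring distribution `φ` started from one
individual of type `i₀`: the root has type `i₀` and, for each `n`, conditionally on the tree up to
generation `n`, the child vectors of the vertices of generation `n` are independent, the one of a
vertex of type `i` having law `φ i`. -/
structure IsMBGW {Ω : Type*} [MeasurableSpace Ω] (φ : Fin d → PMF (Fin d → ℕ)) (i₀ : Fin d)
    (P : Measure Ω) (T : Ω → MultitypeTree d) : Prop where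
  measurable : Measurable T
  root_type : ∀ᵐ ω ∂P, (T ω).label [] = some i₀
  branching : ∀ (n : ℕ) (t : MultitypeTree d) (c : List ℕ → Fin d → ℕ),
    P {ω | (T ω).AgreeUpTo n t ∧
        ∀ v : t.Vertex, v.1.length = n → (T ω).childVector v.1 = c v.1} =
      P {ω | (T ω).AgreeUpTo n t} *
        ∏ᶠ v : {v : t.Vertex // v.1.length = n}, φ (t.type v.1) (c v.1.1)

/-- The matrix of the means `E[ξ^{i,j}]`. -/
def meanMatrix (φ : Fin d → PMF (Fin d → ℕ)) : Matrix (Fin d) (Fin d) ℝ :=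
  fun i j => ∫ x, (x j : ℝ) ∂(φ i).toMeasure

/-- The Perron-Frobenius eigenvalue of a nonnegative matrix, that is, its spectral radius. -/
def perronEigenvalue (M : Matrix (Fin d) (Fin d) ℝ) : ENNReal :=
  spectralRadius ℂ (M.map (fun x : ℝ => (x : ℂ)))

/-- Subcritical or critical offspring distributions: the means exist, the mean matrix is
irreducible, some type does not have exactly one child almost surely, and the Perron-Frobenius
eigenvalue of the mean matrix is at most `1`. -/
structure IsSubcriticalOrCritical (φ : Fin d → PMF (Fin d → ℕ)) : Prop where
  integrable : ∀ i j, Integrable (fun x : Fin d → ℕ => (x j : ℝ)) (φ i).toMeasure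
  irreducible : ∀ i j, ∃ n : ℕ, 0 < (meanMatrix φ ^ n) i j
  nondegenerate : ∃ i, (φ i).toMeasure {x | ∑ j, x j = 1} < 1
  perron_le_one : perronEigenvalue (meanMatrix φ) ≤ 1

end

end MBGW

/-!
Both random spaces are almost surely encoded by a finite tree, and the two encoding trees have the
same law.

Forget the order of siblings of different types: `FTree d` consists of the finite trees in which
the children of a vertex are sorted by type, and `FTree.weight φ τ i` is the product of the
offspring probabilities over the vertices of `τ`, its root having type `i`. The isomorphism class
of a planted tree depends on the sorted tree only; this is the content of the structure `Coding`
and of `Coding.iso`. A Galton-Watson tree unfolds to `τ` with probability `FTree.weight φ τ i₀`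
(`IsMBGW.prob_unfolds`, by induction over the generations).

The decoration takes a finite tree apart: the vertices that are joined to the root of `τ` by
vertices of the type `i` of the root only form a plane tree, coded by the excursion, and its
vertices carry, as children of the other types `j`, the roots of the trees of the list `slotTrees`.
The predicate `Realizes` says that the samples of the decoration fit together to `τ` in this way.
It has again probability `FTree.weight φ τ i₀` (`lintegral_realizeProb`): the excursion has the
correct law by `excursionLaw_path`, and given the excursion, the attached subdecorations are i.i.d.
for each type. They are rearranged by their cardinalities, but the uniform permutations `π^j` of
the slots absorb every arrangement that is a function of the subdecorations only
(`sum_perm_arrange`), so that the subtrees at the slots are independent. A decoration which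
realizes `τ` glues to the planted tree of `τ` (`Realizes.coding`); the argument uses that a
distance in a tree is determined by the parent map (`IsTreeMetric`), and that moving from a point
to its parent changes a single coordinate of the glued space (`Decoration.isTreeMetric_star`).

It remains to see that these countably many disjoint events have total probability one, that is,
`∑ τ, FTree.weight φ τ i = 1` (`tsum_weight_eq_one`). The vector `u` of the numbers
`u i = 1 - ∑ τ, FTree.weight φ τ i` is nonnegative, because a probability measure carries disjoint
events with these probabilities (`tsum_weight_le_one`), and it solves the survival equation
`1 - u i = E ∏ j, (1 - u j) ^ ξ j` with `ξ` of law `φ i`, which gives `u ≤ M u`. Since `M` is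
irreducible of spectral radius at most one, Gelfand's formula forces `u = M u`
(`mulVec_eq_self_of_le`), and irreducibility forces `u = 0` or `u > 0`. In the latter case, `u = M u`
means equality in the Bernoulli inequality, so that no individual has more than one child; the
maximum principle then makes `u` constant and all row sums of `M` equal to one, and every individual
has exactly one child almost surely, which is excluded (`survival_eq_zero`).
-/

namespace MBGW

noncomputable section

open scoped ENNReal NNReal

/-! ### Subinvariant vectors of irreducible nonnegative matrices -/

section PerronFrobenius

variable {d : ℕ}

attribute [local instance] Matrix.linftyOpNormedRing Matrix.linftyOpNormedAlgebra in
/-- By Gelfand's formula, a nonnegative vector that is multiplied by at least `r > 1` in each step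
forces the spectral radius above `1`. -/
theorem eq_zero_of_perronEigenvalue_le_one {M : Matrix (Fin d) (Fin d) ℝ}
    (hM : ∀ i j, 0 ≤ M i j) (hρ : perronEigenvalue M ≤ 1) {r : ℝ} (hr : 1 < r) {v : Fin d → ℝ}
    (hv : ∀ i, 0 ≤ v i) (hle : ∀ i, r * v i ≤ M.mulVec v i) (i : Fin d) : v i = 0 := by
  by_contra hne
  have hvi : 0 < v i := lt_of_le_of_ne (hv i) (Ne.symm hne)
  set A : Matrix (Fin d) (Fin d) ℂ := M.map (fun x : ℝ => (x : ℂ)) with hA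
  have hpow0 : ∀ n : ℕ, ∀ a b, 0 ≤ (M ^ n) a b := by
    intro n
    induction n with
    | zero => intro a b; by_cases h : a = b <;> simp [h]
    | succ n ih =>
      intro a b
      rw [pow_succ, Matrix.mul_apply]
      exact Finset.sum_nonneg fun c _ => mul_nonneg (ih a c) (hM c b)
  have hgrow : ∀ n : ℕ, ∀ a, r ^ n * v a ≤ (M ^ n).mulVec v a := by
    intro n
    induction n with
    | zero => intro a; simp
    | succ n ih =>
      intro a
      rw [pow_succ M, ← Matrix.mulVec_mulVec, pow_succ, mul_assoc]
      calc r ^ n * (r * v a) = r * (r ^ n * v a) := by ring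
        _ ≤ r * (M ^ n).mulVec v a := by
          have := ih a
          gcongr
        _ = ∑ b, (M ^ n) a b * (r * v b) := by
          simp only [Matrix.mulVec, dotProduct, Finset.mul_sum]
          exact Finset.sum_congr rfl fun b _ => by ring
        _ ≤ _ := Finset.sum_le_sum fun b _ => mul_le_mul_of_nonneg_left (hle b) (hpow0 n a b)
  obtain ⟨C, hC⟩ : ∃ C, ∀ a, v a ≤ C :=
    ⟨∑ a, v a, fun a => Finset.single_le_sum (fun b _ => hv b) (Finset.mem_univ a)⟩
  have hC0 : 0 < C := hvi.trans_le (hC i)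
  -- in the operator norm for the supremum norm, which is the largest row sum of absolute values
  have hnorm : ∀ n : ℕ, r ^ n * (v i / C) ≤ ‖A ^ n‖ := by
    intro n
    have hAn : A ^ n = (M ^ n).map (fun x : ℝ => (x : ℂ)) :=
      (map_pow (Complex.ofRealHom.mapMatrix) M n).symm
    have h1 : ∑ b, (M ^ n) i b ≤ ‖A ^ n‖ := by
      rw [Matrix.linfty_opNorm_def]
      have : (∑ b, ‖(A ^ n) i b‖₊ : ℝ≥0) ≤
          Finset.univ.sup fun a => ∑ b, ‖(A ^ n) a b‖₊ :=
        Finset.le_sup (f := fun a => ∑ b, ‖(A ^ n) a b‖₊) (Finset.mem_univ i)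
      refine le_trans ?_ (NNReal.coe_le_coe.mpr this)
      rw [NNReal.coe_sum]
      refine Finset.sum_le_sum fun b _ => ?_
      rw [hAn]
      simp only [Matrix.map_apply, coe_nnnorm, Complex.norm_real]
      exact le_abs_self _
    have h2 : (M ^ n).mulVec v i ≤ (∑ b, (M ^ n) i b) * C := by
      rw [Finset.sum_mul, Matrix.mulVec, dotProduct]
      exact Finset.sum_le_sum fun b _ => mul_le_mul_of_nonneg_left (hC b) (hpow0 n i b)
    rw [← mul_div_assoc, div_le_iff₀ hC0]
    exact (hgrow n i).trans (h2.trans (mul_le_mul_of_nonneg_right h1 hC0.le))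
  have hlim := spectrum.pow_norm_pow_one_div_tendsto_nhds_spectralRadius A
  -- for `1 < r' < r`, Gelfand's formula gives `‖A ^ n‖ < r' ^ n` for large `n`, whereas
  -- `(r / r') ^ n` tends to infinity
  obtain ⟨r', hr1, hr2⟩ := exists_between hr
  have hev : ∀ᶠ n : ℕ in Filter.atTop,
      ENNReal.ofReal (‖A ^ n‖ ^ (1 / n : ℝ)) < ENNReal.ofReal r' := by
    refine hlim.eventually_lt_const (lt_of_le_of_lt hρ ?_)
    rw [← ENNReal.ofReal_one]
    exact (ENNReal.ofReal_lt_ofReal_iff (by linarith)).mpr hr1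
  have htend : Filter.Tendsto (fun n : ℕ => (r / r') ^ n) Filter.atTop Filter.atTop :=
    tendsto_pow_atTop_atTop_of_one_lt (by rw [one_lt_div (by linarith)]; exact hr2)
  obtain ⟨n, hn1, hn2, hn3⟩ := (hev.and ((htend.eventually_gt_atTop (C / v i)).and
    (Filter.eventually_gt_atTop 0))).exists
  rw [ENNReal.ofReal_lt_ofReal_iff (by linarith)] at hn1
  have h3 : ‖A ^ n‖ < r' ^ n := by
    have := pow_lt_pow_left₀ hn1 (by positivity) hn3.ne'
    rwa [one_div, Real.rpow_inv_natCast_pow (norm_nonneg _) hn3.ne'] at this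
  have h4 := (hnorm n).trans_lt h3
  rw [div_pow, lt_div_iff₀ (by positivity), div_mul_eq_mul_div, div_lt_iff₀ hvi] at hn2
  rw [← mul_div_assoc, div_lt_iff₀ hC0] at h4
  linarith

/-- A nonnegative vector `u ≤ M u`, where `M` is irreducible with spectral radius at most `1`, is an
eigenvector: if `M u - u` were nonzero, then `∑_{k < K} M ^ k` would map it to a positive vector,
and `∑_{k < K} M ^ k u` would be multiplied by more than `1` by `M`. -/
theorem mulVec_eq_self_of_le {M : Matrix (Fin d) (Fin d) ℝ}
    (hM : ∀ i j, 0 ≤ M i j) (hirr : ∀ i j, ∃ n : ℕ, 0 < (M ^ n) i j)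
    (hρ : perronEigenvalue M ≤ 1) {u : Fin d → ℝ}
    (hu : ∀ i, 0 ≤ u i) (hle : ∀ i, u i ≤ M.mulVec u i) (i : Fin d) : M.mulVec u i = u i := by
  by_contra hne
  have hpow0 : ∀ n : ℕ, ∀ a b, 0 ≤ (M ^ n) a b := by
    intro n
    induction n with
    | zero => intro a b; by_cases h : a = b <;> simp [h]
    | succ n ih =>
      intro a b
      rw [pow_succ, Matrix.mul_apply]
      exact Finset.sum_nonneg fun c _ => mul_nonneg (ih a c) (hM c b)
  choose N hN using hirr
  -- `K` exceeds all the exponents `N a b`, so that all the entries of `S` are positive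
  set K := (∑ a, ∑ b, N a b) + 1 with hK
  have hNK : ∀ a b, N a b < K := by
    intro a b
    have h1 : N a b ≤ ∑ b, N a b :=
      Finset.single_le_sum (f := fun b => N a b) (fun _ _ => Nat.zero_le _) (Finset.mem_univ b)
    have h2 : ∑ b, N a b ≤ ∑ a, ∑ b, N a b :=
      Finset.single_le_sum (f := fun a => ∑ b, N a b) (fun _ _ => Nat.zero_le _)
        (Finset.mem_univ a)
    omega
  set S : Matrix (Fin d) (Fin d) ℝ := ∑ k ∈ Finset.range K, M ^ k with hS
  have hSapp : ∀ a b, S a b = ∑ k ∈ Finset.range K, (M ^ k) a b := by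
    intro a b
    rw [hS, Matrix.sum_apply]
  have hS0 : ∀ a b, 0 < S a b := by
    intro a b
    rw [hSapp]
    exact Finset.sum_pos' (fun k _ => hpow0 k a b) ⟨N a b, Finset.mem_range.mpr (hNK a b), hN a b⟩
  set w : Fin d → ℝ := M.mulVec u - u with hw
  have hw0 : ∀ a, 0 ≤ w a := fun a => sub_nonneg.mpr (hle a)
  have hwi : 0 < w i := lt_of_le_of_ne (hw0 i) fun h => hne (sub_eq_zero.mp h.symm)
  have hcomm : M * S = S * M := by
    rw [hS, Finset.mul_sum, Finset.sum_mul]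
    exact Finset.sum_congr rfl fun k _ => (pow_mul_comm' M k).symm
  have hMv : M.mulVec (S.mulVec u) = S.mulVec u + S.mulVec w := by
    rw [Matrix.mulVec_mulVec, hcomm, ← Matrix.mulVec_mulVec, hw, Matrix.mulVec_sub]
    abel
  have hSu0 : ∀ a, 0 ≤ S.mulVec u a := by
    intro a
    rw [Matrix.mulVec, dotProduct]
    exact Finset.sum_nonneg fun b _ => mul_nonneg (hS0 a b).le (hu b)
  have hSw : ∀ a, S a i * w i ≤ S.mulVec w a := fun a =>
    Finset.single_le_sum (f := fun b => S a b * w b)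
      (fun b _ => mul_nonneg (hS0 a b).le (hw0 b)) (Finset.mem_univ i)
  obtain ⟨a₀, -, ha₀⟩ := Finset.exists_min_image Finset.univ (fun a => S a i * w i)
    ⟨i, Finset.mem_univ i⟩
  set δ := S a₀ i * w i
  have hδ : 0 < δ := mul_pos (hS0 _ _) hwi
  set C := ∑ a, S.mulVec u a
  have hC0 : 0 ≤ C := Finset.sum_nonneg fun a _ => hSu0 a
  have hC : ∀ a, S.mulVec u a ≤ C := fun a =>
    Finset.single_le_sum (f := fun a => S.mulVec u a) (fun b _ => hSu0 b) (Finset.mem_univ a)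
  -- `M (S u) = S u + S w ≥ S u + δ`, and `δ ≥ δ / (C + 1) * S u`
  have hz := eq_zero_of_perronEigenvalue_le_one hM hρ (r := 1 + δ / (C + 1))
    (by have : 0 < δ / (C + 1) := by positivity
        linarith) hSu0 (by
      intro a
      rw [hMv, Pi.add_apply, add_mul, one_mul]
      have h1 : δ / (C + 1) * S.mulVec u a ≤ δ := by
        rw [div_mul_eq_mul_div, div_le_iff₀ (by positivity)]
        have := hC a
        gcongr
        linarith
      have h2 := ha₀ a (Finset.mem_univ a)
      have h3 := hSw a
      linarith)
  have hzero : S.mulVec u = 0 := funext hz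
  have hpos := (hSw i).trans_lt' (mul_pos (hS0 i i) hwi)
  have := congrFun hMv i
  rw [hzero, Matrix.mulVec_zero, Pi.add_apply, Pi.zero_apply] at this
  linarith

end PerronFrobenius

/-! ### Fixed points of the generating functions -/

section GeneratingFunction

variable {d : ℕ}

theorem one_sub_prod_pow_le (u : Fin d → ℝ) (h0 : ∀ j, 0 ≤ u j) (h1 : ∀ j, u j ≤ 1)
    (x : Fin d → ℕ) : 1 - ∏ j, (1 - u j) ^ x j ≤ ∑ j, (x j : ℝ) * u j := by
  have key : ∀ s : Finset (Fin d), 1 - ∏ j ∈ s, (1 - u j) ^ x j ≤ ∑ j ∈ s, (x j : ℝ) * u j := by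
    intro s
    induction s using Finset.induction_on with
    | empty => simp
    | insert a s ha ih =>
      rw [Finset.prod_insert ha, Finset.sum_insert ha]
      have hB := one_add_mul_le_pow (a := -u a) (by linarith [h1 a]) (x a)
      have hp0 : 0 ≤ ∏ j ∈ s, (1 - u j) ^ x j :=
        Finset.prod_nonneg fun j _ => pow_nonneg (by linarith [h1 j]) _
      have hp1 : ∏ j ∈ s, (1 - u j) ^ x j ≤ 1 :=
        Finset.prod_le_one (fun j _ => pow_nonneg (by linarith [h1 j]) _)
          fun j _ => pow_le_one₀ (by linarith [h1 j]) (by linarith [h0 j])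
      have hq0 : 0 ≤ (1 - u a) ^ x a := pow_nonneg (by linarith [h1 a]) _
      have hq1 : (1 - u a) ^ x a ≤ 1 := pow_le_one₀ (by linarith [h1 a]) (by linarith [h0 a])
      have hB' : 1 - x a * u a ≤ (1 - u a) ^ x a := by
        have : 1 + (x a : ℝ) * -u a = 1 - x a * u a := by ring
        rw [← this]
        exact hB
      nlinarith [mul_nonneg (sub_nonneg.mpr hq1) (sub_nonneg.mpr hp1)]
  exact key Finset.univ

/-- Equality in the union bound forces at most one child: two children of types `a` and `b`
have survival probability `u a + u b - u a * u b`. -/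
theorem sum_le_one_of_one_sub_prod_pow_eq (u : Fin d → ℝ) (h0 : ∀ j, 0 < u j) (h1 : ∀ j, u j ≤ 1)
    (x : Fin d → ℕ) (h : 1 - ∏ j, (1 - u j) ^ x j = ∑ j, (x j : ℝ) * u j) : ∑ j, x j ≤ 1 := by
  by_contra! hlt
  obtain ⟨a, ha⟩ : ∃ a, x a ≠ 0 := by
    by_contra! hz
    simp [hz] at hlt
  set y : Fin d → ℕ := Function.update x a (x a - 1) with hy
  have hxy : ∀ j, x j = y j + if j = a then 1 else 0 := by
    intro j
    by_cases hj : j = a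
    · subst hj
      simp only [hy, Function.update_self, if_true]
      omega
    · simp [hy, hj]
  have hysum : ∑ j, x j = ∑ j, y j + 1 := by
    simp [hxy, Finset.sum_add_distrib]
  have hprod : ∏ j, (1 - u j) ^ x j = (∏ j, (1 - u j) ^ y j) * (1 - u a) := by
    have : ∀ j, (1 - u j) ^ x j = (1 - u j) ^ y j * (if j = a then (1 - u j) else 1) := by
      intro j
      rw [hxy j]
      split_ifs <;> simp [pow_succ]
    simp only [this, Finset.prod_mul_distrib]
    simp
  have hs : ∑ j, (x j : ℝ) * u j = ∑ j, (y j : ℝ) * u j + u a := by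
    have : ∀ j, (x j : ℝ) * u j = (y j : ℝ) * u j + if j = a then u j else 0 := by
      intro j
      rw [hxy j]
      split_ifs <;> push_cast <;> ring
    simp [this, Finset.sum_add_distrib]
  have hy1 := one_sub_prod_pow_le u (fun j => (h0 j).le) h1 y
  obtain ⟨b, hb⟩ : ∃ b, y b ≠ 0 := by
    by_contra! hz
    simp [hz] at hysum
    omega
  have hlt1 : ∏ j, (1 - u j) ^ y j < 1 := by
    rw [← Finset.mul_prod_erase _ _ (Finset.mem_univ b)]
    have e1 : (1 - u b) ^ y b < 1 := pow_lt_one₀ (by linarith [h1 b]) (by linarith [h0 b]) hb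
    have e2 : ∏ j ∈ Finset.univ.erase b, (1 - u j) ^ y j ≤ 1 :=
      Finset.prod_le_one (fun j _ => pow_nonneg (by linarith [h1 j]) _)
        fun j _ => pow_le_one₀ (by linarith [h1 j]) (by linarith [h0 j])
    have e3 : 0 ≤ (1 - u b) ^ y b := pow_nonneg (by linarith [h1 b]) _
    exact (mul_le_of_le_one_right e3 e2).trans_lt e1
  rw [hprod, hs] at h
  nlinarith [h0 a]

theorem integrable_of_le_one {φ : PMF (Fin d → ℕ)} {f : (Fin d → ℕ) → ℝ} (h0 : ∀ x, 0 ≤ f x)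
    (h1 : ∀ x, f x ≤ 1) : Integrable f φ.toMeasure :=
  Integrable.of_bound (measurable_of_countable f).aestronglyMeasurable 1
    (Filter.Eventually.of_forall fun x => by rw [Real.norm_of_nonneg (h0 x)]; exact h1 x)

theorem meanMatrix_nonneg (φ : Fin d → PMF (Fin d → ℕ)) (i j : Fin d) : 0 ≤ meanMatrix φ i j :=
  integral_nonneg fun _ => Nat.cast_nonneg _

/-- In an irreducible nonnegative matrix, a set of indices which contains all the successors of
its elements is empty or everything. -/
theorem forall_of_irreducible {M : Matrix (Fin d) (Fin d) ℝ}
    (hirr : ∀ i j, ∃ n : ℕ, 0 < (M ^ n) i j) {p : Fin d → Prop}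
    (hp : ∀ i j, p i → M i j ≠ 0 → p j) {i : Fin d} (hi : p i) (j : Fin d) : p j := by
  have key : ∀ n : ℕ, ∀ a b, (M ^ n) a b ≠ 0 → p a → p b := by
    intro n
    induction n with
    | zero =>
      intro a b hab ha
      by_cases h : a = b
      · exact h ▸ ha
      · simp [h] at hab
    | succ n ih =>
      intro a b hab ha
      rw [pow_succ, Matrix.mul_apply] at hab
      obtain ⟨c, -, hc⟩ := Finset.exists_ne_zero_of_sum_ne_zero hab
      exact hp c b (ih a c (left_ne_zero_of_mul hc) ha) (right_ne_zero_of_mul hc)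
  obtain ⟨n, hn⟩ := hirr i j
  exact key n i j hn.ne' hi

/-- In the subcritical and critical cases the only vector `u ∈ [0, 1]^d` of survival probabilities
compatible with the generating functions is `0`. -/
theorem survival_eq_zero {φ : Fin d → PMF (Fin d → ℕ)} (hφ : IsSubcriticalOrCritical φ)
    (u : Fin d → ℝ) (h0 : ∀ j, 0 ≤ u j) (h1 : ∀ j, u j ≤ 1)
    (hfix : ∀ i, u i = ∫ x, (1 - ∏ j, (1 - u j) ^ x j) ∂(φ i).toMeasure) (i : Fin d) :
    u i = 0 := by
  by_contra hne
  set M := meanMatrix φ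
  have hf0 : ∀ x : Fin d → ℕ, 0 ≤ 1 - ∏ j, (1 - u j) ^ x j := fun x =>
    sub_nonneg.mpr (Finset.prod_le_one (fun j _ => pow_nonneg (by linarith [h1 j]) _)
      fun j _ => pow_le_one₀ (by linarith [h1 j]) (by linarith [h0 j]))
  have hf1 : ∀ x : Fin d → ℕ, 1 - ∏ j, (1 - u j) ^ x j ≤ 1 := fun x =>
    sub_le_self _ (Finset.prod_nonneg fun j _ => pow_nonneg (by linarith [h1 j]) _)
  have hfint : ∀ i, Integrable (fun x : Fin d → ℕ => 1 - ∏ j, (1 - u j) ^ x j)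
      (φ i).toMeasure := fun i => integrable_of_le_one hf0 hf1
  have hgint : ∀ i, Integrable (fun x : Fin d → ℕ => ∑ j, (x j : ℝ) * u j) (φ i).toMeasure :=
    fun i => integrable_finsetSum _ fun j _ => (hφ.integrable i j).mul_const _
  have hg : ∀ i, ∫ x, ∑ j, (x j : ℝ) * u j ∂(φ i).toMeasure = M.mulVec u i := by
    intro i
    rw [integral_finsetSum _ fun j _ => (hφ.integrable i j).mul_const _, Matrix.mulVec, dotProduct]
    exact Finset.sum_congr rfl fun j _ => integral_mul_const _ _
  have hle : ∀ i, u i ≤ M.mulVec u i := by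
    intro i
    rw [hfix i, ← hg i]
    exact integral_mono (hfint i) (hgint i) fun x => one_sub_prod_pow_le u h0 h1 x
  have heq := mulVec_eq_self_of_le (meanMatrix_nonneg φ) hφ.irreducible hφ.perron_le_one h0 hle
  -- the relation `u = M u` passes `u b = 0` on to the types of the possible children of `b`
  have hpos : ∀ a, 0 < u a := by
    intro a
    by_contra ha
    refine hne (forall_of_irreducible hφ.irreducible (p := fun b => u b = 0) ?_
      (le_antisymm (not_lt.mp ha) (h0 a)) i)
    intro b c hb hbc
    have hs := heq b
    rw [hb, Matrix.mulVec, dotProduct] at hs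
    have := (Finset.sum_eq_zero_iff_of_nonneg fun j _ =>
      mul_nonneg (meanMatrix_nonneg φ b j) (h0 j)).mp hs c (Finset.mem_univ c)
    exact (mul_eq_zero.mp this).resolve_left hbc
  -- `u = M u` means equality in the Bernoulli inequality, almost surely
  have hone : ∀ a x, φ a x ≠ 0 → ∑ j, x j ≤ 1 := by
    intro a x hx
    have hae : (fun x : Fin d → ℕ => ∑ j, (x j : ℝ) * u j - (1 - ∏ j, (1 - u j) ^ x j))
        =ᵐ[(φ a).toMeasure] 0 := by
      rw [← integral_eq_zero_iff_of_nonneg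
        (fun x => sub_nonneg.mpr (one_sub_prod_pow_le u h0 h1 x)) ((hgint a).sub (hfint a)),
        integral_sub (hgint a) (hfint a), hg, heq, ← hfix, sub_self]
    rw [Filter.EventuallyEq, ae_iff_of_countable] at hae
    have hx' := hae x (by rwa [PMF.toMeasure_apply_singleton _ _ (measurableSet_singleton x)])
    exact sum_le_one_of_one_sub_prod_pow_eq u hpos h1 x (sub_eq_zero.mp hx').symm
  have hrow : ∀ a, ∑ j, M a j = ∫ x, ((∑ j, x j : ℕ) : ℝ) ∂(φ a).toMeasure := by
    intro a
    push_cast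
    rw [integral_finsetSum _ fun j _ => hφ.integrable a j]
    rfl
  have hrowint : ∀ a, Integrable (fun x : Fin d → ℕ => ((∑ j, x j : ℕ) : ℝ)) (φ a).toMeasure := by
    intro a
    push_cast
    exact integrable_finsetSum _ fun j _ => hφ.integrable a j
  have hae1 : ∀ a, ∀ᵐ x ∂(φ a).toMeasure, ((∑ j, x j : ℕ) : ℝ) ≤ 1 := by
    intro a
    rw [ae_iff_of_countable]
    intro x hx
    rw [PMF.toMeasure_apply_singleton _ _ (measurableSet_singleton x)] at hx
    exact_mod_cast hone a x hx
  have hrow1 : ∀ a, ∑ j, M a j ≤ 1 := by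
    intro a
    rw [hrow]
    refine (integral_mono_ae (hrowint a) (integrable_const 1) (hae1 a)).trans (by simp)
  -- the maximum principle for `u = M u`, where the rows of `M` sum to at most one
  obtain ⟨m, -, hm⟩ := Finset.exists_max_image Finset.univ u ⟨i, Finset.mem_univ i⟩
  have hmax : ∀ a, u a = u m → ∑ j, M a j = 1 ∧ ∀ j, M a j ≠ 0 → u j = u m := by
    intro a ha
    have hsum : ∑ j, M a j * (u m - u j) + (1 - ∑ j, M a j) * u m = 0 := by
      have := heq a
      rw [Matrix.mulVec, dotProduct] at this
      simp only [mul_sub, Finset.sum_sub_distrib, ← Finset.sum_mul]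
      linarith
    have t1 : ∀ j, 0 ≤ M a j * (u m - u j) := fun j =>
      mul_nonneg (meanMatrix_nonneg φ a j) (sub_nonneg.mpr (hm j (Finset.mem_univ j)))
    have t2 : 0 ≤ (1 - ∑ j, M a j) * u m :=
      mul_nonneg (sub_nonneg.mpr (hrow1 a)) (h0 m)
    have t3 : 0 ≤ ∑ j, M a j * (u m - u j) := Finset.sum_nonneg fun j _ => t1 j
    constructor
    · have : (1 - ∑ j, M a j) * u m = 0 := by linarith
      have := (mul_eq_zero.mp this).resolve_right (hpos m).ne'
      linarith
    · intro j hj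
      have : ∑ j, M a j * (u m - u j) = 0 := by linarith
      have := (Finset.sum_eq_zero_iff_of_nonneg fun j _ => t1 j).mp this j (Finset.mem_univ j)
      have := (mul_eq_zero.mp this).resolve_left hj
      linarith
  have hall : ∀ a, u a = u m :=
    forall_of_irreducible hφ.irreducible (p := fun a => u a = u m)
      (fun a b ha hab => (hmax a ha).2 b hab) rfl
  obtain ⟨a, ha⟩ := hφ.nondegenerate
  refine ha.ne ?_
  rw [prob_compl_eq_zero_iff (MeasurableSet.of_discrete)|>.symm, ← mem_ae_iff]
  have hint : ∫ x, (1 - ((∑ j, x j : ℕ) : ℝ)) ∂(φ a).toMeasure = 0 := by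
    rw [integral_sub (integrable_const 1) (hrowint a), ← hrow, (hmax a (hall a)).1]
    simp
  have hz := (integral_eq_zero_iff_of_nonneg_ae
    ((hae1 a).mono fun x hx => sub_nonneg.mpr hx) ((integrable_const 1).sub (hrowint a))).mp hint
  refine hz.mono fun x hx => ?_
  have : (1 : ℝ) - ((∑ j, x j : ℕ) : ℝ) = 0 := hx
  have : ((∑ j, x j : ℕ) : ℝ) = 1 := by linarith
  exact_mod_cast this

end GeneratingFunction

/-! ### Finite trees sorted by type -/

section FiniteTrees

variable {d : ℕ}

/-- Finite multitype trees in which the children of a vertex are sorted by type: a vertex carries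
the vector `x` of its numbers of children of each type, and the pair `(j, k)` with `k < x j` stands
for its `k`-th child of type `j`. The type of the root is not part of the tree. -/
abbrev FTree (d : ℕ) : Type := WType fun x : Fin d → ℕ => Σ j, Fin (x j)

instance : Inhabited (FTree d) := ⟨WType.mk 0 fun b => b.2.elim0⟩

/-- The numbers of children of the root. -/
def FTree.off : FTree d → Fin d → ℕ
  | WType.mk x _ => x

/-- The list of the subtrees at the children of type `j` of the root. -/
def FTree.kids : FTree d → Fin d → List (FTree d)
  | WType.mk _ f, j => List.ofFn fun k => f ⟨j, k⟩

@[simp]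
theorem FTree.length_kids (τ : FTree d) (j : Fin d) : (τ.kids j).length = τ.off j := by
  cases τ
  simp [FTree.kids, FTree.off]

theorem FTree.ext {τ τ' : FTree d} (h : ∀ j, τ.kids j = τ'.kids j) : τ = τ' := by
  have hoff : τ.off = τ'.off := funext fun j => by
    rw [← FTree.length_kids, h, FTree.length_kids]
  obtain ⟨x, f⟩ := τ
  obtain ⟨x', f'⟩ := τ'
  obtain rfl : x = x' := hoff
  congr 1
  funext ⟨j, k⟩
  exact congrFun (List.ofFn_injective (h j)) k

/-- Induction over the subtrees at the children of the root. -/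
theorem FTree.induction {p : FTree d → Prop}
    (h : ∀ τ : FTree d, (∀ j, ∀ σ ∈ τ.kids j, p σ) → p τ) (τ : FTree d) : p τ := by
  induction τ with
  | mk x f ih =>
    refine h _ fun j σ hσ => ?_
    obtain ⟨k, rfl⟩ := (List.mem_ofFn' _ _).mp hσ
    exact ih _

/-- The probability that the Galton-Watson tree started from an individual of type `i`, with the
children of each vertex sorted by type, is the given finite tree. -/
def FTree.weight (φ : Fin d → PMF (Fin d → ℕ)) : FTree d → Fin d → ℝ≥0∞
  | WType.mk x f, i => φ i x * ∏ b : Σ j, Fin (x j), FTree.weight φ (f b) b.1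

theorem FTree.weight_eq (φ : Fin d → PMF (Fin d → ℕ)) (τ : FTree d) (i : Fin d) :
    τ.weight φ i = φ i τ.off * ∏ j, ((τ.kids j).map fun σ => σ.weight φ j).prod := by
  obtain ⟨x, f⟩ := τ
  rw [FTree.weight, FTree.off, Fintype.prod_sigma]
  simp [FTree.kids, List.map_ofFn, List.prod_ofFn]

theorem tsum_pi_prod {β κ : Type} [Fintype β] (g : β → κ → ℝ≥0∞) :
    ∑' f : β → κ, ∏ b, g b (f b) = ∏ b, ∑' x, g b x := by
  have key : ∀ (n : ℕ) (g : Fin n → κ → ℝ≥0∞),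
      ∑' f : Fin n → κ, ∏ b, g b (f b) = ∏ b, ∑' x, g b x := by
    intro n
    induction n with
    | zero => intro g; simp
    | succ n ih =>
      intro g
      rw [← (Fin.consEquiv fun _ => κ).tsum_eq, ENNReal.tsum_prod']
      simp only [Fin.prod_univ_succ, Fin.consEquiv_apply, Fin.cons_zero, Fin.cons_succ,
        ENNReal.tsum_mul_left, ih, ENNReal.tsum_mul_right]
  let e := Fintype.equivFin β
  rw [← (Equiv.arrowCongr e (Equiv.refl κ)).symm.tsum_eq,
    ← Equiv.prod_comp e.symm fun b => ∑' x, g b x, ← key]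
  congr 1
  funext f
  rw [← Equiv.prod_comp e.symm]
  simp [Equiv.arrowCongr]

/-- The total masses of the weights are a fixed point of the generating functions. -/
theorem tsum_weight (φ : Fin d → PMF (Fin d → ℕ)) (i : Fin d) :
    ∑' τ : FTree d, τ.weight φ i =
      ∑' x : Fin d → ℕ, φ i x * ∏ j, (∑' τ : FTree d, τ.weight φ j) ^ x j := by
  rw [← (WType.equivSigma _).symm.tsum_eq, ENNReal.tsum_sigma']
  congr 1
  funext x
  have : ∀ f : (Σ j, Fin (x j)) → FTree d,
      FTree.weight φ ((WType.equivSigma fun x : Fin d → ℕ => Σ j, Fin (x j)).symm ⟨x, f⟩) i =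
        φ i x * ∏ b : Σ j, Fin (x j), (f b).weight φ b.1 := fun f => rfl
  simp only [this, ENNReal.tsum_mul_left]
  rw [tsum_pi_prod (fun (b : Σ j, Fin (x j)) (τ : FTree d) => τ.weight φ b.1), Fintype.prod_sigma]
  simp

/-- Subcritical and critical Galton-Watson trees are almost surely finite. -/
theorem tsum_weight_eq_one {φ : Fin d → PMF (Fin d → ℕ)} (hφ : IsSubcriticalOrCritical φ)
    (hle : ∀ i, ∑' τ : FTree d, τ.weight φ i ≤ 1) (i : Fin d) :
    ∑' τ : FTree d, τ.weight φ i = 1 := by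
  set q : Fin d → ℝ≥0∞ := fun i => ∑' τ : FTree d, τ.weight φ i with hq
  have hqfix : ∀ i, q i = ∑' x : Fin d → ℕ, φ i x * ∏ j, q j ^ x j := tsum_weight φ
  have hqtop : ∀ i, q i ≠ ⊤ := fun i => ((hle i).trans_lt ENNReal.one_lt_top).ne
  have hq1 : ∀ i, (q i).toReal ≤ 1 := fun i => ENNReal.toReal_le_of_le_ofReal zero_le_one
    (by simpa using hle i)
  have hz := survival_eq_zero hφ (fun j => 1 - (q j).toReal) (fun j => sub_nonneg.mpr (hq1 j))
    (fun j => sub_le_self _ ENNReal.toReal_nonneg) (fun i => by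
      simp only [sub_sub_cancel]
      have hp0 : ∀ x : Fin d → ℕ, 0 ≤ ∏ j, (q j).toReal ^ x j := fun x =>
        Finset.prod_nonneg fun j _ => pow_nonneg ENNReal.toReal_nonneg _
      have hint : Integrable (fun x : Fin d → ℕ => ∏ j, (q j).toReal ^ x j) (φ i).toMeasure :=
        integrable_of_le_one hp0 fun x =>
          Finset.prod_le_one (fun j _ => pow_nonneg ENNReal.toReal_nonneg _)
            fun j _ => pow_le_one₀ ENNReal.toReal_nonneg (hq1 j)
      rw [integral_sub (integrable_const 1) hint]
      simp only [integral_const, probReal_univ, smul_eq_mul, mul_one, sub_right_inj]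
      rw [integral_eq_lintegral_of_nonneg_ae (Filter.Eventually.of_forall hp0)
        (measurable_of_countable _).aestronglyMeasurable, lintegral_countable', hqfix i]
      congr 2
      funext x
      rw [PMF.toMeasure_apply_singleton _ _ (measurableSet_singleton x), mul_comm,
        ENNReal.ofReal_prod_of_nonneg fun j _ => pow_nonneg ENNReal.toReal_nonneg _]
      congr 1
      refine Finset.prod_congr rfl fun j _ => ?_
      rw [ENNReal.ofReal_pow ENNReal.toReal_nonneg, ENNReal.ofReal_toReal (hqtop j)]) i
  have h1 : (q i).toReal = 1 := by linarith
  change q i = 1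
  rw [← ENNReal.ofReal_toReal (hqtop i), h1, ENNReal.ofReal_one]

end FiniteTrees

/-! ### Metric trees given by a parent function -/

section TreeMetric

/-- The metric space is a discrete tree with root `r` and unit edges between `x` and its parent
`par x`: the way from `x` to any point that is not below `x` passes through `par x`. -/
structure IsTreeMetric {X : Type} [MetricSpace X] (r : X) (par : X → X) : Prop where
  par_root : par r = r
  reach : ∀ x, ∃ n, par^[n] x = r
  dist_eq : ∀ x y, x ≠ r → (∀ n, par^[n] y ≠ x) → dist x y = 1 + dist (par x) y

namespace IsTreeMetric

variable {X Y : Type} [MetricSpace X] [MetricSpace Y] {r : X} {par : X → X} {r' : Y} {par' : Y → Y}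

theorem induction (h : IsTreeMetric r par) {p : X → Prop} (h0 : p r)
    (h1 : ∀ x, x ≠ r → p (par x) → p x) (x : X) : p x := by
  obtain ⟨n, hn⟩ := h.reach x
  induction n generalizing x with
  | zero =>
    have hx : x = r := hn
    exact hx ▸ h0
  | succ n ih =>
    by_cases hx : x = r
    · exact hx ▸ h0
    · exact h1 x hx (ih (par x) hn)

open Classical in
/-- The distance to the root, in number of generations. -/
def depth (h : IsTreeMetric r par) (x : X) : ℕ := Nat.find (h.reach x)

theorem depth_eq_zero (h : IsTreeMetric r par) {x : X} : h.depth x = 0 ↔ x = r := by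
  simp [depth]

theorem depth_par (h : IsTreeMetric r par) (x : X) : h.depth (par x) = h.depth x - 1 := by
  classical
  by_cases hx : x = r
  · subst hx
    rw [h.par_root, h.depth_eq_zero.mpr rfl]
  · have := Nat.find_comp_succ (h.reach x) (h.reach (par x)) hx
    change h.depth x = h.depth (par x) + 1 at this
    omega

theorem depth_iterate (h : IsTreeMetric r par) (n : ℕ) (x : X) :
    h.depth (par^[n] x) = h.depth x - n := by
  induction n with
  | zero => simp
  | succ n ih =>
    rw [Function.iterate_succ_apply', h.depth_par, ih]
    omega

theorem not_below_of_depth_le (h : IsTreeMetric r par) {x y : X} (hx : x ≠ r) (hxy : y ≠ x)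
    (hd : h.depth y ≤ h.depth x) (n : ℕ) : par^[n] y ≠ x := by
  rintro rfl
  have h1 := h.depth_iterate n y
  have h2 : h.depth (par^[n] y) ≠ 0 := fun h0 => hx (h.depth_eq_zero.mp h0)
  have : n = 0 := by omega
  subst this
  exact hxy rfl

/-- An injective map between metric trees that preserves parents is an isometry. -/
theorem isometry (h : IsTreeMetric r par) (h' : IsTreeMetric r' par') {f : X → Y}
    (hinj : Function.Injective f) (hr : f r = r') (hpar : ∀ x, f (par x) = par' (f x)) :
    Isometry f := by
  have hiter : ∀ n x, f (par^[n] x) = par'^[n] (f x) := by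
    intro n
    induction n with
    | zero => intro x; rfl
    | succ n ih =>
      intro x
      rw [Function.iterate_succ_apply, Function.iterate_succ_apply, ih, hpar]
  -- moving the deeper one of the points to its parent reduces the sum of the depths
  have key : ∀ N x y, h.depth x + h.depth y ≤ N → h.depth y ≤ h.depth x →
      dist (f x) (f y) = dist x y := by
    intro N
    induction N with
    | zero =>
      intro x y hN _
      have hx : x = r := h.depth_eq_zero.mp (by omega)
      have hy : y = r := h.depth_eq_zero.mp (by omega)
      simp [hx, hy]
    | succ N ih =>
      intro x y hN hle
      by_cases hxy : y = x
      · simp [hxy]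
      · have hx : x ≠ r := by
          intro hx
          have h0 := h.depth_eq_zero.mpr hx
          exact hxy ((h.depth_eq_zero.mp (by omega)).trans hx.symm)
        have hnb := h.not_below_of_depth_le hx hxy hle
        have hx0 : h.depth x ≠ 0 := fun h0 => hx (h.depth_eq_zero.mp h0)
        rw [h.dist_eq x y hx hnb, h'.dist_eq (f x) (f y) (fun h0 => hx (hinj (h0.trans hr.symm)))
          fun n hn => hnb n (hinj ((hiter n y).trans hn)), ← hpar]
        congr 1
        have hd := h.depth_par x
        rcases le_total (h.depth y) (h.depth (par x)) with hc | hc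
        · exact ih _ _ (by omega) hc
        · rw [dist_comm, dist_comm (par x)]
          exact ih _ _ (by omega) hc
  refine Isometry.of_dist_eq fun x y => ?_
  rcases le_total (h.depth y) (h.depth x) with hc | hc
  · exact key _ x y le_rfl hc
  · rw [dist_comm, dist_comm x]
    exact key _ y x le_rfl hc

end IsTreeMetric

/-- The graph distance of a connected graph whose edges join the points and their parents. -/
theorem isTreeMetric_graphMetric {V : Type} {G : SimpleGraph V} (hG : G.Connected) {r : V}
    {par : V → V} (h0 : par r = r) (hreach : ∀ x, ∃ n, par^[n] x = r)
    (hadj : ∀ x, x ≠ r → G.Adj x (par x)) (hpar : ∀ x y, G.Adj x y → par x = y ∨ par y = x) :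
    @IsTreeMetric V (graphMetric G hG) r par := by
  let _ := graphMetric G hG
  refine ⟨h0, hreach, fun x y hx hy => ?_⟩
  have hd : ∀ a b, dist a b = (G.dist a b : ℝ) := fun a b => rfl
  have hstep : dist x (par x) = 1 := by
    rw [hd, SimpleGraph.dist_eq_one_iff_adj.mpr (hadj x hx), Nat.cast_one]
  refine le_antisymm ((dist_triangle x (par x) y).trans (by rw [hstep])) ?_
  -- a walk from a point below `x` to a point not below `x` contains the edge from `x` to `par x`
  have key : ∀ (a b : V) (p : G.Walk a b), (∃ n, par^[n] a = x) → (∀ n, par^[n] b ≠ x) →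
      1 + G.dist (par x) b ≤ p.length := by
    intro a b p
    induction p with
    | nil =>
      rintro ⟨n, hn⟩ hb
      exact absurd hn (hb n)
    | @cons a c b hac p ih =>
      rintro ⟨n, hn⟩ hb
      rw [SimpleGraph.Walk.length_cons]
      by_cases hc : ∃ m, par^[m] c = x
      · have := ih hc hb
        omega
      · push Not at hc
        rcases hpar a c hac with hca | hca
        · cases n with
          | zero =>
            have hax : a = x := hn
            rw [← hax, hca]
            have := SimpleGraph.dist_le p
            omega
          | succ n =>
            rw [Function.iterate_succ_apply, hca] at hn
            exact absurd hn (hc n)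
        · refine absurd ?_ (hc (n + 1))
          rw [Function.iterate_succ_apply, hca, hn]
  obtain ⟨p, hp⟩ := hG.exists_walk_length_eq_dist x y
  have := key x y p ⟨0, rfl⟩ hy
  rw [hp] at this
  rw [hd, hd]
  exact_mod_cast this

end TreeMetric

/-! ### Spaces coded by a finite tree -/

section Coding

variable {d : ℕ}

/-- The space is the planted tree of `τ`, whose root is given the type `i`: it is a metric tree
carrying the counting measures of the types `ty`, each point `x` other than the root is the root of
a copy of the finite tree `sub x`, and it is the `idx x`-th child of type `ty x` of its parent. The
values of `ty`, `idx` and `sub` at the root, and of `idx` at its only child, are irrelevant. -/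
structure Coding (X : PMMSpace d) (i : Fin d) (τ : FTree d) where
  /-- the parent of a point -/
  par : X.carrier → X.carrier
  /-- the type of a point -/
  ty : X.carrier → Fin d
  /-- the rank of a point among its siblings of the same type -/
  idx : X.carrier → ℕ
  /-- the tree of the descendants of a point -/
  sub : X.carrier → FTree d
  tree : IsTreeMetric X.root par
  mass : ∀ j, X.mass j = @Measure.sum _ _ (borel X.carrier)
    fun v : {x // x ≠ X.root ∧ ty x = j} => @Measure.dirac _ (borel X.carrier) v.1
  top_exists : ∃ x, x ≠ X.root ∧ par x = X.root
  top : ∀ x, x ≠ X.root → par x = X.root → sub x = τ ∧ ty x = i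
  top_unique : ∀ x y, x ≠ X.root → par x = X.root → y ≠ X.root → par y = X.root → x = y
  kid : ∀ x, x ≠ X.root → par x ≠ X.root → ((sub (par x)).kids (ty x))[idx x]? = some (sub x)
  kid_inj : ∀ x y, x ≠ X.root → y ≠ X.root → par x ≠ X.root → par x = par y → ty x = ty y →
    idx x = idx y → x = y
  kid_exists : ∀ x, x ≠ X.root → ∀ j k, k < (sub x).off j →
    ∃ y, y ≠ X.root ∧ par y = x ∧ ty y = j ∧ idx y = k

namespace Coding

variable {X Y : PMMSpace d} {i : Fin d} {τ : FTree d}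

theorem idx_lt (A : Coding X i τ) {x : X.carrier} (hx : x ≠ X.root) (hp : A.par x ≠ X.root) :
    A.idx x < (A.sub (A.par x)).off (A.ty x) := by
  have := A.kid x hx hp
  rw [← FTree.length_kids]
  by_contra hcon
  rw [List.getElem?_eq_none (not_lt.mp hcon)] at this
  exact absurd this (by simp)

/-- `x` and `y` occupy the same position in two spaces coded by the same tree. -/
inductive Match (A : Coding X i τ) (B : Coding Y i τ) : X.carrier → Y.carrier → Prop
  | root : Match A B X.root Y.root
  | top (x y) : x ≠ X.root → A.par x = X.root → y ≠ Y.root → B.par y = Y.root → Match A B x y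
  | kid (x y) : x ≠ X.root → A.par x ≠ X.root → y ≠ Y.root → B.par y ≠ Y.root →
      Match A B (A.par x) (B.par y) → A.ty x = B.ty y → A.idx x = B.idx y → Match A B x y

theorem Match.symm {A : Coding X i τ} {B : Coding Y i τ} {x : X.carrier} {y : Y.carrier}
    (h : Match A B x y) : Match B A y x := by
  induction h with
  | root => exact .root
  | top x y h1 h2 h3 h4 => exact .top y x h3 h4 h1 h2
  | kid x y h1 h2 h3 h4 _ h6 h7 ih => exact .kid y x h3 h4 h1 h2 ih h6.symm h7.symm

theorem Match.root_iff {A : Coding X i τ} {B : Coding Y i τ} {x : X.carrier} {y : Y.carrier}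
    (h : Match A B x y) : x = X.root ↔ y = Y.root := by
  cases h with
  | root => simp
  | top _ _ h1 h2 h3 h4 => simp [h1, h3]
  | kid _ _ h1 h2 h3 h4 => simp [h1, h3]

theorem Match.par {A : Coding X i τ} {B : Coding Y i τ} {x : X.carrier} {y : Y.carrier}
    (h : Match A B x y) : Match A B (A.par x) (B.par y) := by
  cases h with
  | root => rw [A.tree.par_root, B.tree.par_root]; exact .root
  | top _ _ h1 h2 h3 h4 => rw [h2, h4]; exact .root
  | kid _ _ _ _ _ _ h => exact h

theorem Match.sub_eq {A : Coding X i τ} {B : Coding Y i τ} {x : X.carrier} {y : Y.carrier}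
    (h : Match A B x y) (hx : x ≠ X.root) : A.sub x = B.sub y ∧ A.ty x = B.ty y := by
  induction h with
  | root => exact absurd rfl hx
  | top x y h1 h2 h3 h4 =>
    exact ⟨(A.top x h1 h2).1.trans (B.top y h3 h4).1.symm,
      (A.top x h1 h2).2.trans (B.top y h3 h4).2.symm⟩
  | kid x y h1 h2 h3 h4 _ h6 h7 ih =>
    have hs := A.kid x h1 h2
    rw [(ih h2).1, h6, h7, B.kid y h3 h4, Option.some_inj] at hs
    exact ⟨hs.symm, h6⟩

theorem exists_match (A : Coding X i τ) (B : Coding Y i τ) (x : X.carrier) :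
    ∃ y, Match A B x y := by
  induction x using A.tree.induction with
  | h0 => exact ⟨_, .root⟩
  | h1 x hx ih =>
    by_cases hp : A.par x = X.root
    · obtain ⟨y, hy⟩ := B.top_exists
      exact ⟨y, .top x y hx hp hy.1 hy.2⟩
    · obtain ⟨z, hz⟩ := ih
      have hlt := A.idx_lt hx hp
      rw [(hz.sub_eq hp).1] at hlt
      have hz0 : z ≠ Y.root := fun h => hp (hz.root_iff.mpr h)
      obtain ⟨y, hy, rfl, hty, hidx⟩ := B.kid_exists z hz0 _ _ hlt
      exact ⟨y, .kid x y hx hp hy hz0 hz hty.symm hidx.symm⟩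

theorem Match.unique {A : Coding X i τ} {B : Coding Y i τ} {x : X.carrier} {y y' : Y.carrier}
    (h : Match A B x y) (h' : Match A B x y') : y = y' := by
  induction h generalizing y' with
  | root => exact (h'.root_iff.mp rfl).symm
  | top x y h1 h2 h3 h4 =>
    cases h' with
    | root => exact absurd rfl h1
    | top _ _ _ _ h3' h4' => exact B.top_unique y y' h3 h4 h3' h4'
    | kid _ _ _ h2' => exact absurd h2 h2'
  | kid x y h1 h2 h3 h4 h5 h6 h7 ih =>
    cases h' with
    | root => exact absurd rfl h1
    | top _ _ _ h2' => exact absurd h2' h2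
    | kid _ _ _ _ h3' h4' h5' h6' h7' =>
      exact B.kid_inj y y' h3 h3' h4 (ih h5') (h6.symm.trans h6') (h7.symm.trans h7')

/-- Two spaces coded by the same tree are isomorphic. -/
theorem iso (A : Coding X i τ) (B : Coding Y i τ) : X.Iso Y := by
  choose f hf using exists_match A B
  choose g hg using exists_match B A
  have hgf : ∀ x, g (f x) = x := fun x => (hg (f x)).unique (hf x).symm
  have hfg : ∀ y, f (g y) = y := fun y => (hf (g y)).unique (hg y).symm
  have hroot : f X.root = Y.root := (hf X.root).root_iff.mp rfl
  have hiso : Isometry f := A.tree.isometry B.tree (Function.LeftInverse.injective hgf) hroot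
    fun x => (hf (A.par x)).unique (hf x).par
  refine ⟨⟨⟨f, g, hgf, hfg⟩, hiso⟩, hroot, fun j => ?_⟩
  let _ : MeasurableSpace X.carrier := borel _
  let _ : MeasurableSpace Y.carrier := borel _
  have hmeas : Measurable f := borel_measurable hiso.continuous
  rw [A.mass, B.mass]
  change Measure.map f _ = _
  rw [Measure.map_sum hmeas.aemeasurable]
  simp only [Measure.map_dirac' hmeas]
  have hne : ∀ x, x ≠ X.root → f x ≠ Y.root := fun x hx h => hx ((hf x).root_iff.mpr h)
  have hne' : ∀ y, y ≠ Y.root → g y ≠ X.root := fun y hy h => hy ((hg y).root_iff.mpr h)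
  let e : {x // x ≠ X.root ∧ A.ty x = j} ≃ {y // y ≠ Y.root ∧ B.ty y = j} :=
    { toFun := fun x => ⟨f x.1, hne _ x.2.1, ((hf x.1).sub_eq x.2.1).2.symm.trans x.2.2⟩
      invFun := fun y => ⟨g y.1, hne' _ y.2.1, ((hg y.1).sub_eq y.2.1).2.symm.trans y.2.2⟩
      left_inv := fun x => Subtype.ext (hgf x.1)
      right_inv := fun y => Subtype.ext (hfg y.1) }
  ext s hs
  rw [Measure.sum_apply _ hs, Measure.sum_apply _ hs, ← e.tsum_eq]
  rfl

theorem finite (A : Coding X i τ) : Finite X.carrier := by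
  -- the set of the points below `x` is finite
  have key : ∀ σ : FTree d, ∀ x, x ≠ X.root → A.sub x = σ →
      {y | ∃ n, A.par^[n] y = x}.Finite := by
    intro σ
    induction σ using FTree.induction with
    | h σ ih =>
      rintro x hx rfl
      choose c hc0 hcp hct hci using A.kid_exists x hx
      have hfin : ∀ j k h, {y | ∃ n, A.par^[n] y = c j k h}.Finite := by
        intro j k h
        refine ih j _ ?_ (c j k h) (hc0 j k h) rfl
        have hkid := A.kid (c j k h) (hc0 j k h) (by rw [hcp]; exact hx)
        rw [hcp, hct, hci] at hkid
        exact List.mem_of_getElem? hkid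
      refine Set.Finite.subset ((Set.finite_singleton x).union
        (Set.finite_iUnion fun b : Σ j, Fin ((A.sub x).off j) => hfin b.1 b.2 b.2.2)) ?_
      rintro y ⟨n, hn⟩
      cases n with
      | zero => exact Or.inl hn
      | succ n =>
        rw [Function.iterate_succ_apply'] at hn
        set z := A.par^[n] y with hz
        have hz0 : z ≠ X.root := by
          intro h0
          rw [h0, A.tree.par_root] at hn
          exact hx hn.symm
        have hzp : A.par z ≠ X.root := by rw [hn]; exact hx
        have hlt := A.idx_lt hz0 hzp
        rw [hn] at hlt
        refine Or.inr (Set.mem_iUnion.mpr ⟨⟨A.ty z, A.idx z, hlt⟩, n, ?_⟩)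
        exact A.kid_inj _ _ hz0 (hc0 _ _ _) hzp (by rw [hcp, hn]) (hct _ _ _).symm (hci _ _ _).symm
  obtain ⟨t, ht, htp⟩ := A.top_exists
  have hfin : (Set.univ : Set X.carrier).Finite := by
    refine Set.Finite.subset ((Set.finite_singleton X.root).union (key _ t ht rfl)) ?_
    intro x hxu
    clear hxu
    induction x using A.tree.induction with
    | h0 => exact Or.inl rfl
    | h1 x hx ih =>
      right
      rcases ih with ih | ⟨n, hn⟩
      · exact ⟨0, A.top_unique _ _ hx ih ht htp⟩
      · exact ⟨n + 1, by rw [Function.iterate_succ_apply, hn]⟩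
  exact Set.finite_univ_iff.mp hfin

theorem isCompactFinite (A : Coding X i τ) : X.IsCompactFinite := by
  have := A.finite
  refine ⟨inferInstance, fun j => ?_⟩
  rw [A.mass, Measure.sum_apply _ MeasurableSet.univ]
  have := Fintype.ofFinite {x // x ≠ X.root ∧ A.ty x = j}
  rw [tsum_fintype]
  refine ENNReal.sum_lt_top.mpr fun v _ => ?_
  let _ : MeasurableSpace X.carrier := borel _
  exact measure_lt_top _ _

end Coding

end Coding

/-! ### Multitype trees with their children sorted by type -/

section Unfolding

variable {d : ℕ}

namespace MultitypeTree

theorem AgreeUpTo.mono {n m : ℕ} (hnm : m ≤ n) {t t' : MultitypeTree d} (h : t.AgreeUpTo n t') :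
    t.AgreeUpTo m t' := fun v hv => h v (hv.trans hnm)

theorem finite_children (t : MultitypeTree d) (v : List ℕ) :
    {k | t.label (v ++ [k]) ≠ none}.Finite := by
  by_cases hv : t.label v = none
  · convert Set.finite_empty
    ext k
    simp only [Set.mem_ofPred_eq, Set.mem_empty_iff_false, iff_false, not_not]
    by_contra h
    exact t.parent_mem v k h hv
  · obtain ⟨n, hn⟩ := t.children v hv
    exact (Set.finite_lt_nat n).subset fun k hk => (hn k).mp hk

theorem finite_children_type (t : MultitypeTree d) (v : List ℕ) (j : Fin d) :
    {k | t.label (v ++ [k]) = some j}.Finite :=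
  (t.finite_children v).subset fun k hk => by
    have hk' : t.label (v ++ [k]) = some j := hk
    simp [hk']

theorem finite_generation (t : MultitypeTree d) (n : ℕ) :
    {v : List ℕ | v.length = n ∧ t.label v ≠ none}.Finite := by
  induction n with
  | zero =>
    refine (Set.finite_singleton []).subset ?_
    rintro v ⟨hv, -⟩
    exact List.length_eq_zero_iff.mp hv
  | succ n ih =>
    refine (ih.biUnion fun u _ => (t.finite_children u).image fun k => u ++ [k]).subset ?_
    rintro v ⟨hv, hl⟩
    obtain rfl | ⟨u, k, rfl⟩ := List.eq_nil_or_concat' v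
    · simp at hv
    · refine Set.mem_biUnion (x := u) ⟨?_, t.parent_mem u k hl⟩ ⟨k, hl, rfl⟩
      simpa using hv

/-- The `k`-th child of type `j` of the vertex `v`. -/
def kidWord (t : MultitypeTree d) (v : List ℕ) (j : Fin d) (k : ℕ) : List ℕ :=
  v ++ [Nat.nth (fun n => t.label (v ++ [n]) = some j) k]

theorem childVector_eq_card (t : MultitypeTree d) (v : List ℕ) (j : Fin d) :
    t.childVector v j = (t.finite_children_type v j).toFinset.card :=
  Set.ncard_eq_toFinset_card _ _

theorem label_kidWord (t : MultitypeTree d) {v : List ℕ} {j : Fin d} {k : ℕ}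
    (hk : k < t.childVector v j) : t.label (t.kidWord v j k) = some j := by
  rw [childVector_eq_card] at hk
  exact Nat.nth_mem_of_lt_card (t.finite_children_type v j) hk

open Classical in
theorem count_lt_childVector (t : MultitypeTree d) {v : List ℕ} {j : Fin d} {m : ℕ}
    (h : t.label (v ++ [m]) = some j) :
    Nat.count (fun n => t.label (v ++ [n]) = some j) m < t.childVector v j := by
  rw [childVector_eq_card]
  exact Nat.count_lt_card (t.finite_children_type v j) h

open Classical in
theorem kidWord_count (t : MultitypeTree d) {v : List ℕ} {j : Fin d} {m : ℕ}
    (h : t.label (v ++ [m]) = some j) :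
    t.kidWord v j (Nat.count (fun n => t.label (v ++ [n]) = some j) m) = v ++ [m] := by
  rw [kidWord, Nat.nth_count h]

theorem kidWord_inj (t : MultitypeTree d) {v : List ℕ} {j j' : Fin d} {k k' : ℕ}
    (hk : k < t.childVector v j) (hk' : k' < t.childVector v j')
    (h : t.kidWord v j k = t.kidWord v j' k') : j = j' ∧ k = k' := by
  have hj := t.label_kidWord hk
  rw [h, t.label_kidWord hk', Option.some_inj] at hj
  subst hj
  refine ⟨rfl, ?_⟩
  rw [childVector_eq_card] at hk hk'
  refine Nat.nth_injOn (t.finite_children_type v j') hk hk' ?_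
  simpa [kidWord] using h

theorem length_kidWord (t : MultitypeTree d) (v : List ℕ) (j : Fin d) (k : ℕ) :
    (t.kidWord v j k).length = v.length + 1 := by
  simp [kidWord]

theorem AgreeUpTo.childVector_eq {n : ℕ} {t t' : MultitypeTree d} (h : t.AgreeUpTo n t')
    {v : List ℕ} (hv : v.length < n) : t.childVector v = t'.childVector v := by
  funext j
  simp only [childVector]
  congr 1
  ext k
  have := h (v ++ [k]) (by simpa using hv)
  simp [this]

theorem AgreeUpTo.kidWord_eq {n : ℕ} {t t' : MultitypeTree d} (h : t.AgreeUpTo n t')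
    {v : List ℕ} (hv : v.length < n) (j : Fin d) (k : ℕ) :
    t.kidWord v j k = t'.kidWord v j k := by
  simp only [kidWord]
  congr 3
  funext m
  rw [h (v ++ [m]) (by simpa using hv)]

/-- After sorting the children by type, the descendants of the vertex `v` are those of the given
finite tree, as far as the numbers of children of the first `n` generations below `v` (including
`v`) are concerned. -/
def UnfoldsUpTo (t : MultitypeTree d) : ℕ → FTree d → List ℕ → Prop
  | 0, _, _ => True
  | n + 1, WType.mk x f, v => t.childVector v = x ∧
      ∀ b : Σ j, Fin (x j), UnfoldsUpTo t n (f b) (t.kidWord v b.1 b.2)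

/-- After sorting the children by type, the descendants of the vertex `v` are those of the given
finite tree. -/
def Unfolds (t : MultitypeTree d) (τ : FTree d) (v : List ℕ) : Prop :=
  ∀ n, t.UnfoldsUpTo n τ v

theorem unfolds_mk (t : MultitypeTree d) {x : Fin d → ℕ} {f : (Σ j, Fin (x j)) → FTree d}
    {v : List ℕ} : t.Unfolds (WType.mk x f) v ↔ t.childVector v = x ∧
      ∀ b : Σ j, Fin (x j), t.Unfolds (f b) (t.kidWord v b.1 b.2) := by
  constructor
  · intro h
    exact ⟨(h 1).1, fun b n => (h (n + 1)).2 b⟩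
  · rintro ⟨h1, h2⟩ n
    cases n with
    | zero => trivial
    | succ n => exact ⟨h1, fun b => h2 b n⟩

theorem unfoldsUpTo_mono (t : MultitypeTree d) {n m : ℕ} (hmn : m ≤ n) {τ : FTree d} {v : List ℕ}
    (h : t.UnfoldsUpTo n τ v) : t.UnfoldsUpTo m τ v := by
  induction m generalizing n τ v with
  | zero => trivial
  | succ m ih =>
    obtain ⟨n, rfl⟩ : ∃ n', n = n' + 1 := ⟨n - 1, by omega⟩
    obtain ⟨x, f⟩ := τ
    exact ⟨h.1, fun b => ih (by omega) (h.2 b)⟩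

theorem unfolds_iff_unfoldsUpTo_depth (t : MultitypeTree d) {τ : FTree d} {v : List ℕ} :
    t.Unfolds τ v ↔ t.UnfoldsUpTo τ.depth τ v := by
  refine ⟨fun h => h _, fun h n => ?_⟩
  induction τ generalizing n v with
  | mk x f ih =>
    obtain ⟨m, hm⟩ := Nat.exists_eq_succ_of_ne_zero (WType.depth_pos (WType.mk x f : FTree d)).ne'
    rw [hm] at h
    cases n with
    | zero => trivial
    | succ n =>
      refine ⟨h.1, fun b => ih b (t.unfoldsUpTo_mono ?_ (h.2 b)) n⟩
      have : (f b).depth < (WType.mk x f : FTree d).depth :=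
        WType.depth_lt_depth_mk (β := fun x : Fin d → ℕ => Σ j, Fin (x j)) x f b
      omega

theorem Unfolds.unique {t : MultitypeTree d} {τ τ' : FTree d} {v : List ℕ} (h : t.Unfolds τ v)
    (h' : t.Unfolds τ' v) : τ = τ' := by
  induction τ generalizing τ' v with
  | mk x f ih =>
    obtain ⟨x', f'⟩ := τ'
    rw [unfolds_mk] at h h'
    obtain rfl : x = x' := h.1.symm.trans h'.1
    congr 1
    funext b
    exact ih b (h.2 b) (h'.2 b)

theorem Unfolds.off_eq {t : MultitypeTree d} {τ : FTree d} {v : List ℕ} (h : t.Unfolds τ v) :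
    t.childVector v = τ.off := by
  obtain ⟨x, f⟩ := τ
  exact (t.unfolds_mk.mp h).1

theorem Unfolds.kid {t : MultitypeTree d} {τ : FTree d} {v : List ℕ} (h : t.Unfolds τ v)
    {j : Fin d} {k : ℕ} (hk : k < t.childVector v j) :
    ∃ σ, (τ.kids j)[k]? = some σ ∧ t.Unfolds σ (t.kidWord v j k) := by
  obtain ⟨x, f⟩ := τ
  obtain ⟨rfl, h2⟩ := t.unfolds_mk.mp h
  refine ⟨f ⟨j, ⟨k, hk⟩⟩, ?_, h2 ⟨j, ⟨k, hk⟩⟩⟩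
  rw [FTree.kids, List.getElem?_ofFn, dif_pos hk]

theorem Unfolds.exists_below {t : MultitypeTree d} {τ : FTree d} (h : t.Unfolds τ [])
    (v : List ℕ) (hv : t.label v ≠ none) : ∃ σ, t.Unfolds σ v := by
  classical
  induction v using List.reverseRecOn with
  | nil => exact ⟨τ, h⟩
  | append_singleton u m ih =>
    obtain ⟨σ, hσ⟩ := ih (t.parent_mem u m hv)
    obtain ⟨j, hj⟩ := Option.ne_none_iff_exists'.mp hv
    obtain ⟨σ', -, hσ'⟩ := hσ.kid (t.count_lt_childVector hj)
    exact ⟨σ', t.kidWord_count hj ▸ hσ'⟩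

theorem label_eq_some_type (t : MultitypeTree d) (v : t.Vertex) :
    t.label v.1 = some (t.type v) := by
  simp [type]

/-- The parent of a vertex of the planted tree; the parent of the root of the tree is the
additional vertex, which is its own parent. -/
def plantedPar (t : MultitypeTree d) : Option t.Vertex → Option t.Vertex
  | none => none
  | some v => if h : v.1 = [] then none else
      some ⟨v.1.dropLast, by
        have hv := v.2
        rw [← List.dropLast_append_getLast h] at hv
        exact t.parent_mem _ _ hv⟩

theorem plantedPar_append (t : MultitypeTree d) (u : List ℕ) (k : ℕ)
    (h : t.label (u ++ [k]) ≠ none) :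
    t.plantedPar (some ⟨u ++ [k], h⟩) = some ⟨u, t.parent_mem u k h⟩ := by
  simp [plantedPar]

theorem plantedPar_eq_none (t : MultitypeTree d) {v : t.Vertex} :
    t.plantedPar (some v) = none ↔ v.1 = [] := by
  simp [plantedPar]

theorem isTreeMetric_planted (t : MultitypeTree d) :
    @IsTreeMetric _ t.planted.metric t.planted.root t.plantedPar := by
  refine isTreeMetric_graphMetric t.plantedGraph_connected rfl ?_ ?_ ?_
  · have key : ∀ v : List ℕ, ∀ h : t.label v ≠ none,
        ∃ n, t.plantedPar^[n] (some ⟨v, h⟩) = none := by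
      intro v
      induction v using List.reverseRecOn with
      | nil => exact fun h => ⟨1, by simp [plantedPar]⟩
      | append_singleton u k ih =>
        intro h
        obtain ⟨n, hn⟩ := ih (t.parent_mem u k h)
        exact ⟨n + 1, by rw [Function.iterate_succ_apply, plantedPar_append, hn]⟩
    rintro (_ | ⟨v, h⟩)
    · exact ⟨0, rfl⟩
    · exact key v h
  · rintro (_ | ⟨v, h⟩) hx
    · exact absurd rfl hx
    · obtain rfl | ⟨u, k, rfl⟩ := List.eq_nil_or_concat' v
      · simp [plantedPar, plantedGraph, SimpleGraph.fromRel_adj]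
      · rw [plantedPar_append]
        simp [plantedGraph, SimpleGraph.fromRel_adj]
  · have key : ∀ a b : Option t.Vertex, (match a, b with
        | none, some v => v.1 = []
        | some u, some v => ∃ k, v.1 = u.1 ++ [k]
        | _, none => False) → t.plantedPar b = a := by
      rintro (_ | ⟨u, hu⟩) (_ | ⟨v, hv⟩) hab
      · exact hab.elim
      · exact t.plantedPar_eq_none.mpr hab
      · exact hab.elim
      · obtain ⟨k, rfl⟩ := hab
        exact t.plantedPar_append u k hv
    intro a b hab
    rw [plantedGraph, SimpleGraph.fromRel_adj] at hab
    rcases hab.2 with h | h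
    · exact Or.inr (key a b h)
    · exact Or.inl (key b a h)

/-- The types of the vertices of the planted tree; the additional vertex is given the type `i`. -/
def plantedTy (t : MultitypeTree d) (i : Fin d) : Option t.Vertex → Fin d
  | none => i
  | some v => t.type v

open Classical in
/-- A multitype tree which unfolds to a finite tree is coded by it. The rank of a vertex counts its
elder siblings of the same type. -/
def coding (t : MultitypeTree d) {i : Fin d} {τ : FTree d} (hi : t.label [] = some i)
    (h : t.Unfolds τ []) : Coding t.planted i τ where
  par := t.plantedPar
  ty := t.plantedTy i
  idx
    | none => 0
    | some v => Nat.count (fun n => t.label (v.1.dropLast ++ [n]) = t.label v.1)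
        (v.1.getLast?.getD 0)
  sub
    | none => τ
    | some v => Classical.choose (h.exists_below v.1 v.2)
  tree := t.isTreeMetric_planted
  mass j := by
    have hset : {a | ∃ v : t.Vertex, a = some v ∧ t.type v = j} =
        {x : Option t.Vertex | x ≠ none ∧ t.plantedTy i x = j} := by
      ext (_ | v)
      · simp
      · constructor
        · rintro ⟨w, hw, rfl⟩
          exact ⟨by simp, by rw [hw]; rfl⟩
        · rintro ⟨-, hv⟩
          exact ⟨v, rfl, hv⟩
    exact congrArg (fun s : Set (Option t.Vertex) =>
      @Measure.sum _ _ (borel t.planted.carrier) fun v : s =>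
        @Measure.dirac _ (borel t.planted.carrier) v.1) hset
  top_exists := by
    refine ⟨some ⟨[], by simp [hi]⟩, by simp [planted, graphSpace], ?_⟩
    exact t.plantedPar_eq_none.mpr rfl
  top := by
    rintro (_ | ⟨v, hv⟩) h0 h1
    · exact absurd rfl h0
    · obtain rfl : v = [] := t.plantedPar_eq_none.mp h1
      refine ⟨(Classical.choose_spec (h.exists_below [] hv)).unique h, ?_⟩
      have := t.label_eq_some_type ⟨[], hv⟩
      rw [hi] at this
      exact (Option.some_inj.mp this).symm
  top_unique := by
    rintro (_ | ⟨v, hv⟩) (_ | ⟨w, hw⟩) h0 h1 h2 h3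
    · exact absurd rfl h0
    · exact absurd rfl h0
    · exact absurd rfl h2
    · obtain rfl : v = [] := t.plantedPar_eq_none.mp h1
      obtain rfl : w = [] := t.plantedPar_eq_none.mp h3
      rfl
  kid := by
    rintro (_ | ⟨v, hv⟩) h0 h1
    · exact absurd rfl h0
    · obtain rfl | ⟨u, m, rfl⟩ := List.eq_nil_or_concat' v
      · exact absurd (t.plantedPar_eq_none.mpr rfl) h1
      · have hm := t.label_eq_some_type ⟨u ++ [m], hv⟩
        rw [plantedPar_append]
        obtain ⟨σ, hσ, hσ'⟩ := (Classical.choose_spec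
          (h.exists_below u (t.parent_mem u m hv))).kid (t.count_lt_childVector hm)
        rw [t.kidWord_count hm] at hσ'
        simp only [List.dropLast_concat, List.getLast?_append, List.getLast?_singleton,
          Option.some_or, Option.getD_some]
        rw [(Classical.choose_spec (h.exists_below _ hv)).unique hσ']
        simp only [hm]
        exact hσ
  kid_inj := by
    rintro (_ | ⟨v, hv⟩) (_ | ⟨w, hw⟩) h0 h1 h2 h3 h4 h5
    · exact absurd rfl h0
    · exact absurd rfl h0
    · exact absurd rfl h1
    · obtain rfl | ⟨u, m, rfl⟩ := List.eq_nil_or_concat' v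
      · exact absurd (t.plantedPar_eq_none.mpr rfl) h2
      obtain rfl | ⟨u', m', rfl⟩ := List.eq_nil_or_concat' w
      · rw [show t.plantedPar (some ⟨[], hw⟩) = none from t.plantedPar_eq_none.mpr rfl] at h3
        exact absurd h3 h2
      · rw [plantedPar_append, plantedPar_append] at h3
        obtain rfl : u = u' := congrArg Subtype.val (Option.some_inj.mp h3)
        have hm := t.label_eq_some_type ⟨u ++ [m], hv⟩
        have hm' := t.label_eq_some_type ⟨u ++ [m'], hw⟩
        have h4' : t.type ⟨u ++ [m], hv⟩ = t.type ⟨u ++ [m'], hw⟩ := h4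
        simp only at hm hm'
        rw [← h4'] at hm'
        simp only [List.dropLast_concat, List.getLast?_append, List.getLast?_singleton,
          Option.some_or, Option.getD_some, hm, hm'] at h5
        have : m = m' := by
          rw [← Nat.nth_count (p := fun n => t.label (u ++ [n]) = some (t.type ⟨u ++ [m], hv⟩)) hm,
            h5, Nat.nth_count (p := fun n => t.label (u ++ [n]) = some (t.type ⟨u ++ [m], hv⟩)) hm']
        subst this
        rfl
  kid_exists := by
    rintro (_ | ⟨v, hv⟩) h0 j k hk
    · exact absurd rfl h0
    · rw [← (Classical.choose_spec (h.exists_below v hv)).off_eq] at hk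
      have hl := t.label_kidWord hk
      have hne : t.label (t.kidWord v j k) ≠ none := by simp [hl]
      refine ⟨some ⟨t.kidWord v j k, hne⟩, by simp [planted, graphSpace], ?_, ?_, ?_⟩
      · exact t.plantedPar_append v _ hne
      · have := t.label_eq_some_type ⟨_, hne⟩
        rw [hl] at this
        exact (Option.some_inj.mp this).symm
      · simp only [hl]
        simp only [kidWord, List.dropLast_concat, List.getLast?_append, List.getLast?_singleton,
          Option.some_or, Option.getD_some]
        rw [childVector_eq_card] at hk
        refine Nat.count_nth fun hf => ?_
        convert hk

end MultitypeTree

end Unfolding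

/-! ### The law of Galton-Watson trees -/

section TreeLaw

variable {d : ℕ}

/-- The probability that the first `n` generations of a Galton-Watson tree, with their numbers of
children, are those of the given finite tree. -/
def FTree.weightUpTo (φ : Fin d → PMF (Fin d → ℕ)) : ℕ → FTree d → Fin d → ℝ≥0∞
  | 0, _, _ => 1
  | n + 1, WType.mk x f, i =>
      φ i x * ∏ b : Σ j, Fin (x j), FTree.weightUpTo φ n (f b) b.1

/-- The contribution of generation `n` to the probability of a finite tree. -/
def FTree.genWeight (φ : Fin d → PMF (Fin d → ℕ)) : ℕ → FTree d → Fin d → ℝ≥0∞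
  | 0, WType.mk x _, i => φ i x
  | n + 1, WType.mk x f, _ => ∏ b : Σ j, Fin (x j), FTree.genWeight φ n (f b) b.1

theorem FTree.weightUpTo_succ (φ : Fin d → PMF (Fin d → ℕ)) (n : ℕ) (τ : FTree d) (i : Fin d) :
    FTree.weightUpTo φ (n + 1) τ i = FTree.weightUpTo φ n τ i * FTree.genWeight φ n τ i := by
  induction n generalizing τ i with
  | zero =>
    obtain ⟨x, f⟩ := τ
    simp [FTree.weightUpTo, FTree.genWeight]
  | succ n ih =>
    obtain ⟨x, f⟩ := τ
    rw [FTree.weightUpTo, FTree.weightUpTo, FTree.genWeight, mul_assoc, ← Finset.prod_mul_distrib]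
    simp only [ih]

theorem FTree.weightUpTo_of_depth_le (φ : Fin d → PMF (Fin d → ℕ)) {n : ℕ} {τ : FTree d}
    (h : τ.depth ≤ n) (i : Fin d) : FTree.weightUpTo φ n τ i = FTree.weight φ τ i := by
  induction τ generalizing n i with
  | mk x f ih =>
    cases n with
    | zero => exact absurd h (not_le.mpr (WType.depth_pos _))
    | succ n =>
      rw [FTree.weightUpTo, FTree.weight]
      congr 1
      refine Finset.prod_congr rfl fun b _ => ih b ?_ b.1
      have : (f b).depth < (WType.mk x f : FTree d).depth :=
        WType.depth_lt_depth_mk (β := fun x : Fin d → ℕ => Σ j, Fin (x j)) x f b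
      omega

namespace MultitypeTree

/-- The tree up to generation `n`, as a finite object. -/
def truncate (n : ℕ) (t : MultitypeTree d) : Finset (List ℕ × Fin d) :=
  (((Set.finite_le_nat n).biUnion fun m _ => t.finite_generation m).prod
    (Set.finite_univ (α := Fin d))).toFinset.filter fun a => t.label a.1 = some a.2

theorem mem_truncate {n : ℕ} {t : MultitypeTree d} {a : List ℕ × Fin d} :
    a ∈ t.truncate n ↔ a.1.length ≤ n ∧ t.label a.1 = some a.2 := by
  simp only [truncate, Finset.mem_filter, Set.Finite.mem_toFinset, Set.mem_prod, Set.mem_iUnion,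
    Set.mem_univ, and_true]
  constructor
  · rintro ⟨⟨m, hm, h1, h2⟩, h3⟩
    exact ⟨h1.trans_le hm, h3⟩
  · rintro ⟨h1, h2⟩
    exact ⟨⟨_, h1, rfl, by simp [h2]⟩, h2⟩

theorem agreeUpTo_iff_truncate {n : ℕ} {t t' : MultitypeTree d} :
    t.AgreeUpTo n t' ↔ t.truncate n = t'.truncate n := by
  constructor
  · intro h
    ext a
    rw [mem_truncate, mem_truncate]
    exact and_congr_right fun ha => by rw [h a.1 ha]
  · intro h v hv
    refine Option.ext fun j => ?_
    have := Finset.ext_iff.mp h (v, j)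
    simpa [mem_truncate, hv] using this

theorem UnfoldsUpTo.congr {n m : ℕ} {t t' : MultitypeTree d} (h : t.AgreeUpTo m t') {τ : FTree d}
    {v : List ℕ} (hv : v.length + n ≤ m) (hu : t.UnfoldsUpTo n τ v) : t'.UnfoldsUpTo n τ v := by
  induction n generalizing τ v with
  | zero => trivial
  | succ n ih =>
    obtain ⟨x, f⟩ := τ
    refine ⟨(h.childVector_eq (by omega)).symm.trans hu.1, fun b => ?_⟩
    rw [← h.kidWord_eq (by omega)]
    exact ih (by rw [length_kidWord]; omega) (hu.2 b)

/-- If the first `n` generations below `u` unfold to `τ`, then the next ones do as well exactly when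
the child vectors `c v` of the vertices `v` in generation `n` below `u` have prescribed values, of
probability `genWeight φ n τ i`. -/
theorem exists_generation (φ : Fin d → PMF (Fin d → ℕ)) (t : MultitypeTree d) (n : ℕ) :
    ∀ (τ : FTree d) (u : List ℕ) (i : Fin d), t.label u = some i → t.UnfoldsUpTo n τ u →
      ∃ (D : Finset (List ℕ)) (c : List ℕ → Fin d → ℕ),
        (∀ v, v ∈ D ↔ (∃ w, w.length = n ∧ v = u ++ w) ∧ t.label v ≠ none) ∧
        (∀ t', t.AgreeUpTo (u.length + n) t' →
          (t'.UnfoldsUpTo (n + 1) τ u ↔ ∀ v ∈ D, t'.childVector v = c v)) ∧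
        ∏ v ∈ D, (t.label v).elim 1 (fun a => φ a (c v)) = FTree.genWeight φ n τ i := by
  induction n with
  | zero =>
    rintro ⟨x, f⟩ u i hu -
    refine ⟨{u}, fun _ => x, ?_, ?_, ?_⟩
    · intro v
      simp only [Finset.mem_singleton, List.length_eq_zero_iff]
      constructor
      · rintro rfl
        exact ⟨⟨[], rfl, by simp⟩, by simp [hu]⟩
      · rintro ⟨⟨w, rfl, rfl⟩, -⟩
        simp
    · intro t' _
      simp [UnfoldsUpTo]
    · simp [hu, FTree.genWeight]
  | succ n ih =>
    rintro ⟨x, f⟩ u i hu ⟨hx, hf⟩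
    have hlt : ∀ b : Σ j, Fin (x j), (b.2 : ℕ) < t.childVector u b.1 := fun b => by
      rw [hx]
      exact b.2.2
    choose D c hD hc hp using fun b : Σ j, Fin (x j) =>
      ih (f b) (t.kidWord u b.1 b.2) b.1 (t.label_kidWord (hlt b)) (hf b)
    have hdisj : ∀ b b' v, v ∈ D b → v ∈ D b' → b = b' := by
      intro b b' v hb hb'
      obtain ⟨⟨w, -, hw⟩, -⟩ := (hD b v).mp hb
      obtain ⟨⟨w', -, hw'⟩, -⟩ := (hD b' v).mp hb'
      have h1 := (List.append_inj (hw.symm.trans hw')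
        (by rw [length_kidWord, length_kidWord])).1
      obtain ⟨h2, h3⟩ := t.kidWord_inj (hlt b) (hlt b') h1
      obtain ⟨j, k⟩ := b
      obtain ⟨j', k'⟩ := b'
      obtain rfl : j = j' := h2
      obtain rfl : k = k' := Fin.ext h3
      rfl
    classical
    -- the prescribed child vectors, put together from those below the different children
    let C : List ℕ → Fin d → ℕ := fun v => if h : ∃ b, v ∈ D b then c (Classical.choose h) v else 0
    have hC : ∀ b v, v ∈ D b → C v = c b v := by
      intro b v hv
      have h : ∃ b, v ∈ D b := ⟨b, hv⟩
      simp only [C, dif_pos h]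
      rw [hdisj _ b v (Classical.choose_spec h) hv]
    refine ⟨Finset.univ.biUnion D, C, ?_, ?_, ?_⟩
    · intro v
      simp only [Finset.mem_biUnion, Finset.mem_univ, true_and]
      constructor
      · rintro ⟨b, hb⟩
        obtain ⟨⟨w, hw, rfl⟩, hl⟩ := (hD b _).mp hb
        refine ⟨⟨_, ?_, by rw [kidWord, List.append_assoc]⟩, hl⟩
        simp [hw]
      · rintro ⟨⟨w, hw, rfl⟩, hl⟩
        obtain ⟨m, w, rfl⟩ := List.exists_cons_of_length_eq_add_one hw
        have hl' : t.label (u ++ [m]) ≠ none := by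
          have key : ∀ w : List ℕ, t.label (u ++ [m] ++ w) ≠ none → t.label (u ++ [m]) ≠ none := by
            intro w
            induction w using List.reverseRecOn with
            | nil => simp
            | append_singleton w k ih' =>
              intro h
              rw [← List.append_assoc] at h
              exact ih' (t.parent_mem _ _ h)
          exact key w (by simpa using hl)
        obtain ⟨j, hj⟩ := Option.ne_none_iff_exists'.mp hl'
        have hk := t.count_lt_childVector hj
        rw [hx] at hk
        refine ⟨⟨j, ⟨_, hk⟩⟩, (hD _ _).mpr ⟨⟨w, by simpa using hw, ?_⟩, hl⟩⟩
        simp only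
        rw [t.kidWord_count hj]
        simp
    · intro t' ht'
      have h1 : t'.childVector u = x := (ht'.childVector_eq (by omega)).symm.trans hx
      have h2 : ∀ b : Σ j, Fin (x j), t'.kidWord u b.1 b.2 = t.kidWord u b.1 b.2 := fun b =>
        (ht'.kidWord_eq (by omega) _ _).symm
      have h3 : ∀ b : Σ j, Fin (x j), t'.UnfoldsUpTo (n + 1) (f b) (t'.kidWord u b.1 b.2) ↔
          ∀ v ∈ D b, t'.childVector v = c b v := by
        intro b
        rw [h2]
        refine hc b t' (ht'.mono ?_)
        rw [length_kidWord]
        omega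
      rw [UnfoldsUpTo]
      simp only [h1, h3, true_and, Finset.mem_biUnion, Finset.mem_univ]
      constructor
      · rintro h v ⟨b, hb⟩
        rw [h b v hb, hC b v hb]
      · intro h b v hb
        rw [h v ⟨b, hb⟩, hC b v hb]
    · rw [Finset.prod_biUnion fun b _ b' _ hbb' => Finset.disjoint_left.mpr fun v hv hv' =>
        hbb' (hdisj b b' v hv hv'), FTree.genWeight]
      refine Finset.prod_congr rfl fun b _ => ?_
      rw [← hp b]
      exact Finset.prod_congr rfl fun v hv => by rw [hC b v hv]

theorem measurableSet_label {Ω : Type*} [MeasurableSpace Ω] {T : Ω → MultitypeTree d}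
    (hT : Measurable T) (v : List ℕ) (a : Option (Fin d)) :
    MeasurableSet {ω | (T ω).label v = a} := by
  let _ : MeasurableSpace (Option (Fin d)) := ⊤
  have h1 : Measurable fun t : MultitypeTree d => t.label := comap_measurable label
  exact ((measurable_pi_apply v).comp (h1.comp hT)) (MeasurableSet.of_discrete (s := {a}))

theorem measurableSet_truncate {Ω : Type*} [MeasurableSpace Ω] {T : Ω → MultitypeTree d}
    (hT : Measurable T) (n : ℕ) (s : Set (Finset (List ℕ × Fin d))) :
    MeasurableSet {ω | (T ω).truncate n ∈ s} := by
  have h1 : ∀ F : Finset (List ℕ × Fin d), MeasurableSet {ω | (T ω).truncate n = F} := by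
    intro F
    have : {ω | (T ω).truncate n = F} = ⋂ a : List ℕ × Fin d,
        {ω | (a.1.length ≤ n ∧ (T ω).label a.1 = some a.2) ↔ a ∈ F} := by
      ext ω
      simp only [Set.mem_ofPred_eq, Set.mem_iInter, Finset.ext_iff, mem_truncate]
    rw [this]
    refine MeasurableSet.iInter fun a => ?_
    have hm := (MeasurableSet.const (a.1.length ≤ n)).inter (measurableSet_label hT a.1 (some a.2))
    by_cases ha : a ∈ F
    · simp only [ha, iff_true]
      exact hm
    · simp only [ha, iff_false]
      exact hm.compl
  have : {ω | (T ω).truncate n ∈ s} = ⋃ F ∈ s, {ω | (T ω).truncate n = F} := by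
    ext ω
    simp
  rw [this]
  exact MeasurableSet.biUnion s.to_countable fun F _ => h1 F

/-- The event depends on the truncated tree only, which takes countably many values. -/
theorem measurableSet_unfoldsUpTo {Ω : Type*} [MeasurableSpace Ω] {T : Ω → MultitypeTree d}
    (hT : Measurable T) (n : ℕ) (τ : FTree d) : MeasurableSet {ω | (T ω).UnfoldsUpTo n τ []} := by
  convert measurableSet_truncate hT n
    {F | ∃ t : MultitypeTree d, t.truncate n = F ∧ t.UnfoldsUpTo n τ []} using 1
  ext ω
  simp only [Set.mem_ofPred_eq]
  constructor
  · intro h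
    exact ⟨T ω, rfl, h⟩
  · rintro ⟨t, ht, h⟩
    exact h.congr (agreeUpTo_iff_truncate.mpr ht) (by simp)

end MultitypeTree

open MultitypeTree

variable {Ω : Type*} [MeasurableSpace Ω] {φ : Fin d → PMF (Fin d → ℕ)} {i₀ : Fin d}
  {P : Measure Ω} {T : Ω → MultitypeTree d}

/-- The event is split according to the tree up to generation `n`, to which the branching property
applies. -/
theorem IsMBGW.prob_unfoldsUpTo [IsProbabilityMeasure P] (hT : IsMBGW φ i₀ P T) (n : ℕ)
    (τ : FTree d) : P {ω | (T ω).label [] = some i₀ ∧ (T ω).UnfoldsUpTo n τ []} =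
      FTree.weightUpTo φ n τ i₀ := by
  induction n with
  | zero =>
    have h : ∀ᵐ ω ∂P, ω ∈ {ω | (T ω).label [] = some i₀ ∧ (T ω).UnfoldsUpTo 0 τ []} := by
      filter_upwards [hT.root_type] with ω hω
      exact ⟨hω, trivial⟩
    rw [FTree.weightUpTo, ← measure_univ (μ := P)]
    exact measure_congr (Filter.eventuallyEq_univ.mpr h)
  | succ n ih =>
    set A : ℕ → Set Ω := fun n => {ω | (T ω).label [] = some i₀ ∧ (T ω).UnfoldsUpTo n τ []} with hA
    have hAm : ∀ n, MeasurableSet (A n) := fun n =>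
      (measurableSet_label hT.measurable _ _).inter (measurableSet_unfoldsUpTo hT.measurable n τ)
    have hsplit : ∀ m, P (A m) = ∑' F : Finset (List ℕ × Fin d),
        P (A m ∩ {ω | (T ω).truncate n = F}) := by
      intro m
      rw [← measure_iUnion]
      · rw [← Set.inter_iUnion]
        congr 1
        ext ω
        simp
      · intro F F' hF
        refine Set.disjoint_left.mpr fun ω h1 h2 => hF ?_
        exact h1.2.symm.trans h2.2
      · intro F
        exact (hAm m).inter (measurableSet_truncate hT.measurable n {F})
    change P (A (n + 1)) = _
    rw [FTree.weightUpTo_succ, ← ih]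
    change P (A (n + 1)) = P (A n) * _
    rw [hsplit (n + 1), hsplit n, ← ENNReal.tsum_mul_right]
    congr 1
    funext F
    by_cases hF : ∃ t : MultitypeTree d, t.truncate n = F ∧ t.label [] = some i₀ ∧
        t.UnfoldsUpTo n τ []
    · obtain ⟨t, rfl, ht0, htn⟩ := hF
      obtain ⟨D, c, hD, hc, hp⟩ := exists_generation φ t n τ [] i₀ ht0 htn
      have hn : A n ∩ {ω | (T ω).truncate n = t.truncate n} = {ω | (T ω).AgreeUpTo n t} := by
        ext ω
        simp only [hA, Set.mem_inter_iff, Set.mem_ofPred_eq, ← agreeUpTo_iff_truncate]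
        refine ⟨fun h => h.2, fun h => ⟨⟨?_, ?_⟩, h⟩⟩
        · rw [h [] (by simp), ht0]
        · exact htn.congr (fun v hv => (h v hv).symm) (by simp)
      -- given the first `n` generations, the next one is a condition on the child vectors
      have hn1 : A (n + 1) ∩ {ω | (T ω).truncate n = t.truncate n} = {ω | (T ω).AgreeUpTo n t ∧
          ∀ v : t.Vertex, v.1.length = n → (T ω).childVector v.1 = c v.1} := by
        ext ω
        simp only [hA, Set.mem_inter_iff, Set.mem_ofPred_eq, ← agreeUpTo_iff_truncate]
        have hiff : (T ω).AgreeUpTo n t → ((T ω).UnfoldsUpTo (n + 1) τ [] ↔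
            ∀ v : t.Vertex, v.1.length = n → (T ω).childVector v.1 = c v.1) := by
          intro h
          rw [hc (T ω) fun v hv => (h v (by simpa using hv)).symm]
          constructor
          · intro h' v hv
            exact h' v.1 ((hD _).mpr ⟨⟨v.1, hv, rfl⟩, v.2⟩)
          · intro h' v hv
            obtain ⟨⟨w, hw, rfl⟩, hl⟩ := (hD v).mp hv
            exact h' ⟨_, hl⟩ hw
        constructor
        · rintro ⟨⟨-, h2⟩, h3⟩
          exact ⟨h3, (hiff h3).mp h2⟩
        · rintro ⟨h1, h2⟩
          exact ⟨⟨by rw [h1 [] (by simp), ht0], (hiff h1).mpr h2⟩, h1⟩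
      rw [hn, hn1, hT.branching n t c, ← hp]
      congr 1
      let e : {v : t.Vertex // v.1.length = n} ≃ D :=
        { toFun := fun v => ⟨v.1.1, (hD _).mpr ⟨⟨_, v.2, rfl⟩, v.1.2⟩⟩
          invFun := fun v => ⟨⟨v.1, ((hD _).mp v.2).2⟩, by
            obtain ⟨⟨w, hw, h⟩, -⟩ := (hD _).mp v.2
            simpa [h] using hw⟩
          left_inv := fun v => rfl
          right_inv := fun v => rfl }
      have := Fintype.ofEquiv _ e.symm
      rw [finprod_eq_prod_of_fintype, ← Finset.prod_coe_sort D]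
      refine Fintype.prod_equiv e _ _ fun v => ?_
      have hl := t.label_eq_some_type v.1
      have he : ((e v : D) : List ℕ) = v.1.1 := rfl
      rw [he, hl]
      rfl
    -- no tree that unfolds to `τ` in the first `n` generations has the truncation `F`
    · have h0 : ∀ m, n ≤ m → A m ∩ {ω | (T ω).truncate n = F} = ∅ := by
        intro m hm
        refine Set.eq_empty_iff_forall_notMem.mpr fun ω hω => hF ?_
        exact ⟨T ω, hω.2, hω.1.1, (T ω).unfoldsUpTo_mono hm hω.1.2⟩
      rw [h0 _ le_rfl, h0 _ (Nat.le_succ n)]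
      simp

/-- The law of a Galton-Watson tree with its children sorted by type. -/
theorem IsMBGW.prob_unfolds [IsProbabilityMeasure P] (hT : IsMBGW φ i₀ P T) (τ : FTree d) :
    P {ω | (T ω).label [] = some i₀ ∧ (T ω).Unfolds τ []} = FTree.weight φ τ i₀ := by
  simp only [unfolds_iff_unfoldsUpTo_depth]
  rw [hT.prob_unfoldsUpTo, FTree.weightUpTo_of_depth_le φ le_rfl]

theorem IsMBGW.measurableSet_unfolds (hT : IsMBGW φ i₀ P T) (τ : FTree d) :
    MeasurableSet {ω | (T ω).label [] = some i₀ ∧ (T ω).Unfolds τ []} := by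
  simp only [unfolds_iff_unfoldsUpTo_depth]
  exact (measurableSet_label hT.measurable _ _).inter
    (measurableSet_unfoldsUpTo hT.measurable _ τ)

end TreeLaw

/-! ### Concatenated lists -/

section FlatMap

variable {α β γ δ : Type}

/-- The position of the `k`-th entry of the block number `m` in a concatenation of lists. -/
def blockPos (f : α → List β) (l : List α) (m k : ℕ) : ℕ := ((l.take m).flatMap f).length + k

theorem blockPos_congr {f : α → List β} {g : γ → List δ} {l : List α} {l' : List γ}
    (h : l.map (fun a => (f a).length) = l'.map (fun a => (g a).length)) (m k : ℕ) :
    blockPos f l m k = blockPos g l' m k := by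
  simp only [blockPos, List.length_flatMap, List.map_take, h]

theorem flatMap_eq_of_getElem? (f : α → List β) {l : List α} {m : ℕ} {a : α}
    (h : l[m]? = some a) :
    l.flatMap f = (l.take m).flatMap f ++ (f a ++ (l.drop (m + 1)).flatMap f) := by
  obtain ⟨hm, rfl⟩ := List.getElem?_eq_some_iff.mp h
  conv_lhs => rw [← List.take_append_drop m l, List.drop_eq_getElem_cons hm, List.flatMap_append,
    List.flatMap_cons]

theorem drop_blockPos (f : α → List β) {l : List α} {m k : ℕ} {a : α} (h : l[m]? = some a)
    (hk : k ≤ (f a).length) : (l.flatMap f).drop (blockPos f l m k) =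
      (f a).drop k ++ (l.drop (m + 1)).flatMap f := by
  rw [flatMap_eq_of_getElem? f h, blockPos, List.drop_length_add_append,
    List.drop_append_of_le_length hk]

theorem take_blockPos (f : α → List β) {l : List α} {m k : ℕ} {a : α} (h : l[m]? = some a)
    (hk : k ≤ (f a).length) : (l.flatMap f).take (blockPos f l m k) =
      (l.take m).flatMap f ++ (f a).take k := by
  rw [flatMap_eq_of_getElem? f h, blockPos, List.take_length_add_append,
    List.take_append_of_le_length hk]

theorem getElem?_blockPos (f : α → List β) {l : List α} {m k : ℕ} {a : α} (h : l[m]? = some a)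
    (hk : k < (f a).length) : (l.flatMap f)[blockPos f l m k]? = (f a)[k]? := by
  have := congrArg (fun l : List β => l[0]?) (drop_blockPos f h hk.le)
  simp only [List.getElem?_drop, add_zero] at this
  rw [this, List.getElem?_append_left (by simpa using hk), List.getElem?_drop, add_zero]

theorem blockPos_lt_length (f : α → List β) {l : List α} {m k : ℕ} {a : α} (h : l[m]? = some a)
    (hk : k < (f a).length) : blockPos f l m k < (l.flatMap f).length := by
  have := getElem?_blockPos f h hk
  rw [List.getElem?_eq_getElem hk] at this
  exact (List.getElem?_eq_some_iff.mp this).1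

/-- Each entry of a concatenation lies in one of the blocks. -/
theorem exists_eq_blockPos (f : α → List β) (l : List α) {t : ℕ} (ht : t < (l.flatMap f).length) :
    ∃ m a k, l[m]? = some a ∧ k < (f a).length ∧ t = blockPos f l m k := by
  induction l generalizing t with
  | nil => simp at ht
  | cons a l ih =>
    by_cases h : t < (f a).length
    · exact ⟨0, a, t, rfl, h, by simp [blockPos]⟩
    · obtain ⟨m, b, k, h1, h2, h3⟩ := ih (t := t - (f a).length) (by
        rw [List.flatMap_cons, List.length_append] at ht
        omega)
      refine ⟨m + 1, b, k, by simpa using h1, h2, ?_⟩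
      rw [blockPos] at h3 ⊢
      rw [List.take_succ_cons, List.flatMap_cons, List.length_append]
      omega

end FlatMap

/-! ### The component of the root and its Łukasiewicz path -/

section Component

variable {d : ℕ}

namespace FTree

/-- The subtrees at the vertices of the component of the root, in depth-first order. The type of
the root being `i`, the component consists of the vertices which, as well as all their ancestors,
have type `i`. -/
def comp (i : Fin d) : FTree d → List (FTree d)
  | WType.mk x f => WType.mk x f :: (List.ofFn fun k => comp i (f ⟨i, k⟩)).flatten

theorem comp_eq (i : Fin d) (τ : FTree d) : τ.comp i = τ :: (τ.kids i).flatMap (comp i) := by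
  obtain ⟨x, f⟩ := τ
  rw [comp, kids, List.flatMap_def, List.map_ofFn]
  rfl

/-- The subtrees at the children of type `j` of the vertices of the component of the root. -/
def slotTrees (i j : Fin d) (τ : FTree d) : List (FTree d) :=
  (τ.comp i).flatMap fun σ => σ.kids j

theorem comp_ne_nil (i : Fin d) (τ : FTree d) : 0 < (τ.comp i).length := by
  rw [comp_eq]
  simp

theorem comp_zero (i : Fin d) (τ : FTree d) : (τ.comp i)[0]? = some τ := by
  rw [comp_eq]
  rfl

/-- In the depth-first order the descendants of a vertex follow it. -/
theorem drop_comp (i : Fin d) (τ σ : FTree d) (m : ℕ) (h : (τ.comp i)[m]? = some σ) :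
    ∃ l, (τ.comp i).drop m = σ.comp i ++ l := by
  induction τ using FTree.induction generalizing m with
  | h τ ih =>
    cases m with
    | zero =>
      rw [comp_zero] at h
      obtain rfl : τ = σ := Option.some_inj.mp h
      exact ⟨[], by simp⟩
    | succ m =>
      rw [comp_eq, List.getElem?_cons_succ] at h
      obtain ⟨p, κ, k, h1, h2, rfl⟩ := exists_eq_blockPos (comp i) (τ.kids i)
        (List.getElem?_eq_some_iff.mp h).1
      rw [getElem?_blockPos _ h1 h2] at h
      obtain ⟨l, hl⟩ := ih i κ (List.mem_of_getElem? h1) k h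
      rw [comp_eq, List.drop_succ_cons, drop_blockPos _ h1 h2.le, hl, List.append_assoc]
      exact ⟨_, rfl⟩

/-- The position of the `k`-th child (in the component) of the vertex number `m`, at which the tree
is `σ`. -/
def kidPos (i : Fin d) (σ : FTree d) (m k : ℕ) : ℕ := m + 1 + blockPos (comp i) (σ.kids i) k 0

theorem comp_kidPos {i : Fin d} {τ σ κ : FTree d} {m k : ℕ} (h : (τ.comp i)[m]? = some σ)
    (hk : (σ.kids i)[k]? = some κ) : (τ.comp i)[kidPos i σ m k]? = some κ := by
  obtain ⟨l, hl⟩ := drop_comp i τ σ m h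
  rw [kidPos, add_assoc, ← List.getElem?_drop, hl, comp_eq, List.cons_append, add_comm 1,
    List.getElem?_cons_succ,
    List.getElem?_append_left (blockPos_lt_length (comp i) hk (comp_ne_nil i κ)),
    getElem?_blockPos (comp i) hk (comp_ne_nil i κ), comp_zero]

/-- Each vertex of the component other than its root is a child of another one. -/
theorem exists_eq_kidPos (i : Fin d) (τ : FTree d) {t : ℕ} (h0 : t ≠ 0)
    (ht : t < (τ.comp i).length) :
    ∃ m σ k, (τ.comp i)[m]? = some σ ∧ k < σ.off i ∧ t = kidPos i σ m k := by
  induction τ using FTree.induction generalizing t with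
  | h τ ih =>
    obtain ⟨t, rfl⟩ := Nat.exists_eq_succ_of_ne_zero h0
    rw [comp_eq, List.length_cons, Nat.succ_lt_succ_iff] at ht
    obtain ⟨p, κ, q, h1, h2, rfl⟩ := exists_eq_blockPos (comp i) (τ.kids i) ht
    by_cases hq : q = 0
    · subst hq
      refine ⟨0, τ, p, comp_zero i τ, ?_, by rw [kidPos]; omega⟩
      rw [← length_kids]
      exact (List.getElem?_eq_some_iff.mp h1).1
    · obtain ⟨m, σ, k, e1, e2, e3⟩ := ih i κ (List.mem_of_getElem? h1) hq h2
      refine ⟨blockPos (comp i) (τ.kids i) p m + 1, σ, k, ?_, e2, ?_⟩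
      · rw [comp_eq, List.getElem?_cons_succ, getElem?_blockPos _ h1
          (List.getElem?_eq_some_iff.mp e1).1, e1]
      · rw [e3]
        simp only [kidPos, blockPos]
        omega

theorem kidPos_strictMono {i : Fin d} {σ : FTree d} (m : ℕ) {k k' : ℕ} (hk : k < k')
    (hk' : k' ≤ σ.off i) : kidPos i σ m k < kidPos i σ m k' := by
  simp only [kidPos, blockPos, add_lt_add_iff_left, add_zero]
  induction k', hk using Nat.le_induction with
  | base =>
    have hlt : k < (σ.kids i).length := by rw [length_kids]; omega
    rw [List.take_succ_eq_append_getElem hlt, List.flatMap_append, List.length_append]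
    have := comp_ne_nil i (σ.kids i)[k]
    simp only [List.flatMap_cons, List.flatMap_nil, List.append_nil]
    omega
  | succ n hn ih =>
    refine (ih (by omega)).trans_le ?_
    have hlt : n < (σ.kids i).length := by rw [length_kids]; omega
    rw [List.take_succ_eq_append_getElem hlt, List.flatMap_append, List.length_append]
    omega

/-- The total increment of a list of steps of the walk. -/
def stepSum (i : Fin d) (l : List (FTree d)) : ℤ := (l.map fun σ => (σ.off i : ℤ) - 1).sum

@[simp]
theorem stepSum_append (i : Fin d) (l l' : List (FTree d)) :
    stepSum i (l ++ l') = stepSum i l + stepSum i l' := by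
  simp [stepSum]

@[simp]
theorem stepSum_nil (i : Fin d) : stepSum i [] = 0 := rfl

@[simp]
theorem stepSum_cons (i : Fin d) (σ : FTree d) (l : List (FTree d)) :
    stepSum i (σ :: l) = (σ.off i - 1) + stepSum i l := by
  simp [stepSum]

theorem stepSum_flatMap {i : Fin d} {l : List (FTree d)}
    (h : ∀ σ ∈ l, stepSum i (σ.comp i) = -1) : stepSum i (l.flatMap (comp i)) = -l.length := by
  induction l with
  | nil => simp
  | cons σ l ih =>
    rw [List.flatMap_cons, stepSum_append, h σ (by simp), ih fun σ' hσ' => h σ' (by simp [hσ'])]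
    simp

/-- A finite tree has one vertex more than it has edges. -/
theorem stepSum_comp (i : Fin d) (τ : FTree d) : stepSum i (τ.comp i) = -1 := by
  induction τ using FTree.induction with
  | h τ ih =>
    rw [comp_eq, stepSum_cons, stepSum_flatMap (ih i), length_kids]
    ring

theorem stepSum_take_flatMap {i : Fin d} {l : List (FTree d)} {p k : ℕ} {κ : FTree d}
    (h : l[p]? = some κ) (hk : k ≤ (κ.comp i).length) :
    stepSum i ((l.flatMap (comp i)).take (blockPos (comp i) l p k)) =
      -p + stepSum i ((κ.comp i).take k) := by
  rw [take_blockPos _ h hk, stepSum_append, stepSum_flatMap fun σ _ => stepSum_comp i σ,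
    List.length_take, min_eq_left (List.getElem?_eq_some_iff.mp h).1.le]

/-- The walk of the component of the root stays nonnegative before the end. -/
theorem stepSum_take_comp_nonneg (i : Fin d) (τ : FTree d) {m : ℕ} (hm : m < (τ.comp i).length) :
    0 ≤ stepSum i ((τ.comp i).take m) := by
  induction τ using FTree.induction generalizing m with
  | h τ ih =>
    cases m with
    | zero => simp
    | succ m =>
      rw [comp_eq, List.length_cons, Nat.succ_lt_succ_iff] at hm
      obtain ⟨p, κ, k, h1, h2, rfl⟩ := exists_eq_blockPos (comp i) (τ.kids i) hm
      rw [comp_eq, List.take_succ_cons, stepSum_cons, stepSum_take_flatMap h1 h2.le]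
      have h3 := ih i κ (List.mem_of_getElem? h1) h2
      have h4 := (List.getElem?_eq_some_iff.mp h1).1
      rw [length_kids] at h4
      omega

/-- The walk whose steps are the vectors of the numbers of children in the component of the root,
in depth-first order. -/
def path (i : Fin d) (τ : FTree d) : Path d :=
  ⟨(τ.comp i).length, fun m j =>
    (((τ.comp i).take m).map fun σ => (σ.off j : ℤ) - if j = i then 1 else 0).sum⟩

theorem val_path (i : Fin d) (τ : FTree d) (m : ℕ) (j : Fin d) : (τ.path i).val m j =
    (((τ.comp i).take m).map fun σ => (σ.off j : ℤ) - if j = i then 1 else 0).sum := by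
  simp only [Path.val, path]
  rcases le_total m (τ.comp i).length with h | h
  · rw [min_eq_left h]
  · rw [min_eq_right h, List.take_length, List.take_of_length_le h]

theorem len_path (i : Fin d) (τ : FTree d) : (τ.path i).len = (τ.comp i).length := rfl

theorem val_path_self (i : Fin d) (τ : FTree d) (m : ℕ) :
    (τ.path i).val m i = stepSum i ((τ.comp i).take m) := by
  simp [val_path, stepSum]

theorem val_path_succ (i : Fin d) {τ σ : FTree d} {m : ℕ} (h : (τ.comp i)[m]? = some σ)
    (j : Fin d) : (τ.path i).val (m + 1) j =
      (τ.path i).val m j + ((σ.off j : ℤ) - if j = i then 1 else 0) := by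
  rw [val_path, val_path, List.take_add_one, h]
  simp

theorem val_path_add (i : Fin d) {τ σ : FTree d} {m r : ℕ} (h : (τ.comp i)[m]? = some σ)
    (hr : r ≤ (σ.comp i).length) :
    (τ.path i).val (m + r) i = (τ.path i).val m i + stepSum i ((σ.comp i).take r) := by
  obtain ⟨l, hl⟩ := drop_comp i τ σ m h
  rw [val_path_self, val_path_self, List.take_add, stepSum_append, hl,
    List.take_append_of_le_length hr]

/-- The parents in the tree coded by the Łukasiewicz path are the parents in the component. -/
theorem parent_kidPos {i : Fin d} {τ σ : FTree d} {m k : ℕ} (h : (τ.comp i)[m]? = some σ)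
    (hk : k < σ.off i) : (τ.path i).parent i (kidPos i σ m k + 1) = m + 1 := by
  have hk' : k < (σ.kids i).length := by rwa [length_kids]
  have hκ : (σ.kids i)[k]? = some (σ.kids i)[k] := List.getElem?_eq_getElem hk'
  set κ := (σ.kids i)[k]
  set L := blockPos (comp i) (σ.kids i) k 0 with hL
  have hLlt : L < ((σ.kids i).flatMap (comp i)).length :=
    blockPos_lt_length (comp i) hκ (comp_ne_nil i κ)
  have hlen : (σ.comp i).length = ((σ.kids i).flatMap (comp i)).length + 1 := by
    rw [comp_eq, List.length_cons]
  have hend : (τ.path i).val (m + (1 + L)) i = (τ.path i).val m i + (σ.off i - 1 - k) := by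
    rw [val_path_add i h (by omega), add_comm 1 L, comp_eq, List.take_succ_cons, stepSum_cons,
      stepSum_take_flatMap hκ (Nat.zero_le _)]
    simp
    ring
  rw [Path.parent, Nat.findGreatest_eq_iff]
  have hpos : kidPos i σ m k + 1 - 1 = m + (1 + L) := by
    rw [kidPos]
    omega
  rw [hpos]
  refine ⟨by omega, fun _ => ⟨by omega, fun r hr1 hr2 => ?_⟩, fun n hn1 hn2 hn => ?_⟩
  -- the walk stays above its value at `m` on the way through the tree `σ`
  · obtain ⟨s, rfl⟩ := Nat.exists_eq_add_of_le (show m ≤ r by omega)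
    rw [Nat.add_sub_cancel, val_path_add i h (by omega)]
    have := stepSum_take_comp_nonneg i σ (m := s) (by omega)
    omega
  -- a vertex between `m` and the child lies in the tree of an elder sibling `p < k` of the child,
  -- where the walk exceeds its value at the child
  · have hlast := hn.2 (m + (1 + L)) (by omega) le_rfl
    obtain ⟨l, rfl⟩ := Nat.exists_eq_add_of_le (show m + 2 ≤ n by omega)
    have hl : l < (((σ.kids i).take k).flatMap (comp i)).length := by
      rw [hL, blockPos] at hn2
      omega
    obtain ⟨p, κ', q, e1, e2, e3⟩ := exists_eq_blockPos (comp i) _ hl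
    have hpk : p < k := by
      have := (List.getElem?_eq_some_iff.mp e1).1
      rw [List.length_take] at this
      omega
    rw [List.getElem?_take_of_lt hpk] at e1
    have e3' : l = blockPos (comp i) (σ.kids i) p q := by
      rw [e3, blockPos, blockPos, List.take_take, min_eq_left hpk.le]
    have hval : (τ.path i).val (m + 2 + l - 1) i =
        (τ.path i).val m i + (σ.off i - 1 + (-p + stepSum i ((κ'.comp i).take q))) := by
      rw [show m + 2 + l - 1 = m + (l + 1) by omega, val_path_add i h (by omega), comp_eq,
        List.take_succ_cons, stepSum_cons, e3', stepSum_take_flatMap e1 e2.le]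
    have := stepSum_take_comp_nonneg i κ' e2
    rw [hval, hend] at hlast
    omega

theorem parent_one (i : Fin d) (w : Path d) : w.parent i 1 = 0 := by
  simp [Path.parent]

/-- The increments of the `j`-th coordinate of the path are the numbers of children of type `j`. -/
theorem map_length_slots (i : Fin d) (τ : FTree d) {j : Fin d} (hj : j ≠ i) :
    (List.finRange (τ.path i).len).map (fun m : Fin (τ.path i).len =>
      (List.replicate ((τ.path i).val ((m : ℕ) + 1) j - (τ.path i).val m j).toNat
        (m.succ : (τ.path i).Vertex)).length) =
      (τ.comp i).map fun σ => (σ.kids j).length := by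
  refine List.ext_getElem (by simp [len_path]) fun m h1 h2 => ?_
  have hm : m < (τ.comp i).length := by simpa using h2
  have := val_path_succ i (List.getElem?_eq_getElem hm) j
  simp only [List.getElem_map, List.length_replicate, length_kids, List.getElem_finRange,
    Fin.val_cast]
  rw [this, if_neg hj]
  simp

theorem length_slots (i : Fin d) (τ : FTree d) {j : Fin d} (hj : j ≠ i) :
    ((τ.path i).slots j).length = (τ.slotTrees i j).length := by
  rw [Path.slots, slotTrees, List.length_flatMap, List.length_flatMap, map_length_slots i τ hj]

/-- The children of type `j` of the vertex number `m` (counted from `0`) of the component are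
listed in `slots` and in `slotTrees` from the same position on. -/
theorem slots_blockPos {i : Fin d} {τ σ : FTree d} {j : Fin d} (hj : j ≠ i) {m k : ℕ}
    (h : (τ.comp i)[m]? = some σ) (hk : k < σ.off j) :
    (((τ.path i).slots j)[blockPos (fun σ => σ.kids j) (τ.comp i) m k]?).map Fin.val =
      some (m + 1) := by
  have hm : m < (τ.path i).len := (List.getElem?_eq_some_iff.mp h).1
  rw [Path.slots, ← blockPos_congr (f := fun m : Fin (τ.path i).len =>
      List.replicate ((τ.path i).val ((m : ℕ) + 1) j - (τ.path i).val m j).toNat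
        (m.succ : (τ.path i).Vertex)) (map_length_slots i τ hj),
    getElem?_blockPos _ (a := ⟨m, hm⟩)]
  · rw [List.getElem?_replicate, if_pos]
    · simp
    · have := val_path_succ i h j
      rw [if_neg hj] at this
      simp only
      omega
  · simp [hm]
  · have := val_path_succ i h j
    rw [if_neg hj] at this
    simp only [List.length_replicate]
    omega

theorem slotTrees_blockPos {i : Fin d} {τ σ : FTree d} {j : Fin d} {m k : ℕ}
    (h : (τ.comp i)[m]? = some σ) (hk : k < σ.off j) :
    (τ.slotTrees i j)[blockPos (fun σ => σ.kids j) (τ.comp i) m k]? = (σ.kids j)[k]? :=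
  getElem?_blockPos _ h (by rwa [length_kids])

/-- The weight of a tree in terms of the component of its root. -/
theorem weight_eq_comp (φ : Fin d → PMF (Fin d → ℕ)) (i : Fin d) (τ : FTree d) :
    weight φ τ i = ((τ.comp i).map fun σ => φ i σ.off).prod *
      ∏ j : {j // j ≠ i}, ((τ.slotTrees i j).map fun σ => weight φ σ j).prod := by
  classical
  have key : ∀ l : List (FTree d), (∀ σ ∈ l, weight φ σ i =
      ((σ.comp i).map fun σ => φ i σ.off).prod *
      ∏ j : {j // j ≠ i}, ((σ.slotTrees i j).map fun σ => weight φ σ j).prod) →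
      (l.map fun σ => weight φ σ i).prod = ((l.flatMap (comp i)).map fun σ => φ i σ.off).prod *
      ∏ j : {j // j ≠ i}, ((((l.flatMap (comp i)).flatMap fun σ => σ.kids j)).map
        fun σ => weight φ σ j).prod := by
    intro l
    induction l with
    | nil => simp
    | cons σ l ih =>
      intro h
      rw [List.map_cons, List.prod_cons, ih fun σ' hσ' => h σ' (by simp [hσ']), h σ (by simp)]
      simp only [List.flatMap_cons, List.flatMap_append, List.map_append, List.prod_append,
        Finset.prod_mul_distrib, slotTrees]
      ring
  induction τ using FTree.induction with
  | h τ ih =>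
    have hsplit : ∏ j, ((τ.kids j).map fun σ => weight φ σ j).prod =
        ((τ.kids i).map fun σ => weight φ σ i).prod *
          ∏ j : {j // j ≠ i}, ((τ.kids j).map fun σ => weight φ σ j).prod := by
      rw [Fintype.prod_eq_mul_prod_subtype_ne _ i]
    rw [weight_eq, hsplit, key _ (ih i)]
    simp only [slotTrees]
    rw [comp_eq]
    simp only [List.flatMap_cons, List.map_append, List.prod_append, Finset.prod_mul_distrib,
      List.map_cons, List.prod_cons]
    ring

theorem depth_lt_of_mem_kids {τ σ : FTree d} {j : Fin d} (h : σ ∈ τ.kids j) :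
    σ.depth < τ.depth := by
  obtain ⟨x, f⟩ := τ
  obtain ⟨k, rfl⟩ := (List.mem_ofFn' _ _).mp h
  exact WType.depth_lt_depth_mk (β := fun x : Fin d → ℕ => Σ j, Fin (x j)) x f ⟨j, k⟩

theorem depth_le_of_mem_comp {i : Fin d} {τ σ : FTree d} (h : σ ∈ τ.comp i) :
    σ.depth ≤ τ.depth := by
  induction τ using FTree.induction with
  | h τ ih =>
    rw [comp_eq, List.mem_cons, List.mem_flatMap] at h
    rcases h with rfl | ⟨κ, hκ, h⟩
    · exact le_rfl
    · exact (ih i κ hκ h).trans (depth_lt_of_mem_kids hκ).le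

theorem depth_lt_of_mem_slotTrees {i j : Fin d} {τ σ : FTree d} (h : σ ∈ τ.slotTrees i j) :
    σ.depth < τ.depth := by
  obtain ⟨κ, hκ, h⟩ := List.mem_flatMap.mp h
  exact (depth_lt_of_mem_kids h).trans_le (depth_le_of_mem_comp hκ)

/-- A tree is determined by the vectors of the numbers of children in the component of its root and
by the trees attached to the component. The lists are allowed to continue, so that the
statement passes to forests. -/
theorem eq_of_comp_append {i : Fin d} (τ : FTree d) :
    ∀ (τ' : FTree d) (l l' : List (Fin d → ℕ)) (r r' : Fin d → List (FTree d)),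
      (τ.comp i).map off ++ l = (τ'.comp i).map off ++ l' →
      (∀ j, j ≠ i → τ.slotTrees i j ++ r j = τ'.slotTrees i j ++ r' j) →
      τ = τ' ∧ l = l' ∧ ∀ j, j ≠ i → r j = r' j := by
  have forest : ∀ F : List (FTree d), (∀ τ ∈ F,
      ∀ (τ' : FTree d) (l l' : List (Fin d → ℕ)) (r r' : Fin d → List (FTree d)),
      (τ.comp i).map off ++ l = (τ'.comp i).map off ++ l' →
      (∀ j, j ≠ i → τ.slotTrees i j ++ r j = τ'.slotTrees i j ++ r' j) →
      τ = τ' ∧ l = l' ∧ ∀ j, j ≠ i → r j = r' j) →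
      ∀ (F' : List (FTree d)) (l l' : List (Fin d → ℕ)) (r r' : Fin d → List (FTree d)),
      F.length = F'.length →
      (F.flatMap (comp i)).map off ++ l = (F'.flatMap (comp i)).map off ++ l' →
      (∀ j, j ≠ i → F.flatMap (slotTrees i j) ++ r j = F'.flatMap (slotTrees i j) ++ r' j) →
      F = F' ∧ l = l' ∧ ∀ j, j ≠ i → r j = r' j := by
    intro F
    induction F with
    | nil =>
      intro _ F' l l' r r' hF h1 h2
      obtain rfl : F' = [] := List.length_eq_zero_iff.mp hF.symm
      exact ⟨rfl, by simpa using h1, fun j hj => by simpa using h2 j hj⟩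
    | cons τ F ihF =>
      intro ih F' l l' r r' hF h1 h2
      obtain ⟨τ', F', rfl⟩ := List.exists_cons_of_length_eq_add_one hF.symm
      simp only [List.flatMap_cons, List.map_append, List.append_assoc] at h1 h2
      obtain ⟨e1, e2, e3⟩ := ih τ (by simp) τ' _ _
        (fun j => F.flatMap (slotTrees i j) ++ r j) (fun j => F'.flatMap (slotTrees i j) ++ r' j)
        h1 h2
      obtain ⟨e4, e5, e6⟩ := ihF (fun σ hσ => ih σ (by simp [hσ])) F' l l' r r'
        (by simpa using hF) e2 e3
      exact ⟨by rw [e1, e4], e5, e6⟩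
  induction τ using FTree.induction with
  | h τ ih =>
    intro τ' l l' r r' h1 h2
    rw [comp_eq i τ, comp_eq i τ'] at h1
    simp only [List.map_cons, List.cons_append, List.cons.injEq] at h1
    have hslot : ∀ (σ : FTree d) (j : Fin d), σ.slotTrees i j =
        σ.kids j ++ (σ.kids i).flatMap (slotTrees i j) := by
      intro σ j
      rw [slotTrees, comp_eq, List.flatMap_cons, List.flatMap_assoc]
      rfl
    simp only [hslot, List.append_assoc] at h2
    have hkids : ∀ j, j ≠ i → τ.kids j = τ'.kids j ∧ (τ.kids i).flatMap (slotTrees i j) ++ r j =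
        (τ'.kids i).flatMap (slotTrees i j) ++ r' j := fun j hj =>
      List.append_inj (h2 j hj) (by rw [length_kids, length_kids, h1.1])
    obtain ⟨e1, e2, e3⟩ := forest (τ.kids i) (ih i) (τ'.kids i) l l' r r'
      (by rw [length_kids, length_kids, h1.1]) h1.2 fun j hj => (hkids j hj).2
    refine ⟨FTree.ext fun j => ?_, e2, e3⟩
    by_cases hj : j = i
    · exact hj ▸ e1
    · exact (hkids j hj).1

/-- The path of a tree and the trees attached to the component of the root determine the tree. -/
theorem eq_of_path_eq {i : Fin d} {τ τ' : FTree d} (h : τ.path i = τ'.path i)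
    (hs : ∀ j, j ≠ i → τ.slotTrees i j = τ'.slotTrees i j) : τ = τ' := by
  refine (eq_of_comp_append τ τ' [] [] (fun _ => []) (fun _ => []) ?_ (by simpa using hs)).1
  rw [List.append_nil, List.append_nil]
  have hlen : (τ.comp i).length = (τ'.comp i).length := congrArg Path.len h
  refine List.ext_getElem (by simpa using hlen) fun m h1 h2 => ?_
  rw [List.length_map] at h1 h2
  rw [List.getElem_map, List.getElem_map]
  funext j
  have e1 := val_path_succ i (List.getElem?_eq_getElem h1) j
  have e2 := val_path_succ i (List.getElem?_eq_getElem h2) j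
  rw [h] at e1
  omega

end FTree

end Component

/-! ### The law of a subdecoration -/

section SampleLaw

variable {d : ℕ}

theorem excursion_eq {i : Fin d} {ξ : ℕ → Fin d → ℕ} {n : ℕ} (h : hit i ξ = n) :
    excursion i ξ = ⟨n, fun m => walk i ξ m⟩ := by
  subst h
  rfl

/-- The excursion is the path of `τ` if its steps are the child vectors in the component of the
root, because the path hits `-1` at its end and not before. -/
theorem excursion_eq_path_iff (i : Fin d) (τ : FTree d) (ξ : ℕ → Fin d → ℕ) :
    excursion i ξ = τ.path i ↔
      ∀ k ∈ Finset.range (τ.comp i).length, ξ k ∈ ({((τ.comp i).getD k default).off} : Set _) := by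
  have hget : ∀ k, k < (τ.comp i).length → (τ.comp i)[k]? = some ((τ.comp i).getD k default) := by
    intro k hk
    rw [List.getD_eq_getElem _ _ hk, List.getElem?_eq_getElem hk]
  constructor
  · intro h k hk
    have hk' := Finset.mem_range.mp hk
    have hlen : hit i ξ = (τ.comp i).length := congrArg Path.len h
    have hval : ∀ m ≤ (τ.comp i).length, ∀ j, walk i ξ m j = (τ.path i).val m j := by
      intro m hm j
      rw [← h, Path.val]
      simp only [excursion]
      rw [min_eq_left (hm.trans hlen.ge)]
    refine funext fun j => ?_
    have h1 := hval (k + 1) hk' j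
    rw [FTree.val_path_succ i (hget k hk'), ← hval k hk'.le, walk, Finset.sum_range_succ] at h1
    rw [walk] at h1
    omega
  · intro h
    have hval : ∀ m ≤ (τ.comp i).length, ∀ j, walk i ξ m j = (τ.path i).val m j := by
      intro m
      induction m with
      | zero =>
        intro _ j
        simp [walk, FTree.val_path]
      | succ m ih =>
        intro hm j
        have hm' : m < (τ.comp i).length := hm
        have hx : ξ m = ((τ.comp i).getD m default).off := h m (Finset.mem_range.mpr hm')
        rw [FTree.val_path_succ i (hget m hm'), ← ih hm'.le j, walk, Finset.sum_range_succ, ← hx]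
        rfl
    have hhit : hit i ξ = (τ.comp i).length := by
      refine le_antisymm (Nat.sInf_le ?_) ?_
      · change walk i ξ _ i = -1
        rw [hval _ le_rfl, FTree.val_path_self, List.take_length, FTree.stepSum_comp]
      · by_contra hlt
        rw [not_le] at hlt
        have hmem : walk i ξ (hit i ξ) i = -1 := by
          refine Nat.sInf_mem (s := {m | walk i ξ m i = -1}) ⟨(τ.comp i).length, ?_⟩
          change walk i ξ _ i = -1
          rw [hval _ le_rfl, FTree.val_path_self, List.take_length, FTree.stepSum_comp]
        rw [hval _ hlt.le, FTree.val_path_self] at hmem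
        have := FTree.stepSum_take_comp_nonneg i τ hlt
        omega
    rw [excursion_eq hhit, FTree.path]
    congr 1
    funext m j
    rw [hval m (Nat.lt_succ_iff.mp m.2) j, FTree.val_path]

/-- The probability that the excursion codes the component of the root of `τ`. -/
theorem excursionLaw_path (φ : Fin d → PMF (Fin d → ℕ)) (i : Fin d) (τ : FTree d) :
    excursionLaw φ i {τ.path i} = ((τ.comp i).map fun σ => φ i σ.off).prod := by
  rw [excursionLaw, Measure.map_apply (measurable_excursion i) (measurableSet_singleton _)]
  have : excursion i ⁻¹' {τ.path i} = Set.pi (Finset.range (τ.comp i).length)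
      fun k => ({((τ.comp i).getD k default).off} : Set (Fin d → ℕ)) := by
    ext ξ
    rw [Set.mem_preimage, Set.mem_singleton_iff, excursion_eq_path_iff]
    rfl
  rw [this, Measure.infinitePi_pi _ fun k _ => measurableSet_singleton _]
  simp only [PMF.toMeasure_apply_singleton _ _ (measurableSet_singleton _)]
  rw [Finset.prod_range]
  conv_rhs => rw [← List.ofFn_getElem (xs := τ.comp i), List.map_ofFn, List.prod_ofFn]
  refine Finset.prod_congr rfl fun k _ => ?_
  rw [List.getD_eq_getElem _ _ k.2]
  rfl

instance (i : Fin d) : DiscreteMeasurableSpace (Sample d i) := ⟨fun _ => trivial⟩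

instance (i : Fin d) : Countable (Sample d i) := by
  have : Function.Injective fun c : Sample d i =>
      (⟨c.path, c.perm⟩ :
        Σ w : Path d, ∀ j : {j // j ≠ i}, Equiv.Perm (Fin (w.slots j).length)) := by
    rintro ⟨w, π⟩ ⟨w', π'⟩ h
    simp only [Sigma.mk.injEq] at h
    obtain ⟨rfl, h⟩ := h
    rw [eq_of_heq h]
  exact this.countable

theorem lintegral_sampleLaw (φ : Fin d → PMF (Fin d → ℕ)) (i : Fin d) (g : Sample d i → ℝ≥0∞) :
    ∫⁻ c, g c ∂sampleLaw φ i = ∫⁻ w, ∑ π : ∀ j : {j // j ≠ i}, Equiv.Perm (Fin (w.slots j).length),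
      (Fintype.card (∀ j : {j // j ≠ i}, Equiv.Perm (Fin (w.slots j).length)) : ℝ≥0∞)⁻¹ *
        g ⟨w, π⟩ ∂excursionLaw φ i := by
  rw [sampleLaw, Measure.lintegral_bind measurable_from_top.aemeasurable
    (measurable_from_top (f := g)).aemeasurable]
  congr 1
  funext w
  let _ : MeasurableSpace (∀ j : {j // j ≠ i}, Equiv.Perm (Fin (w.slots j).length)) := ⊤
  have _ : DiscreteMeasurableSpace (∀ j : {j // j ≠ i}, Equiv.Perm (Fin (w.slots j).length)) :=
    ⟨fun _ => trivial⟩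
  rw [← PMF.toMeasure_map _ _ measurable_from_top,
    lintegral_map measurable_from_top measurable_from_top, lintegral_fintype]
  refine Finset.sum_congr rfl fun π _ => ?_
  rw [PMF.toMeasure_apply_singleton _ _ (measurableSet_singleton _),
    PMF.uniformOfFintype_apply, mul_comm]

/-- Integration of a function which charges only one path. -/
theorem lintegral_sampleLaw_of_path (φ : Fin d → PMF (Fin d → ℕ)) (i : Fin d)
    (g : Sample d i → ℝ≥0∞) (w : Path d) (hg : ∀ c : Sample d i, c.path ≠ w → g c = 0) :
    ∫⁻ c, g c ∂sampleLaw φ i = excursionLaw φ i {w} *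
      ∑ π : ∀ j : {j // j ≠ i}, Equiv.Perm (Fin (w.slots j).length),
      (Fintype.card (∀ j : {j // j ≠ i}, Equiv.Perm (Fin (w.slots j).length)) : ℝ≥0∞)⁻¹ *
        g ⟨w, π⟩ := by
  rw [lintegral_sampleLaw, lintegral_countable', tsum_eq_single w, mul_comm]
  intro w' hw'
  rw [Finset.sum_eq_zero fun π _ => by rw [hg ⟨w', π⟩ hw', mul_zero], zero_mul]

end SampleLaw

/-! ### Independence of the root samples and the shifted samples -/

section Streams

variable {d : ℕ}

/-- Families of samples indexed by the vertices of the Ulam tree, the types and the ranks. -/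
abbrev Stream (d : ℕ) : Type := ∀ a : List ℕ × Fin d × ℕ, Sample d a.2.1

/-- The samples of a stream are independent. -/
def streamLaw (φ : Fin d → PMF (Fin d → ℕ)) : Measure (Stream d) :=
  Measure.infinitePi fun a : List ℕ × Fin d × ℕ => sampleLaw φ a.2.1

instance (φ : Fin d → PMF (Fin d → ℕ)) : IsProbabilityMeasure (streamLaw φ) :=
  inferInstanceAs (IsProbabilityMeasure (Measure.infinitePi _))

/-- The law of the samples at a single vertex of the Ulam tree. -/
def rootLaw (φ : Fin d → PMF (Fin d → ℕ)) : Measure (∀ b : Fin d × ℕ, Sample d b.1) :=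
  Measure.infinitePi fun b : Fin d × ℕ => sampleLaw φ b.1

/-- The stream with given samples at the root and given streams above the children of the root. -/
def joinStream (x : (∀ b : Fin d × ℕ, Sample d b.1) × (ℕ → Stream d)) : Stream d
  | ([], b) => x.1 b
  | (ℓ :: p, b) => x.2 ℓ (p, b)

theorem measurable_joinStream : Measurable (joinStream (d := d)) := by
  refine measurable_pi_lambda _ ?_
  rintro ⟨_ | ⟨ℓ, p⟩, b⟩
  · exact (measurable_pi_apply b).comp measurable_fst
  · exact (measurable_pi_apply (p, b)).comp ((measurable_pi_apply ℓ).comp measurable_snd)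

/-- The samples at the root and the streams above its children are independent. -/
theorem map_joinStream (φ : Fin d → PMF (Fin d → ℕ)) :
    ((rootLaw φ).prod (Measure.infinitePi fun _ : ℕ => streamLaw φ)).map joinStream =
      streamLaw φ := by
  classical
  -- a cylinder over `S` is the product of a cylinder over the coordinates at the root and of
  -- cylinders over those above the children `ℓ` of the root
  refine Measure.eq_infinitePi _ fun S t ht => ?_
  rw [Measure.map_apply measurable_joinStream
    (MeasurableSet.pi S.countable_toSet fun _ _ => MeasurableSet.of_discrete)]
  let emb0 : Fin d × ℕ ↪ List ℕ × Fin d × ℕ := ⟨fun b => ([], b), fun b b' h => (Prod.mk.inj h).2⟩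
  let emb1 : (Σ _ : ℕ, List ℕ × Fin d × ℕ) ↪ List ℕ × Fin d × ℕ :=
    ⟨fun x => (x.1 :: x.2.1, x.2.2), by
      rintro ⟨ℓ, p, b⟩ ⟨ℓ', p', b'⟩ h
      simp only [Prod.mk.injEq, List.cons.injEq] at h
      obtain ⟨⟨rfl, rfl⟩, rfl⟩ := h
      rfl⟩
  let S0 : Finset (Fin d × ℕ) := S.preimage emb0 emb0.injective.injOn
  let S1 : Finset (Σ _ : ℕ, List ℕ × Fin d × ℕ) := S.preimage emb1 emb1.injective.injOn
  let L : Finset ℕ := S1.image Sigma.fst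
  let Sl : ℕ → Finset (List ℕ × Fin d × ℕ) := fun ℓ =>
    S1.preimage (fun a => (⟨ℓ, a⟩ : Σ _ : ℕ, List ℕ × Fin d × ℕ))
      (fun a _ a' _ h => eq_of_heq (Sigma.mk.inj h).2)
  have hmem0 : ∀ b, b ∈ S0 ↔ ([], b) ∈ S := fun b => Finset.mem_preimage
  have hmeml : ∀ ℓ a, a ∈ Sl ℓ ↔ (ℓ :: a.1, a.2) ∈ S := fun ℓ a =>
    Finset.mem_preimage.trans Finset.mem_preimage
  have hL : ∀ ℓ a, a ∈ Sl ℓ → ℓ ∈ L := fun ℓ a ha =>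
    Finset.mem_image.mpr ⟨⟨ℓ, a⟩, Finset.mem_preimage.mp ha, rfl⟩
  have hS : S = S0.map emb0 ∪ (L.sigma Sl).map emb1 := by
    ext ⟨_ | ⟨ℓ, p⟩, b⟩
    · simp only [Finset.mem_union, Finset.mem_map, hmem0]
      constructor
      · exact fun h => Or.inl ⟨b, h, rfl⟩
      · rintro (⟨b', h, e⟩ | ⟨x, h, e⟩)
        · exact e ▸ h
        · exact absurd (congrArg Prod.fst e) (List.cons_ne_nil _ _)
    · simp only [Finset.mem_union, Finset.mem_map, Finset.mem_sigma, hmeml]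
      constructor
      · exact fun h => Or.inr ⟨⟨ℓ, p, b⟩, ⟨hL ℓ _ ((hmeml ℓ (p, b)).mpr h), h⟩, rfl⟩
      · rintro (⟨b', h, e⟩ | ⟨x, h, e⟩)
        · exact absurd (congrArg Prod.fst e).symm (List.cons_ne_nil _ _)
        · exact e ▸ h.2
  have hdisj : Disjoint (S0.map emb0) ((L.sigma Sl).map emb1) := by
    rw [Finset.disjoint_left]
    intro a h h'
    obtain ⟨b, -, rfl⟩ := Finset.mem_map.mp h
    obtain ⟨x, -, e⟩ := Finset.mem_map.mp h'
    exact List.cons_ne_nil _ _ (congrArg Prod.fst e)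
  have hpre : joinStream ⁻¹' (Set.pi S t) =
      (Set.pi S0 fun b => t ([], b)) ×ˢ
        (Set.pi L fun ℓ => Set.pi (Sl ℓ) fun a : List ℕ × Fin d × ℕ => t (ℓ :: a.1, a.2)) := by
    ext x
    simp only [Set.mem_preimage, Set.mem_pi, Finset.mem_coe, Set.mem_prod]
    constructor
    · intro h
      exact ⟨fun b hb => h _ ((hmem0 b).mp hb), fun ℓ _ a ha => h _ ((hmeml ℓ a).mp ha)⟩
    · rintro ⟨h1, h2⟩ ⟨_ | ⟨ℓ, p⟩, b⟩ ha
      · exact h1 b ((hmem0 b).mpr ha)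
      · have := (hmeml ℓ (p, b)).mpr ha
        exact h2 ℓ (hL _ _ this) (p, b) this
  rw [hpre, Measure.prod_prod, rootLaw,
    Measure.infinitePi_pi _ fun _ _ => MeasurableSet.of_discrete,
    Measure.infinitePi_pi _ fun ℓ _ =>
      MeasurableSet.pi (Sl ℓ).countable_toSet fun _ _ => MeasurableSet.of_discrete]
  simp only [streamLaw]
  have hinner : ∀ ℓ, Measure.infinitePi (fun a : List ℕ × Fin d × ℕ => sampleLaw φ a.2.1)
      (Set.pi (Sl ℓ) fun a : List ℕ × Fin d × ℕ => t (ℓ :: a.1, a.2)) =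
      ∏ a ∈ Sl ℓ, sampleLaw φ a.2.1 (t (ℓ :: a.1, a.2)) := fun ℓ =>
    Measure.infinitePi_pi _ fun _ _ => MeasurableSet.of_discrete
  simp only [hinner]
  conv_rhs => rw [hS, Finset.prod_union hdisj, Finset.prod_map, Finset.prod_map, Finset.prod_sigma]
  rfl

end Streams

/-! ### Decorations realizing a finite tree -/

section Realizes

variable {d : ℕ}

/-- The sample which the rule `σ` puts at the `m`-th place among `X^j_{p,0}, …, X^j_{p,n-1}`. -/
def sorted (σ : SortRule d) (s : Stream d) (p : List ℕ) (j : Fin d) (n : ℕ) (m : Fin n) :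
    Sample d j :=
  s (p, j, σ.perm j n (fun k => s (p, j, k)) m)

/-- Let the subdecoration at the vertex `p` of the Ulam tree be the sample `c` of type `i`, and let
those above it be given by the stream `s`. The decoration above `p` realizes the finite tree `τ` if
the path of `c` is that of the component of the root of `τ`, and if the decorations above the
children of `p` realize the trees attached to the component, where the child with letter `j + m d`
corresponds to the entry number `π^j(m)` of `L_j`. -/
inductive Realizes (σ : SortRule d) (s : Stream d) :
    List ℕ → (i : Fin d) → Sample d i → FTree d → Prop
  | mk (p : List ℕ) (i : Fin d) (c : Sample d i) (τ : FTree d) (hpath : c.path = τ.path i)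
      (hkids : ∀ (j : Fin d) (hj : j ≠ i) (m : Fin (c.path.slots j).length),
        Realizes σ s (p ++ [(j : ℕ) + m * d]) j (sorted σ s p j _ m)
          ((τ.slotTrees i j).getD (c.perm ⟨j, hj⟩ m) default)) : Realizes σ s p i c τ

theorem realizes_iff {σ : SortRule d} {s : Stream d} {p : List ℕ} {i : Fin d} {c : Sample d i}
    {τ : FTree d} : Realizes σ s p i c τ ↔ c.path = τ.path i ∧
      ∀ (j : Fin d) (hj : j ≠ i) (m : Fin (c.path.slots j).length),
        Realizes σ s (p ++ [(j : ℕ) + m * d]) j (sorted σ s p j _ m)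
          ((τ.slotTrees i j).getD (c.perm ⟨j, hj⟩ m) default) := by
  constructor
  · intro h
    cases h with
    | mk _ _ _ _ h1 h2 => exact ⟨h1, h2⟩
  · rintro ⟨h1, h2⟩
    exact ⟨_, _, _, _, h1, h2⟩

theorem Realizes.unique {σ : SortRule d} {s : Stream d} {p : List ℕ} {i : Fin d} {c : Sample d i}
    {τ τ' : FTree d} (h : Realizes σ s p i c τ) (h' : Realizes σ s p i c τ') : τ = τ' := by
  induction h generalizing τ' with
  | mk p i c τ hpath hkids ih =>
    obtain ⟨hpath', hkids'⟩ := realizes_iff.mp h'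
    refine FTree.eq_of_path_eq (hpath.symm.trans hpath') fun j hj => ?_
    have hl : (c.path.slots j).length = (τ.slotTrees i j).length := by
      rw [hpath, FTree.length_slots i τ hj]
    have hl' : (c.path.slots j).length = (τ'.slotTrees i j).length := by
      rw [hpath', FTree.length_slots i τ' hj]
    refine List.ext_getElem (hl.symm.trans hl') fun m h1 h2 => ?_
    have := ih j hj ((c.perm ⟨j, hj⟩).symm ⟨m, hl ▸ h1⟩) (hkids' j hj _)
    rwa [Equiv.apply_symm_apply, List.getD_eq_getElem _ _ h1, List.getD_eq_getElem _ _ h2] at this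

/-- The stream above the child `ℓ` of the root. -/
def shiftStream (ℓ : ℕ) (s : Stream d) : Stream d := fun a => s (ℓ :: a.1, a.2)

theorem shiftStream_joinStream (ℓ : ℕ) (x : (∀ b : Fin d × ℕ, Sample d b.1) × (ℕ → Stream d)) :
    shiftStream ℓ (joinStream x) = x.2 ℓ := rfl

/-- Realizing a tree above `ℓ :: p` depends on the stream above the child `ℓ` of the root only. -/
theorem realizes_cons_iff {σ : SortRule d} {s : Stream d} {ℓ : ℕ} {p : List ℕ} {i : Fin d}
    {c : Sample d i} {τ : FTree d} :
    Realizes σ s (ℓ :: p) i c τ ↔ Realizes σ (shiftStream ℓ s) p i c τ := by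
  constructor
  · intro h
    generalize hq : ℓ :: p = q at h
    induction h generalizing p with
    | mk q i c τ hpath hkids ih =>
      subst hq
      exact ⟨_, _, _, _, hpath, fun j hj m => ih j hj m rfl⟩
  · intro h
    induction h with
    | mk p i c τ hpath hkids ih => exact ⟨_, _, _, _, hpath, ih⟩

theorem getD_mem_slotTrees {i j : Fin d} {τ : FTree d} (hj : j ≠ i)
    (m : Fin ((τ.path i).slots j).length) :
    (τ.slotTrees i j).getD m default ∈ τ.slotTrees i j := by
  have h : (m : ℕ) < (τ.slotTrees i j).length := by
    rw [← FTree.length_slots i τ hj]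
    exact m.2
  rw [List.getD_eq_getElem _ _ h]
  exact List.getElem_mem h

theorem measurable_sorted (σ : SortRule d) (p : List ℕ) (j : Fin d) (n : ℕ) (m : Fin n) :
    Measurable fun s : Stream d => sorted σ s p j n m := by
  have h1 : Measurable fun s : Stream d => fun k : Fin n => (s (p, j, k) : Sample d j) :=
    measurable_pi_lambda _ fun k => measurable_pi_apply (p, j, (k : ℕ))
  have h2 : Measurable fun v : Fin n → Sample d j => v (σ.perm j n v m) := measurable_of_countable _
  exact h2.comp h1

theorem measurableSet_realizes (σ : SortRule d) (p : List ℕ) (i : Fin d) (c : Sample d i)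
    (τ : FTree d) : MeasurableSet {s : Stream d | Realizes σ s p i c τ} := by
  induction hn : τ.depth using Nat.strong_induction_on generalizing p i c τ with
  | _ n ih =>
    subst hn
    by_cases hpath : c.path = τ.path i
    · obtain ⟨w, π⟩ := c
      obtain rfl : w = τ.path i := hpath
      have : {s : Stream d | Realizes σ s p i ⟨τ.path i, π⟩ τ} =
          ⋂ (j : Fin d) (hj : j ≠ i) (m : Fin ((τ.path i).slots j).length) (c' : Sample d j),
            {s : Stream d | sorted σ s p j _ m = c'}ᶜ ∪
            {s : Stream d | Realizes σ s (p ++ [(j : ℕ) + m * d]) j c'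
              ((τ.slotTrees i j).getD (π ⟨j, hj⟩ m) default)} := by
        ext s
        simp only [Set.mem_ofPred_eq, Set.mem_iInter, Set.mem_union, Set.mem_compl_iff]
        rw [realizes_iff]
        constructor
        · rintro ⟨-, h⟩ j hj m c'
          by_cases hc' : sorted σ s p j _ m = c'
          · exact Or.inr (hc' ▸ h j hj m)
          · exact Or.inl hc'
        · intro h
          exact ⟨rfl, fun j hj m => (h j hj m _).resolve_left (not_not_intro rfl)⟩
      rw [this]
      refine MeasurableSet.iInter fun j => MeasurableSet.iInter fun hj =>
        MeasurableSet.iInter fun m => MeasurableSet.iInter fun c' => ?_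
      refine (measurable_sorted σ p j _ m (measurableSet_singleton c')).compl.union ?_
      exact ih _ (FTree.depth_lt_of_mem_slotTrees (getD_mem_slotTrees hj (π ⟨j, hj⟩ m))) _ _ _ _ rfl
    · convert MeasurableSet.empty
      ext s
      simp only [Set.mem_ofPred_eq, Set.mem_empty_iff_false, iff_false]
      exact fun h => hpath (realizes_iff.mp h).1

/-- The probability that the decoration with the given sample at the root realizes `τ`. -/
def realizeProb (φ : Fin d → PMF (Fin d → ℕ)) (σ : SortRule d) (i : Fin d) (τ : FTree d)
    (c : Sample d i) : ℝ≥0∞ :=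
  streamLaw φ {s | Realizes σ s [] i c τ}

/-- The positions of the tuples `L_j`, `j ≠ i`, of a path. -/
abbrev SlotIndex (w : Path d) (i : Fin d) : Type :=
  Σ j : {j // j ≠ i}, Fin (w.slots j).length

/-- The permutation, for each `j`, by which `σ` arranges the samples at a vertex. -/
def arrange (σ : SortRule d) (w : Path d) (i : Fin d) (r : ∀ b : Fin d × ℕ, Sample d b.1) :
    ∀ j : {j // j ≠ i}, Equiv.Perm (Fin (w.slots j).length) :=
  fun j => σ.perm j _ fun k => r (j, k)

/-- Different slots carry different children in the Ulam tree. -/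
theorem letter_injective {w : Path d} {i : Fin d} :
    Function.Injective fun b : SlotIndex w i => ((b.1 : Fin d) : ℕ) + b.2 * d := by
  rintro ⟨⟨j, hj⟩, m⟩ ⟨⟨j', hj'⟩, m'⟩ h
  simp only at h
  have h1 := congrArg (· % d) h
  simp only [Nat.add_mul_mod_self_right, Nat.mod_eq_of_lt j.2, Nat.mod_eq_of_lt j'.2] at h1
  obtain rfl : j = j' := Fin.ext h1
  have h2 : (m : ℕ) = m' := by
    have := Nat.add_left_cancel h
    exact Nat.eq_of_mul_eq_mul_right i.pos this
  obtain rfl : m = m' := Fin.ext h2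
  rfl

theorem measurable_arrange (σ : SortRule d) (w : Path d) (i : Fin d) (b : SlotIndex w i) :
    @Measurable (∀ b : Fin d × ℕ, Sample d b.1) (Sample d b.1) _ _
      fun r => r (b.1, arrange σ w i r b.1 b.2) := by
  have h1 : Measurable fun r : ∀ b : Fin d × ℕ, Sample d b.1 =>
      fun k : Fin (w.slots b.1).length => (r ((b.1 : Fin d), (k : ℕ)) : Sample d b.1) :=
    measurable_pi_lambda _ fun k => measurable_pi_apply ((b.1 : Fin d), (k : ℕ))
  have h2 : Measurable fun v : Fin (w.slots b.1).length → Sample d b.1 =>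
    v (σ.perm b.1 _ v b.2) := measurable_of_countable _
  exact h2.comp h1

/-- Given the samples `r` above the children of the root, the decorations above these children are
independent, since they use the streams above different letters. -/
theorem realizeProb_eq (φ : Fin d → PMF (Fin d → ℕ)) (σ : SortRule d) (i : Fin d) (τ : FTree d)
    (π : ∀ j : {j // j ≠ i}, Equiv.Perm (Fin ((τ.path i).slots j).length)) :
    realizeProb φ σ i τ ⟨τ.path i, π⟩ = ∫⁻ r, ∏ b : SlotIndex (τ.path i) i,
      realizeProb φ σ b.1 ((τ.slotTrees i b.1).getD (π b.1 b.2) default)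
        (r (b.1, arrange σ (τ.path i) i r b.1 b.2)) ∂rootLaw φ := by
  rw [realizeProb, ← map_joinStream,
    Measure.map_apply measurable_joinStream (measurableSet_realizes _ _ _ _ _),
    Measure.prod_apply (measurable_joinStream (measurableSet_realizes _ _ _ _ _))]
  congr 1
  funext r
  set A : SlotIndex (τ.path i) i → Set (Stream d) := fun b =>
    {s | Realizes σ s [] b.1 (r (b.1, arrange σ (τ.path i) i r b.1 b.2))
      ((τ.slotTrees i b.1).getD (π b.1 b.2) default)} with hA
  have hpre : Prod.mk r ⁻¹' (joinStream ⁻¹' {s | Realizes σ s [] i ⟨τ.path i, π⟩ τ}) =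
      ⋂ b ∈ (Finset.univ : Finset (SlotIndex (τ.path i) i)),
        (fun s' : ℕ → Stream d => s' (((b.1 : Fin d) : ℕ) + b.2 * d)) ⁻¹' A b := by
    ext s'
    simp only [Set.mem_preimage, Set.mem_ofPred_eq, Set.mem_iInter, Finset.mem_univ,
      forall_true_left, hA]
    rw [realizes_iff]
    simp only [List.nil_append, realizes_cons_iff, shiftStream_joinStream, true_and]
    constructor
    · rintro h ⟨⟨j, hj⟩, m⟩
      exact h j hj m
    · intro h j hj m
      exact h ⟨⟨j, hj⟩, m⟩
  rw [hpre]
  have hind : iIndepFun (fun (b : SlotIndex (τ.path i) i) (s' : ℕ → Stream d) =>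
      s' (((b.1 : Fin d) : ℕ) + b.2 * d)) (Measure.infinitePi fun _ : ℕ => streamLaw φ) :=
    (iIndepFun_infinitePi (P := fun _ : ℕ => streamLaw φ) (X := fun _ s => s)
      fun _ => measurable_id).precomp letter_injective
  rw [iIndepFun_iff_measure_inter_preimage_eq_mul.mp hind Finset.univ
    fun b _ => measurableSet_realizes _ _ _ _ _]
  refine Finset.prod_congr rfl fun b _ => ?_
  have hev := Measure.map_apply (μ := Measure.infinitePi fun _ : ℕ => streamLaw φ)
    (f := fun s' : ℕ → Stream d => s' (((b.1 : Fin d) : ℕ) + b.2 * d)) (measurable_pi_apply _)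
    (measurableSet_realizes σ [] b.1 (r (b.1, arrange σ (τ.path i) i r b.1 b.2))
      ((τ.slotTrees i b.1).getD (π b.1 b.2) default))
  refine hev.symm.trans ?_
  rw [Measure.infinitePi_map_eval]
  rfl

/-- Averaging over uniform permutations cancels the arrangement: the sample `a j m` is attached at
the slot `π j m`, that is, the sample `k` at the slot `π j ((a j)⁻¹ k)`, and `π * a⁻¹` is uniform
as well. -/
theorem sum_perm_arrange {i : Fin d} {w : Path d}
    (a : ∀ j : {j // j ≠ i}, Equiv.Perm (Fin (w.slots j).length))
    (f : ∀ b : SlotIndex w i, Fin (w.slots b.1).length → ℝ≥0∞) :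
    ∑ π : ∀ j : {j // j ≠ i}, Equiv.Perm (Fin (w.slots j).length),
        ∏ b : SlotIndex w i, f ⟨b.1, a b.1 b.2⟩ (π b.1 b.2) =
      ∑ π : ∀ j : {j // j ≠ i}, Equiv.Perm (Fin (w.slots j).length),
        ∏ b : SlotIndex w i, f b (π b.1 b.2) := by
  rw [← Equiv.sum_comp (Equiv.mulRight a)]
  refine Finset.sum_congr rfl fun π _ => ?_
  exact (Equiv.sigmaCongrRight a).prod_comp fun b => f b (π b.1 b.2)

/-- A random decoration realizes a finite tree with the same probability as a Galton-Watson tree: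
the subtrees attached at the slots of the root component are independent because the uniform
permutations make their arrangement invisible. -/
theorem lintegral_realizeProb (φ : Fin d → PMF (Fin d → ℕ)) (σ : SortRule d) (i : Fin d)
    (τ : FTree d) : ∫⁻ c, realizeProb φ σ i τ c ∂sampleLaw φ i = FTree.weight φ τ i := by
  induction hn : τ.depth using Nat.strong_induction_on generalizing i τ with
  | _ n ih =>
    subst hn
    rw [lintegral_sampleLaw_of_path φ i _ (τ.path i), excursionLaw_path, FTree.weight_eq_comp]
    swap
    -- a sample with another path does not realize `τ`
    · intro c hc
      rw [realizeProb]
      convert measure_empty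
      · ext s
        simp only [Set.mem_ofPred_eq, Set.mem_empty_iff_false, iff_false]
        exact fun h => hc (realizes_iff.mp h).1
      · infer_instance
    congr 1
    set Q := ∏ j : {j // j ≠ i}, ((τ.slotTrees i j).map fun κ => FTree.weight φ κ j).prod with hQ
    have hmeas : ∀ (π : ∀ j : {j // j ≠ i}, Equiv.Perm (Fin ((τ.path i).slots j).length))
        (b : SlotIndex (τ.path i) i), Measurable fun r : ∀ b : Fin d × ℕ, Sample d b.1 =>
          realizeProb φ σ b.1 ((τ.slotTrees i b.1).getD (π b.1 b.2) default) (r (b.1, b.2)) :=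
      fun π b => (measurable_from_top (f := realizeProb φ σ b.1
        ((τ.slotTrees i b.1).getD (π b.1 b.2) default))).comp
        (measurable_pi_apply ((b.1 : Fin d), (b.2 : ℕ)))
    -- without the arrangement, the samples at the slots are independent
    have hind : ∀ π : ∀ j : {j // j ≠ i}, Equiv.Perm (Fin ((τ.path i).slots j).length),
        ∫⁻ r, ∏ b : SlotIndex (τ.path i) i,
          realizeProb φ σ b.1 ((τ.slotTrees i b.1).getD (π b.1 b.2) default)
            (r (b.1, b.2)) ∂rootLaw φ = Q := by
      intro π
      have hinj : Function.Injective fun b : SlotIndex (τ.path i) i =>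
          (((b.1 : Fin d), (b.2 : ℕ)) : Fin d × ℕ) := by
        rintro ⟨⟨j, hj⟩, m⟩ ⟨⟨j', hj'⟩, m'⟩ h
        simp only [Prod.mk.injEq] at h
        obtain ⟨rfl, h⟩ := h
        obtain rfl : m = m' := Fin.ext h
        rfl
      have h1 : iIndepFun (fun (b : SlotIndex (τ.path i) i) (r : ∀ b : Fin d × ℕ, Sample d b.1) =>
          r (b.1, b.2)) (rootLaw φ) :=
        (iIndepFun_infinitePi (P := fun b : Fin d × ℕ => sampleLaw φ b.1)
          (X := fun _ c => c) fun _ => measurable_id).precomp hinj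
      have h2 := h1.comp (fun b => realizeProb φ σ b.1
        ((τ.slotTrees i b.1).getD (π b.1 b.2) default)) fun b => measurable_from_top
      refine (lintegral_prod_eq_prod_lintegral_of_indepFun Finset.univ _ h2
        (hmeas π)).trans ?_
      have h3 : ∀ b : SlotIndex (τ.path i) i, ∫⁻ r, realizeProb φ σ b.1
          ((τ.slotTrees i b.1).getD (π b.1 b.2) default) (r (b.1, b.2)) ∂rootLaw φ =
          FTree.weight φ ((τ.slotTrees i b.1).getD (π b.1 b.2) default) b.1 := by
        intro b
        rw [← ih _ (FTree.depth_lt_of_mem_slotTrees (getD_mem_slotTrees b.1.2 _)) b.1 _ rfl,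
          ← Measure.infinitePi_map_eval (fun b : Fin d × ℕ => sampleLaw φ b.1)
            ((b.1 : Fin d), (b.2 : ℕ)), lintegral_map measurable_from_top (measurable_pi_apply _)]
        rfl
      simp only [Function.comp_apply, h3]
      rw [Fintype.prod_sigma, hQ]
      refine Finset.prod_congr rfl fun j _ => ?_
      rw [Equiv.prod_comp (π j) fun m => FTree.weight φ ((τ.slotTrees i j).getD m default) j]
      conv_rhs => rw [← List.ofFn_getElem (xs := τ.slotTrees i j), List.map_ofFn, List.prod_ofFn]
      refine Fintype.prod_equiv (finCongr (FTree.length_slots i τ j.2)) _ _ fun m => ?_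
      have h : (m : ℕ) < (τ.slotTrees i j).length := by
        rw [← FTree.length_slots i τ j.2]
        exact m.2
      rw [List.getD_eq_getElem _ _ h]
      rfl
    rw [← Finset.mul_sum]
    simp only [realizeProb_eq]
    rw [← lintegral_finsetSum _ fun π _ => Finset.measurable_prod _ fun b _ =>
      (measurable_from_top (f := realizeProb φ σ b.1
        ((τ.slotTrees i b.1).getD (π b.1 b.2) default))).comp (measurable_arrange σ (τ.path i) i b)]
    -- for given samples `r` the arrangement is a fixed permutation
    have h4 : ∀ r : ∀ b : Fin d × ℕ, Sample d b.1, _ = _ := fun r =>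
      sum_perm_arrange (w := τ.path i) (i := i) (arrange σ (τ.path i) i r) fun b k =>
        realizeProb φ σ b.1 ((τ.slotTrees i b.1).getD k default) (r (b.1, b.2))
    simp only [h4]
    rw [lintegral_finsetSum _ fun π _ => Finset.measurable_prod _ fun b _ => hmeas π b]
    simp only [hind, Finset.sum_const, Finset.card_univ, nsmul_eq_mul]
    rw [← mul_assoc, ENNReal.inv_mul_cancel, one_mul]
    · exact_mod_cast Fintype.card_ne_zero
    · exact ENNReal.natCast_ne_top _

end Realizes

/-! ### Gluing metric trees -/

section Gluing

variable {d : ℕ}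

namespace Decoration

variable (D : Decoration d)

@[simp]
theorem embed_self (p : List ℕ) (z : (D p).carrier) : D.embed p z p = z :=
  Function.update_self _ _ _

theorem embed_congr {p q : List ℕ} (z z' : (D p).carrier) (h : q ≠ p) :
    D.embed p z q = D.embed p z' q := by
  rw [embed, embed, Function.update_of_ne h, Function.update_of_ne h]

theorem prefix_of_embed_ne_root {p q : List ℕ} {z : (D p).carrier}
    (h : D.embed p z q ≠ (D q).root) : q <+: p := by
  by_contra hcon
  exact h (D.embed_of_not_prefix z hcon)

/-- A marked point is identified with the root of the subdecoration that it carries. -/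
theorem incl_append_root (p : List ℕ) (ℓ : ℕ) :
    D.incl (p ++ [ℓ]) (D (p ++ [ℓ])).root = D.incl p ((D p).mark ℓ) := by
  refine Subtype.ext (funext fun q => ?_)
  change D.embed _ _ q = D.embed _ _ q
  by_cases h1 : q = p ++ [ℓ]
  · subst h1
    rw [embed_self, embed_of_not_prefix]
    intro h
    have := h.length_le
    simp at this
  · rw [embed, Function.update_of_ne h1]
    by_cases h2 : q = p
    · subst h2
      rw [embed_self, if_pos (List.prefix_append _ _)]
      simp
    · rw [embed, Function.update_of_ne h2]
      by_cases h3 : q <+: p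
      · have hlt : q.length < p.length := lt_of_le_of_ne h3.length_le
          fun h => h2 (h3.eq_of_length h)
        rw [if_pos h3, if_pos (h3.trans (List.prefix_append _ _)), List.getD_append _ _ _ _ hlt]
      · rw [if_neg h3, if_neg]
        intro h
        rcases List.prefix_concat_iff.mp h with h | h
        · exact h1 h
        · exact h3 h

/-- The root of the glued space. -/
def starRoot : D.GluedStar := D.incl [] (D []).root

theorem incl_inj {p p' : List ℕ} {z : (D p).carrier} {z' : (D p').carrier} (hz : z ≠ (D p).root)
    (hz' : z' ≠ (D p').root) (h : D.incl p z = D.incl p' z') : p = p' := by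
  have h' : D.embed p z = D.embed p' z' := congrArg Subtype.val h
  have h1 : p <+: p' := D.prefix_of_embed_ne_root (z := z') (by rw [← h', embed_self]; exact hz)
  have h2 : p' <+: p := D.prefix_of_embed_ne_root (z := z) (by rw [h', embed_self]; exact hz')
  exact h1.eq_of_length (le_antisymm h1.length_le h2.length_le)

theorem incl_injective (p : List ℕ) : Function.Injective (D.incl p) := by
  intro z z' h
  have := congrFun (congrArg Subtype.val h) p
  simpa [incl] using this

theorem incl_ne_starRoot {p : List ℕ} {z : (D p).carrier} (hz : z ≠ (D p).root) :
    D.incl p z ≠ D.starRoot := by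
  intro h
  have h' : D.embed p z = D.embed [] (D []).root := congrArg Subtype.val h
  have hp := congrFun h' p
  rw [embed_self] at hp
  by_cases h0 : p = []
  · subst h0
    rw [embed_self] at hp
    exact hz hp
  · rw [embed_of_not_prefix _ _ (by simpa using h0)] at hp
    exact hz hp

theorem exists_incl (y : D.GluedStar) : ∃ p z, y = D.incl p z := by
  obtain ⟨y, p, z, rfl⟩ := y
  exact ⟨p, z, rfl⟩

/-- Each point other than the root is, in a unique way, a point other than the root of some
subdecoration. -/
theorem exists_eq_incl (y : D.GluedStar) (hy : y ≠ D.starRoot) :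
    ∃ p z, z ≠ (D p).root ∧ y = D.incl p z := by
  have key : ∀ (p : List ℕ) (z : (D p).carrier), D.incl p z ≠ D.starRoot →
      ∃ p' z', z' ≠ (D p').root ∧ D.incl p z = D.incl p' z' := by
    intro p
    induction p using List.reverseRecOn with
    | nil =>
      intro z hz
      exact ⟨[], z, fun h => hz (by rw [h]; rfl), rfl⟩
    | append_singleton p ℓ ih =>
      intro z hz
      by_cases h : z = (D (p ++ [ℓ])).root
      · subst h
        rw [incl_append_root] at hz ⊢
        exact ih _ hz
      · exact ⟨_, z, h, rfl⟩
  obtain ⟨p, z, rfl⟩ := D.exists_incl y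
  exact key p z hy

open Classical in
/-- The parent of a point of the glued space, in terms of the parents in the subdecorations. -/
def starPar (par : ∀ p, (D p).carrier → (D p).carrier) (y : D.GluedStar) : D.GluedStar :=
  if h : ∃ p z, z ≠ (D p).root ∧ y = D.incl p z then
    D.incl h.choose (par _ h.choose_spec.choose) else y

variable (par : ∀ p, (D p).carrier → (D p).carrier)

theorem starPar_incl {p : List ℕ} {z : (D p).carrier} (hz : z ≠ (D p).root) :
    D.starPar par (D.incl p z) = D.incl p (par p z) := by
  have h : ∃ p' z', z' ≠ (D p').root ∧ D.incl p z = D.incl p' z' := ⟨p, z, hz, rfl⟩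
  rw [starPar, dif_pos h]
  have key : ∀ p' (z' : (D p').carrier), z' ≠ (D p').root → D.incl p z = D.incl p' z' →
      D.incl p' (par p' z') = D.incl p (par p z) := by
    intro p' z' hz' he
    obtain rfl := D.incl_inj hz hz' he
    rw [D.incl_injective p he]
  exact key _ _ h.choose_spec.choose_spec.1 h.choose_spec.choose_spec.2

theorem starPar_starRoot : D.starPar par D.starRoot = D.starRoot := by
  rw [starPar, dif_neg]
  rintro ⟨p, z, hz, h⟩
  exact D.incl_ne_starRoot hz h.symm

theorem starPar_iterate {p : List ℕ} (h0 : par p (D p).root = (D p).root) {n : ℕ}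
    {z z' : (D p).carrier} (hn : (par p)^[n] z = z') (hz' : z' ≠ (D p).root) :
    (D.starPar par)^[n] (D.incl p z) = D.incl p z' := by
  induction n generalizing z with
  | zero => exact congrArg (D.incl p) hn
  | succ n ih =>
    have hz : z ≠ (D p).root := by
      rintro rfl
      rw [Function.iterate_fixed h0] at hn
      exact hz' hn.symm
    rw [Function.iterate_succ_apply, starPar_incl _ _ hz]
    exact ih hn

theorem exists_starPar_iterate_root {p : List ℕ} (z : (D p).carrier)
    (h : ∃ n, (par p)^[n] z = (D p).root) :
    ∃ m, (D.starPar par)^[m] (D.incl p z) = D.incl p (D p).root := by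
  obtain ⟨n, hn⟩ := h
  induction n generalizing z with
  | zero => exact ⟨0, congrArg (D.incl p) hn⟩
  | succ n ih =>
    by_cases hz : z = (D p).root
    · exact ⟨0, by rw [hz]; rfl⟩
    · obtain ⟨m, hm⟩ := ih (par p z) hn
      exact ⟨m + 1, by rw [Function.iterate_succ_apply, starPar_incl _ _ hz, hm]⟩

/-- A point is below its coordinates along the Ulam tree. -/
theorem exists_starPar_iterate_embed (hreach : ∀ p z, ∃ n, (par p)^[n] z = (D p).root)
    {p p' : List ℕ} (hp : p <+: p') (z' : (D p').carrier) :
    ∃ m, (D.starPar par)^[m] (D.incl p' z') = D.incl p (D.embed p' z' p) := by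
  induction p' using List.reverseRecOn with
  | nil =>
    obtain rfl : p = [] := List.prefix_nil.mp hp
    exact ⟨0, by rw [embed_self]; rfl⟩
  | append_singleton q ℓ ih =>
    by_cases h : p = q ++ [ℓ]
    · subst h
      exact ⟨0, by rw [embed_self]; rfl⟩
    · have hpq : p <+: q := (List.prefix_concat_iff.mp hp).resolve_left h
      obtain ⟨m, hm⟩ := D.exists_starPar_iterate_root par z' (hreach _ z')
      obtain ⟨m', hm'⟩ := ih hpq ((D q).mark ℓ)
      refine ⟨m' + m, ?_⟩
      rw [Function.iterate_add_apply, hm, incl_append_root, hm']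
      have h1 : D.embed q ((D q).mark ℓ) = D.embed (q ++ [ℓ]) (D (q ++ [ℓ])).root :=
        congrArg Subtype.val (D.incl_append_root q ℓ).symm
      rw [h1, D.embed_congr (D (q ++ [ℓ])).root z' h]

theorem dist_def (y y' : D.GluedStar) : dist y y' = ∑' q, dist (y.1 q) (y'.1 q) := rfl

/-- A decoration by metric trees glues to a metric tree: moving to the parent of a point of
`D p` changes only the coordinate `p`. -/
theorem isTreeMetric_star (h : ∀ p, IsTreeMetric (D p).root (par p)) :
    IsTreeMetric D.starRoot (D.starPar par) := by
  refine ⟨D.starPar_starRoot par, ?_, ?_⟩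
  · have key : ∀ (p : List ℕ) (z : (D p).carrier),
        ∃ n, (D.starPar par)^[n] (D.incl p z) = D.starRoot := by
      intro p z
      obtain ⟨m, hm⟩ := D.exists_starPar_iterate_embed par (fun p => (h p).reach)
        (List.nil_prefix (l := p)) z
      obtain ⟨n, hn⟩ := D.exists_starPar_iterate_root par (D.embed p z []) ((h []).reach _)
      exact ⟨n + m, by rw [Function.iterate_add_apply, hm, hn]; rfl⟩
    intro y
    obtain ⟨p, z, rfl⟩ := D.exists_incl y
    exact key p z
  · intro x y hx hy
    obtain ⟨p, z, hz, rfl⟩ := D.exists_eq_incl x hx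
    rw [starPar_incl _ _ hz, dist_def, dist_def, (D.summable_dist _ _).tsum_eq_add_tsum_ite p,
      (D.summable_dist (D.incl p (par p z)) y).tsum_eq_add_tsum_ite p, ← add_assoc]
    have h1 : dist ((D.incl p z).1 p) (y.1 p) = 1 + dist ((D.incl p (par p z)).1 p) (y.1 p) := by
      change dist (D.embed p z p) _ = 1 + dist (D.embed p (par p z) p) _
      rw [embed_self, embed_self]
      refine (h p).dist_eq z _ hz fun n hn => ?_
      -- if the coordinate of `y` at `p` is below `z`, then `y` is below the point `z` of `D p`
      obtain ⟨p', z', rfl⟩ := D.exists_incl y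
      have hne : D.embed p' z' p ≠ (D p).root := by
        intro h0
        change (par p)^[n] (D.embed p' z' p) = z at hn
        rw [h0, Function.iterate_fixed (h p).par_root] at hn
        exact hz hn.symm
      obtain ⟨m, hm⟩ := D.exists_starPar_iterate_embed par (fun p => (h p).reach)
        (D.prefix_of_embed_ne_root hne) z'
      refine hy (n + m) ?_
      rw [Function.iterate_add_apply, hm]
      exact D.starPar_iterate par (h p).par_root hn hz
    rw [h1]
    congr 1
    refine tsum_congr fun q => ?_
    by_cases hq : q = p
    · simp [hq]
    · rw [if_neg hq, if_neg hq]
      change dist (D.embed p z q) _ = dist (D.embed p (par p z) q) _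
      rw [D.embed_congr _ (par p z) hq]

theorem isometry_incl (p : List ℕ) : Isometry (D.incl p) := by
  refine Isometry.of_dist_eq fun z z' => ?_
  rw [dist_def, tsum_eq_single p]
  · change dist (D.embed p z p) (D.embed p z' p) = _
    rw [embed_self, embed_self]
  · intro q hq
    change dist (D.embed p z q) (D.embed p z' q) = 0
    rw [D.embed_congr z z' hq, dist_self]

/-- The glued space before completion, with its root and its measures. -/
def star : PMMSpace d where
  carrier := D.GluedStar
  metric := inferInstance
  root := D.starRoot
  mass j := @Measure.sum _ _ (borel D.GluedStar) fun p : List ℕ =>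
    @Measure.map _ _ (borel (D p).carrier) (borel D.GluedStar) (D.incl p) ((D p).mass j)

/-- A finite glued space is its own completion. -/
theorem star_iso_glued [Finite D.GluedStar] : D.star.Iso D.glued := by
  have hiso : Isometry ((↑) : D.GluedStar → UniformSpace.Completion D.GluedStar) :=
    UniformSpace.Completion.coe_isometry
  have hsurj : Function.Surjective
      ((↑) : D.GluedStar → UniformSpace.Completion D.GluedStar) := by
    have h1 : DenseRange ((↑) : D.GluedStar → UniformSpace.Completion D.GluedStar) :=
      UniformSpace.Completion.denseRange_coe
    have h2 := h1.closure_range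
    rw [(Set.finite_range _).isClosed.closure_eq] at h2
    exact Set.range_eq_univ.mp h2
  let e : D.GluedStar ≃ UniformSpace.Completion D.GluedStar :=
    Equiv.ofBijective _ ⟨hiso.injective, hsurj⟩
  refine ⟨⟨e, hiso⟩, rfl, fun j => ?_⟩
  let _ : MeasurableSpace D.GluedStar := borel _
  let _ : MeasurableSpace (UniformSpace.Completion D.GluedStar) := borel _
  let _ : ∀ p, MeasurableSpace (D p).carrier := fun p => borel _
  have hm : Measurable ((↑) : D.GluedStar → UniformSpace.Completion D.GluedStar) :=
    borel_measurable hiso.continuous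
  change Measure.map ((↑) : D.GluedStar → UniformSpace.Completion D.GluedStar)
      (Measure.sum fun p : List ℕ => Measure.map (D.incl p) ((D p).mass j)) =
    Measure.sum fun p : List ℕ => Measure.map
      (fun z => (D.incl p z : UniformSpace.Completion D.GluedStar)) ((D p).mass j)
  rw [Measure.map_sum hm.aemeasurable]
  congr 1
  funext p
  exact Measure.map_map hm (borel_measurable (D.isometry_incl p).continuous)

end Decoration

theorem PMMSpace.Iso.isCompactFinite {X Y : PMMSpace d} (h : X.Iso Y) (hX : X.IsCompactFinite) :
    Y.IsCompactFinite := by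
  obtain ⟨f, -, hf⟩ := h
  have := hX.1
  refine ⟨f.toHomeomorph.compactSpace, fun j => ?_⟩
  let _ : MeasurableSpace X.carrier := borel _
  let _ : MeasurableSpace Y.carrier := borel _
  rw [← hf j]
  change Measure.map f _ _ < ⊤
  rw [Measure.map_apply (borel_measurable f.continuous) MeasurableSet.univ]
  exact hX.2 j

end Gluing

/-! ### The glued decoration as a planted tree -/

section GluedDecoration

variable {d : ℕ}

open Classical in
/-- A coding from an enumeration, for each point and each type, of the children of that type. -/
def Coding.ofChildren {X : PMMSpace d} {i : Fin d} {τ : FTree d} (par : X.carrier → X.carrier)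
    (ty : X.carrier → Fin d) (sub : X.carrier → FTree d) (tree : IsTreeMetric X.root par)
    (mass : ∀ j, X.mass j = @Measure.sum _ _ (borel X.carrier)
      fun v : {x // x ≠ X.root ∧ ty x = j} => @Measure.dirac _ (borel X.carrier) v.1)
    (t : X.carrier) (ht : t ≠ X.root) (htp : par t = X.root) (hts : sub t = τ) (hti : ty t = i)
    (htu : ∀ x, x ≠ X.root → par x = X.root → x = t)
    (hkids : ∀ x, x ≠ X.root → ∀ j, ∃ e : ℕ → X.carrier,
      (∀ k < (sub x).off j, e k ≠ X.root ∧ par (e k) = x ∧ ty (e k) = j ∧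
        ((sub x).kids j)[k]? = some (sub (e k))) ∧
      (∀ k < (sub x).off j, ∀ k' < (sub x).off j, e k = e k' → k = k') ∧
      ∀ y, y ≠ X.root → par y = x → ty y = j → ∃ k < (sub x).off j, y = e k) :
    Coding X i τ :=
  let e := fun x (hx : x ≠ X.root) j => (hkids x hx j).choose
  have he := fun x (hx : x ≠ X.root) j => (hkids x hx j).choose_spec
  let idx : X.carrier → ℕ := fun y =>
    if h : ∃ (hp : par y ≠ X.root) (k : ℕ), k < (sub (par y)).off (ty y) ∧ y = e (par y) hp (ty y) k
    then h.choose_spec.choose else 0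
  have hidx : ∀ y, y ≠ X.root → ∀ hp : par y ≠ X.root, idx y < (sub (par y)).off (ty y) ∧
      y = e (par y) hp (ty y) (idx y) := by
    intro y hy hp
    have h : ∃ (hp : par y ≠ X.root) (k : ℕ), k < (sub (par y)).off (ty y) ∧
        y = e (par y) hp (ty y) k := by
      obtain ⟨k, hk, hyk⟩ := (he (par y) hp (ty y)).2.2 y hy rfl rfl
      exact ⟨hp, k, hk, hyk⟩
    simp only [idx, dif_pos h]
    exact h.choose_spec.choose_spec
  { par := par
    ty := ty
    idx := idx
    sub := sub
    tree := tree
    mass := mass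
    top_exists := ⟨t, ht, htp⟩
    top := fun x hx hp => by
      obtain rfl := htu x hx hp
      exact ⟨hts, hti⟩
    top_unique := fun x y hx hxp hy hyp => (htu x hx hxp).trans (htu y hy hyp).symm
    kid := fun y hy hp => by
      obtain ⟨h1, h2⟩ := hidx y hy hp
      have h3 := ((he (par y) hp (ty y)).1 (idx y) h1).2.2.2
      change _ = some (sub (e (par y) hp (ty y) (idx y))) at h3
      rwa [← h2] at h3
    kid_inj := fun x y hx hy hp hpar hty hid => by
      obtain ⟨h1, h2⟩ := hidx x hx hp
      obtain ⟨h3, h4⟩ := hidx y hy (hpar ▸ hp)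
      rw [h2, h4]
      simp only [hpar, hty, hid]
    kid_exists := fun x hx j k hk => by
      obtain ⟨h1, h2, h3, h4⟩ := (he x hx j).1 k hk
      refine ⟨e x hx j k, h1, h2, h3, ?_⟩
      have key : ∀ y (hy : y ≠ X.root), par y = x → ty y = j → y = e x hx j k → idx y = k := by
        rintro y hy rfl rfl hyk
        obtain ⟨h5, h6⟩ := hidx y hy hx
        exact (he (par y) hx (ty y)).2.1 _ h5 k hk (h6.symm.trans hyk)
      exact key _ h1 h2 h3 rfl }

/-- The space of a sample, trivial if there is none. -/
def nodeSpace : Option (Σ i, Sample d i) → MarkedSpace d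
  | none => trivialSpace d
  | some ⟨_, c⟩ => c.space

/-- The number of points other than the root. -/
def nodeSize : Option (Σ i, Sample d i) → ℕ
  | none => 0
  | some ⟨_, c⟩ => c.path.len

/-- The point `v_m`; the root if `m` is too large. -/
def nodeVertex : ∀ o : Option (Σ i, Sample d i), ℕ → (nodeSpace o).carrier
  | none, _ => ()
  | some ⟨_, c⟩, m =>
    if h : m < c.path.len + 1 then (⟨m, h⟩ : c.path.Vertex) else (0 : c.path.Vertex)

/-- The number `m` of the point `v_m`. -/
def nodeNum : ∀ o : Option (Σ i, Sample d i), (nodeSpace o).carrier → ℕ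
  | none, _ => 0
  | some ⟨_, c⟩, v => Fin.val (n := c.path.len + 1) v

theorem Path.parent_le (w : Path d) (i : Fin d) (m : ℕ) : w.parent i m ≤ m - 1 :=
  Nat.findGreatest_le _

/-- The parents in the tree of a sample; the planted root is its own parent. -/
def nodePar : ∀ o : Option (Σ i, Sample d i), (nodeSpace o).carrier → (nodeSpace o).carrier
  | none, _ => ()
  | some ⟨i, c⟩, v => nodeVertex (some ⟨i, c⟩) (c.path.parent i (Fin.val (n := c.path.len + 1) v))

/-- The type of a sample. -/
def nodeType (o : Option (Σ i, Sample d i)) : Option (Fin d) := o.map Sigma.fst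

theorem nodeNum_le (o : Option (Σ i, Sample d i)) (v : (nodeSpace o).carrier) :
    nodeNum o v ≤ nodeSize o := by
  rcases o with _ | ⟨i, c⟩
  · exact le_rfl
  · exact Nat.lt_succ_iff.mp (Fin.is_lt (n := c.path.len + 1) v)

theorem nodeNum_nodeVertex (o : Option (Σ i, Sample d i)) {m : ℕ} (hm : m ≤ nodeSize o) :
    nodeNum o (nodeVertex o m) = m := by
  rcases o with _ | ⟨i, c⟩
  · exact (Nat.le_zero.mp hm).symm
  · have hm' : m < c.path.len + 1 := Nat.lt_succ_iff.mpr hm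
    exact congrArg (Fin.val (n := c.path.len + 1))
      (dif_pos (e := fun _ => (0 : c.path.Vertex)) (t := fun h => (⟨m, h⟩ : c.path.Vertex)) hm')

theorem nodeVertex_nodeNum (o : Option (Σ i, Sample d i)) (v : (nodeSpace o).carrier) :
    nodeVertex o (nodeNum o v) = v := by
  rcases o with _ | ⟨i, c⟩
  · rfl
  · exact dif_pos (e := fun _ => (0 : c.path.Vertex))
      (t := fun h => (⟨Fin.val (n := c.path.len + 1) v, h⟩ : c.path.Vertex))
      (Fin.is_lt (n := c.path.len + 1) v)

theorem nodeVertex_zero (o : Option (Σ i, Sample d i)) : nodeVertex o 0 = (nodeSpace o).root := by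
  rcases o with _ | ⟨i, c⟩
  · rfl
  · exact dif_pos (e := fun _ => (0 : c.path.Vertex)) (t := fun h => (⟨0, h⟩ : c.path.Vertex))
      (Nat.succ_pos _)

theorem nodeVertex_ne_root (o : Option (Σ i, Sample d i)) {m : ℕ} (h1 : 1 ≤ m)
    (hm : m ≤ nodeSize o) : nodeVertex o m ≠ (nodeSpace o).root := by
  intro h
  rw [← nodeVertex_zero] at h
  have := congrArg (nodeNum o) h
  rw [nodeNum_nodeVertex o hm, nodeNum_nodeVertex o (Nat.zero_le _)] at this
  omega

theorem nodePar_nodeVertex {i : Fin d} {c : Sample d i} {m : ℕ} (hm : m ≤ c.path.len) :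
    nodePar (some ⟨i, c⟩) (nodeVertex (some ⟨i, c⟩) m) =
      nodeVertex (some ⟨i, c⟩) (c.path.parent i m) := by
  have h := nodeNum_nodeVertex (some ⟨i, c⟩) hm
  rw [nodePar]
  exact congrArg (fun n => nodeVertex (some ⟨i, c⟩) (c.path.parent i n)) h

theorem isTreeMetric_nodeSpace (o : Option (Σ i, Sample d i)) :
    IsTreeMetric (nodeSpace o).root (nodePar o) := by
  rcases o with _ | ⟨i, c⟩
  · exact ⟨rfl, fun _ => ⟨0, rfl⟩, fun x _ hx => absurd rfl hx⟩
  · let par : c.path.Vertex → c.path.Vertex := nodePar (some ⟨i, c⟩)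
    have hval : ∀ v : c.path.Vertex, (par v : ℕ) = c.path.parent i v := by
      intro v
      refine nodeNum_nodeVertex (some ⟨i, c⟩) ?_
      have h1 := c.path.parent_le i v
      have h2 := v.2
      change _ ≤ c.path.len
      omega
    have h0 : par 0 = 0 :=
      Fin.ext ((hval 0).trans (by
        rw [Fin.val_zero]
        exact Nat.le_zero.mp (c.path.parent_le i 0)))
    refine isTreeMetric_graphMetric (r := (0 : c.path.Vertex)) (par := par)
      (c.path.graph_connected i) h0 ?_ ?_ ?_
    · have key : ∀ n (v : c.path.Vertex), (v : ℕ) ≤ n →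
          ∃ n, par^[n] v = 0 := by
        intro n
        induction n with
        | zero => exact fun v hv => ⟨0, Fin.ext (Nat.le_zero.mp hv)⟩
        | succ n ih =>
          intro v hv
          obtain ⟨m, hm⟩ := ih (par v) (by
            have := hval v
            have := c.path.parent_le i v
            omega)
          exact ⟨m + 1, hm⟩
      exact fun v => key _ v le_rfl
    · intro v hv
      rw [Path.graph, SimpleGraph.fromRel_adj]
      have h1 : (v : ℕ) ≠ 0 := fun h => hv (Fin.ext h)
      refine ⟨fun h => ?_, Or.inr ⟨hv, hval v⟩⟩
      have h2 : (v : ℕ) = c.path.parent i v := (congrArg Fin.val h).trans (hval v)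
      have h3 := c.path.parent_le i v
      omega
    · intro v v' h
      rw [Path.graph, SimpleGraph.fromRel_adj] at h
      rcases h.2 with h | h
      · exact Or.inr (Fin.ext ((hval v').trans h.2.symm))
      · exact Or.inl (Fin.ext ((hval v).trans h.2.symm))

theorem mass_nodeSpace (o : Option (Σ i, Sample d i)) (j : Fin d) :
    (nodeSpace o).mass j = @Measure.sum _ _ (borel (nodeSpace o).carrier)
      fun v : {v : (nodeSpace o).carrier // v ≠ (nodeSpace o).root ∧ nodeType o = some j} =>
        @Measure.dirac _ (borel (nodeSpace o).carrier) v.1 := by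
  rcases o with _ | ⟨i, c⟩
  · have : IsEmpty {v : (nodeSpace (none : Option (Σ i, Sample d i))).carrier //
        v ≠ (nodeSpace none).root ∧ nodeType (none : Option (Σ i, Sample d i)) = some j} :=
      ⟨fun v => absurd v.2.2 (by simp [nodeType])⟩
    rw [Measure.sum_of_isEmpty]
    rfl
  · have hset : ({v | v ≠ 0 ∧ j = i} : Set c.path.Vertex) =
        {v | v ≠ 0 ∧ nodeType (some ⟨i, c⟩) = some j} := by
      ext v
      simp [nodeType, eq_comm]
    exact congrArg (fun S : Set c.path.Vertex =>
      @Measure.sum _ _ (borel (nodeSpace (some ⟨i, c⟩)).carrier) fun v : S =>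
        @Measure.dirac _ (borel (nodeSpace (some ⟨i, c⟩)).carrier) v.1) hset

theorem letterType_add_mul {i j : Fin d} (t : ℕ) : letterType i ((j : ℕ) + t * d) = j := by
  refine Fin.ext ?_
  simp [letterType, Nat.mod_eq_of_lt j.2]

theorem add_mul_div_letter (j : Fin d) (t : ℕ) : ((j : ℕ) + t * d) / d = t := by
  rw [Nat.add_mul_div_right _ _ j.pos, Nat.div_eq_of_lt j.2, zero_add]

theorem mark_letter {i : Fin d} (c : Sample d i) {j : Fin d} (hj : j ≠ i)
    (t : Fin (c.path.slots j).length) : (nodeSpace (some ⟨i, c⟩)).mark ((j : ℕ) + t * d) =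
      (c.path.slots j).get (c.perm ⟨j, hj⟩ t) := by
  have key : ∀ (ℓ : ℕ) (j' : Fin d), letterType i ℓ = j' → ∀ (hj : j' ≠ i)
      (t : Fin (c.path.slots j').length), ℓ / d = t →
      (nodeSpace (some ⟨i, c⟩)).mark ℓ = (c.path.slots j').get (c.perm ⟨j', hj⟩ t) := by
    rintro ℓ j' rfl hj ⟨t, ht⟩ rfl
    exact dif_pos ⟨hj, ht⟩
  exact key _ j (letterType_add_mul _) hj t (add_mul_div_letter j t)

theorem childSample_letter (σ : SortRule d) (s : Stream d) (p : List ℕ) {i : Fin d}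
    (c : Sample d i) {j : Fin d} (hj : j ≠ i) (t : Fin (c.path.slots j).length) :
    childSample σ s p (some ⟨i, c⟩) ((j : ℕ) + t * d) = some ⟨j, sorted σ s p j _ t⟩ := by
  have key : ∀ (ℓ : ℕ) (j' : Fin d), letterType i ℓ = j' → ∀ (hj : j' ≠ i)
      (t : Fin (c.path.slots j').length), ℓ / d = t →
      childSample σ s p (some ⟨i, c⟩) ℓ = some ⟨j', sorted σ s p j' _ t⟩ := by
    rintro ℓ j' rfl hj ⟨t, ht⟩ rfl
    exact dif_pos ⟨hj, ht⟩
  exact key _ j (letterType_add_mul _) hj t (add_mul_div_letter j t)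

theorem exists_letter_of_childSample {σ : SortRule d} {s : Stream d} {p : List ℕ} {i : Fin d}
    {c : Sample d i} {ℓ : ℕ} {x : Σ i, Sample d i}
    (h : childSample σ s p (some ⟨i, c⟩) ℓ = some x) :
    ∃ j, j ≠ i ∧ ∃ t : Fin (c.path.slots j).length, ℓ = (j : ℕ) + t * d := by
  rw [childSample] at h
  split_ifs at h with h'
  refine ⟨letterType i ℓ, h'.1, ⟨ℓ / d, h'.2⟩, ?_⟩
  simp only [letterType]
  rw [mul_comm]
  exact (Nat.mod_add_div ℓ d).symm

theorem descend_append (σ : SortRule d) (s : Stream d) (p q : List ℕ)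
    (x : Option (Σ i, Sample d i)) (ℓ : ℕ) :
    descend σ s p x (q ++ [ℓ]) = childSample σ s (p ++ q) (descend σ s p x q) ℓ := by
  induction q generalizing p x with
  | nil => simp [descend]
  | cons a q ih =>
    rw [List.cons_append, descend, ih, descend, List.append_assoc]
    rfl

/-- The sample at the vertex `p` of the Ulam tree, given the sample `c` at the root. -/
def node (σ : SortRule d) (s : Stream d) {i₀ : Fin d} (c : Sample d i₀) (p : List ℕ) :
    Option (Σ i, Sample d i) :=
  descend σ s [] (some ⟨i₀, c⟩) p

section Node

variable {σ : SortRule d} {s : Stream d} {i₀ : Fin d} {c₀ : Sample d i₀} {τ : FTree d}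

theorem node_append (p : List ℕ) (ℓ : ℕ) :
    node σ s c₀ (p ++ [ℓ]) = childSample σ s p (node σ s c₀ p) ℓ := by
  rw [node, descend_append]
  rfl

theorem node_append_letter {p : List ℕ} {i : Fin d} {c : Sample d i}
    (h : node σ s c₀ p = some ⟨i, c⟩) {j : Fin d} (hj : j ≠ i) (t : Fin (c.path.slots j).length) :
    node σ s c₀ (p ++ [(j : ℕ) + t * d]) = some ⟨j, sorted σ s p j _ t⟩ := by
  rw [node_append, h, childSample_letter σ s p c hj t]

theorem exists_parent_of_node {p : List ℕ} {ℓ : ℕ} {x : Σ i, Sample d i}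
    (h : node σ s c₀ (p ++ [ℓ]) = some x) : ∃ i, ∃ c : Sample d i, node σ s c₀ p = some ⟨i, c⟩ ∧
      ∃ j, j ≠ i ∧ ∃ t : Fin (c.path.slots j).length, ℓ = (j : ℕ) + t * d := by
  rw [node_append] at h
  rcases hn : node σ s c₀ p with _ | ⟨i, c⟩
  · rw [hn] at h
    exact absurd h (by simp [childSample])
  · rw [hn] at h
    exact ⟨i, c, rfl, exists_letter_of_childSample h⟩

theorem Realizes.exists_node (h : Realizes σ s [] i₀ c₀ τ) (p : List ℕ) :
    ∀ i (c : Sample d i), node σ s c₀ p = some ⟨i, c⟩ → ∃ κ, Realizes σ s p i c κ := by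
  induction p using List.reverseRecOn with
  | nil =>
    rintro i c hn
    obtain ⟨rfl, hc⟩ := Sigma.mk.inj (Option.some_inj.mp hn)
    obtain rfl := eq_of_heq hc
    exact ⟨τ, h⟩
  | append_singleton p ℓ ih =>
    intro j c hn
    obtain ⟨i', c', hn', j', hj', t, rfl⟩ := exists_parent_of_node hn
    obtain ⟨κ, hκ⟩ := ih i' c' hn'
    rw [node_append_letter hn' hj' t] at hn
    obtain ⟨rfl, hc⟩ := Sigma.mk.inj (Option.some_inj.mp hn)
    obtain rfl := eq_of_heq hc
    exact ⟨_, (realizes_iff.mp hκ).2 j' hj' t⟩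

open Classical in
/-- The finite tree realized by the decoration above `p`; arbitrary if there is none. -/
def treeAt (σ : SortRule d) (s : Stream d) {i₀ : Fin d} (c₀ : Sample d i₀) (p : List ℕ) : FTree d :=
  if h : ∃ i, ∃ c : Sample d i, node σ s c₀ p = some ⟨i, c⟩ ∧ ∃ κ, Realizes σ s p i c κ then
    h.choose_spec.choose_spec.2.choose else default

theorem Realizes.treeAt (h : Realizes σ s [] i₀ c₀ τ) {p : List ℕ} {i : Fin d} {c : Sample d i}
    (hn : node σ s c₀ p = some ⟨i, c⟩) : Realizes σ s p i c (treeAt σ s c₀ p) := by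
  have h' : ∃ i, ∃ c : Sample d i, node σ s c₀ p = some ⟨i, c⟩ ∧ ∃ κ, Realizes σ s p i c κ :=
    ⟨i, c, hn, h.exists_node p i c hn⟩
  have key : ∀ i' (c' : Sample d i') (κ : FTree d), node σ s c₀ p = some ⟨i', c'⟩ →
      Realizes σ s p i' c' κ → Realizes σ s p i c κ := by
    intro i' c' κ hn' hκ
    rw [hn] at hn'
    obtain ⟨rfl, hc⟩ := Sigma.mk.inj (Option.some_inj.mp hn')
    obtain rfl := eq_of_heq hc
    exact hκ
  rw [MBGW.treeAt, dif_pos h']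
  exact key _ _ _ h'.choose_spec.choose_spec.1 h'.choose_spec.choose_spec.2.choose_spec

/-- The decoration with sample `c₀` at the root and stream `s`. -/
abbrev nodeDecoration (σ : SortRule d) (s : Stream d) {i₀ : Fin d} (c₀ : Sample d i₀) :
    Decoration d := fun p => nodeSpace (node σ s c₀ p)

theorem decoration_eq (σ : SortRule d) (s : Stream d) {i₀ : Fin d} (c₀ : Sample d i₀) :
    decoration σ (c₀, s) = nodeDecoration σ s c₀ := by
  funext p
  simp only [decoration, nodeDecoration, node]
  generalize descend σ s [] (some ⟨i₀, c₀⟩) p = o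
  rcases o with _ | ⟨i, c⟩ <;> rfl

/-- The point `v_m` of the subdecoration at `p`, in the glued space. -/
def point (σ : SortRule d) (s : Stream d) {i₀ : Fin d} (c₀ : Sample d i₀) (p : List ℕ) (m : ℕ) :
    (nodeDecoration σ s c₀).GluedStar :=
  (nodeDecoration σ s c₀).incl p (nodeVertex (node σ s c₀ p) m)

/-- The parents in the glued space. -/
abbrev gluedPar (σ : SortRule d) (s : Stream d) {i₀ : Fin d} (c₀ : Sample d i₀) :
    (nodeDecoration σ s c₀).GluedStar → (nodeDecoration σ s c₀).GluedStar :=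
  (nodeDecoration σ s c₀).starPar fun p => nodePar (node σ s c₀ p)

theorem point_ne_root {p : List ℕ} {m : ℕ} (h1 : 1 ≤ m) (hm : m ≤ nodeSize (node σ s c₀ p)) :
    point σ s c₀ p m ≠ (nodeDecoration σ s c₀).starRoot :=
  (nodeDecoration σ s c₀).incl_ne_starRoot (nodeVertex_ne_root _ h1 hm)

theorem point_inj {p p' : List ℕ} {m m' : ℕ} (h1 : 1 ≤ m) (hm : m ≤ nodeSize (node σ s c₀ p))
    (h1' : 1 ≤ m') (hm' : m' ≤ nodeSize (node σ s c₀ p'))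
    (h : point σ s c₀ p m = point σ s c₀ p' m') : p = p' ∧ m = m' := by
  obtain rfl := (nodeDecoration σ s c₀).incl_inj (nodeVertex_ne_root _ h1 hm)
    (nodeVertex_ne_root _ h1' hm') h
  have := congrArg (nodeNum (node σ s c₀ p)) ((nodeDecoration σ s c₀).incl_injective p h)
  rw [nodeNum_nodeVertex _ hm, nodeNum_nodeVertex _ hm'] at this
  exact ⟨rfl, this⟩

theorem exists_eq_point (y : (nodeDecoration σ s c₀).GluedStar)
    (hy : y ≠ (nodeDecoration σ s c₀).starRoot) :
    ∃ a : List ℕ × ℕ, 1 ≤ a.2 ∧ a.2 ≤ nodeSize (node σ s c₀ a.1) ∧ y = point σ s c₀ a.1 a.2 := by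
  obtain ⟨p, z, hz, rfl⟩ := (nodeDecoration σ s c₀).exists_eq_incl y hy
  refine ⟨(p, nodeNum _ z), ?_, nodeNum_le _ z, ?_⟩
  · rw [Nat.one_le_iff_ne_zero]
    intro h0
    change nodeNum (node σ s c₀ p) z = 0 at h0
    have h1 := nodeVertex_nodeNum (node σ s c₀ p) z
    rw [h0, nodeVertex_zero] at h1
    exact hz h1.symm
  · rw [point, nodeVertex_nodeNum]

open Classical in
/-- The subdecoration of a point other than the root, and the number of the point there; the root
is given the address of the point `v_0` of `D []`. -/
def address (y : (nodeDecoration σ s c₀).GluedStar) : List ℕ × ℕ :=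
  if h : y ≠ (nodeDecoration σ s c₀).starRoot then (exists_eq_point y h).choose else ([], 0)

theorem address_point {p : List ℕ} {m : ℕ} (h1 : 1 ≤ m) (hm : m ≤ nodeSize (node σ s c₀ p)) :
    address (point σ s c₀ p m) = (p, m) := by
  have h := point_ne_root h1 hm
  rw [address, dif_pos h]
  obtain ⟨h2, h3, h4⟩ := (exists_eq_point _ h).choose_spec
  obtain ⟨h5, h6⟩ := point_inj h1 hm h2 h3 h4
  exact Prod.ext h5.symm h6.symm

/-- The type of a point of the glued space; the root is given the type of `D []`. -/
def pointType (y : (nodeDecoration σ s c₀).GluedStar) : Fin d :=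
  (nodeType (node σ s c₀ (address y).1)).getD i₀

/-- The tree of the descendants of a point of the glued space. The point `v_m` of a subdecoration
is the vertex number `m - 1`, counted from `0`, of a component. -/
def pointTree (y : (nodeDecoration σ s c₀).GluedStar) : FTree d :=
  ((treeAt σ s c₀ (address y).1).comp (pointType y)).getD ((address y).2 - 1) default

theorem exists_node_of_le_nodeSize {o : Option (Σ i, Sample d i)} {m : ℕ} (h1 : 1 ≤ m)
    (hm : m ≤ nodeSize o) : ∃ i, ∃ c : Sample d i, o = some ⟨i, c⟩ := by
  rcases o with _ | ⟨i, c⟩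
  · rw [nodeSize] at hm
    omega
  · exact ⟨i, c, rfl⟩

theorem nodeSize_eq (h : Realizes σ s [] i₀ c₀ τ) {p : List ℕ} {i : Fin d} {c : Sample d i}
    (hn : node σ s c₀ p = some ⟨i, c⟩) :
    nodeSize (node σ s c₀ p) = ((treeAt σ s c₀ p).comp i).length := by
  rw [hn, nodeSize, (realizes_iff.mp (h.treeAt hn)).1, FTree.len_path]

theorem pointType_point {p : List ℕ} {m : ℕ} (h1 : 1 ≤ m) (hm : m ≤ nodeSize (node σ s c₀ p))
    {i : Fin d} {c : Sample d i} (hn : node σ s c₀ p = some ⟨i, c⟩) :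
    pointType (point σ s c₀ p m) = i := by
  rw [pointType, address_point h1 hm, hn]
  rfl

theorem pointTree_point (h : Realizes σ s [] i₀ c₀ τ) {p : List ℕ} {m : ℕ}
    (hm : m + 1 ≤ nodeSize (node σ s c₀ p)) {i : Fin d} {c : Sample d i}
    (hn : node σ s c₀ p = some ⟨i, c⟩) :
    ((treeAt σ s c₀ p).comp i)[m]? = some (pointTree (point σ s c₀ p (m + 1))) := by
  rw [pointTree, pointType_point (Nat.le_add_left 1 m) hm hn,
    address_point (Nat.le_add_left 1 m) hm]
  simp only [Nat.add_sub_cancel]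
  rw [nodeSize_eq h hn] at hm
  rw [List.getD_eq_getElem _ _ hm, List.getElem?_eq_getElem hm]

theorem gluedPar_point {p : List ℕ} {m : ℕ} (h1 : 1 ≤ m) {i : Fin d} {c : Sample d i}
    (hn : node σ s c₀ p = some ⟨i, c⟩) (hm : m ≤ nodeSize (node σ s c₀ p)) :
    gluedPar σ s c₀ (point σ s c₀ p m) = point σ s c₀ p (c.path.parent i m) := by
  rw [gluedPar, point, Decoration.starPar_incl _ _ (nodeVertex_ne_root _ h1 hm), point]
  congr 1
  change nodePar (node σ s c₀ p) _ = _
  have key : ∀ o, o = some ⟨i, c⟩ → m ≤ nodeSize o →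
      nodePar o (nodeVertex o m) = nodeVertex o (c.path.parent i m) := by
    rintro o rfl hm
    exact nodePar_nodeVertex hm
  exact key _ hn hm

/-- The parent of a point in the same subdecoration. -/
theorem gluedPar_kidPos (h : Realizes σ s [] i₀ c₀ τ) {p : List ℕ} {i : Fin d} {c : Sample d i}
    (hn : node σ s c₀ p = some ⟨i, c⟩) {m k : ℕ} {κ : FTree d}
    (hκ : ((treeAt σ s c₀ p).comp i)[m]? = some κ) (hk : k < κ.off i)
    (hm : FTree.kidPos i κ m k + 1 ≤ nodeSize (node σ s c₀ p)) :
    gluedPar σ s c₀ (point σ s c₀ p (FTree.kidPos i κ m k + 1)) = point σ s c₀ p (m + 1) := by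
  rw [gluedPar_point (Nat.le_add_left 1 _) hn hm, (realizes_iff.mp (h.treeAt hn)).1,
    FTree.parent_kidPos hκ hk]

theorem gluedPar_point_one {p : List ℕ} {i : Fin d} {c : Sample d i}
    (hn : node σ s c₀ p = some ⟨i, c⟩) (hm : 1 ≤ nodeSize (node σ s c₀ p)) :
    gluedPar σ s c₀ (point σ s c₀ p 1) =
      (nodeDecoration σ s c₀).incl p (nodeSpace (node σ s c₀ p)).root := by
  rw [gluedPar_point le_rfl hn hm, FTree.parent_one, point, nodeVertex_zero]

theorem one_le_nodeSize (h : Realizes σ s [] i₀ c₀ τ) {p : List ℕ} {i : Fin d} {c : Sample d i}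
    (hn : node σ s c₀ p = some ⟨i, c⟩) : 1 ≤ nodeSize (node σ s c₀ p) := by
  rw [nodeSize_eq h hn]
  exact FTree.comp_ne_nil _ _

/-- The subdecoration attached at the entry number `π^j(t)` of `L_j` is that of the `k`-th child of
type `j` of the vertex number `m` of the component. -/
theorem attached_spec (h : Realizes σ s [] i₀ c₀ τ) {p : List ℕ} {i : Fin d} {c : Sample d i}
    (hn : node σ s c₀ p = some ⟨i, c⟩) {j : Fin d} (hj : j ≠ i) (t : Fin (c.path.slots j).length)
    {m k : ℕ} {κ : FTree d} (hκ : ((treeAt σ s c₀ p).comp i)[m]? = some κ) (hk : k < κ.off j)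
    (ht : (c.perm ⟨j, hj⟩ t : ℕ) =
      blockPos (fun κ => κ.kids j) ((treeAt σ s c₀ p).comp i) m k) :
    (κ.kids j)[k]? = some (treeAt σ s c₀ (p ++ [(j : ℕ) + t * d])) ∧
      gluedPar σ s c₀ (point σ s c₀ (p ++ [(j : ℕ) + t * d]) 1) = point σ s c₀ p (m + 1) := by
  have hn' := node_append_letter hn hj t
  obtain ⟨hpath, hkids⟩ := realizes_iff.mp (h.treeAt hn)
  have htree := (h.treeAt hn').unique (hkids j hj t)
  constructor
  · have hlt : (c.perm ⟨j, hj⟩ t : ℕ) < ((treeAt σ s c₀ p).slotTrees i j).length := by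
      rw [← FTree.length_slots i _ hj, ← hpath]
      exact (c.perm ⟨j, hj⟩ t).2
    rw [htree, ← FTree.slotTrees_blockPos hκ hk, ← ht, List.getD_eq_getElem _ _ hlt,
      List.getElem?_eq_getElem hlt]
  · rw [gluedPar_point_one hn' (one_le_nodeSize h hn'), Decoration.incl_append_root, point]
    congr 1
    have hmark : ∀ (w : Path d), w = (treeAt σ s c₀ p).path i → ∀ x : Fin (w.slots j).length,
        (x : ℕ) = blockPos (fun κ => κ.kids j) ((treeAt σ s c₀ p).comp i) m k →
        (((w.slots j).get x : w.Vertex) : ℕ) = m + 1 := by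
      rintro w rfl x hx
      have h1 := FTree.slots_blockPos hj hκ hk
      rw [← hx, List.getElem?_eq_getElem x.2, Option.map_some, Option.some_inj] at h1
      exact h1
    have h2 := hmark c.path hpath _ ht
    have key : ∀ o, o = some ⟨i, c⟩ → (nodeSpace o).mark ((j : ℕ) + t * d) =
        nodeVertex o (m + 1) := by
      rintro o rfl
      rw [mark_letter c hj t, ← h2]
      exact (nodeVertex_nodeNum (some ⟨i, c⟩) ((c.path.slots j).get (c.perm ⟨j, hj⟩ t))).symm
    exact key _ hn

end Node

end GluedDecoration

section GluedCoding

variable {d : ℕ} {σ : SortRule d} {s : Stream d} {i₀ : Fin d} {c₀ : Sample d i₀} {τ : FTree d}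

theorem address_spec {y : (nodeDecoration σ s c₀).GluedStar}
    (hy : y ≠ (nodeDecoration σ s c₀).starRoot) :
    1 ≤ (address y).2 ∧ (address y).2 ≤ nodeSize (node σ s c₀ (address y).1) ∧
      y = point σ s c₀ (address y).1 (address y).2 := by
  rw [address, dif_pos hy]
  exact (exists_eq_point y hy).choose_spec

theorem pointType_incl {p : List ℕ} {z : (nodeDecoration σ s c₀ p).carrier}
    (hz : z ≠ (nodeDecoration σ s c₀ p).root) :
    nodeType (node σ s c₀ p) = some (pointType ((nodeDecoration σ s c₀).incl p z)) := by
  have hy := (nodeDecoration σ s c₀).incl_ne_starRoot hz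
  obtain ⟨h1, h2, h3⟩ := address_spec hy
  have hp : p = (address ((nodeDecoration σ s c₀).incl p z)).1 :=
    (nodeDecoration σ s c₀).incl_inj hz (nodeVertex_ne_root _ h1 h2) h3
  rw [pointType, ← hp]
  rw [← hp] at h2
  obtain ⟨i, c, h⟩ := exists_node_of_le_nodeSize h1 h2
  rw [h]
  rfl

/-- The `j`-th measure of the glued space is the counting measure on the points of type `j`. -/
theorem mass_star (j : Fin d) : (nodeDecoration σ s c₀).star.mass j =
    @Measure.sum _ _ (borel (nodeDecoration σ s c₀).GluedStar)
      fun v : {y // y ≠ (nodeDecoration σ s c₀).starRoot ∧ pointType y = j} =>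
        @Measure.dirac _ (borel (nodeDecoration σ s c₀).GluedStar) v.1 := by
  set D := nodeDecoration σ s c₀ with hD
  let _ : MeasurableSpace D.GluedStar := borel _
  let e : (Σ p, {z : (D p).carrier // z ≠ (D p).root ∧ nodeType (node σ s c₀ p) = some j}) ≃
      {y : D.GluedStar // y ≠ D.starRoot ∧ pointType y = j} :=
    Equiv.ofBijective (fun x => ⟨D.incl x.1 x.2.1, D.incl_ne_starRoot x.2.2.1, by
      exact Option.some_inj.mp ((pointType_incl x.2.2.1).symm.trans x.2.2.2)⟩) <| by
    constructor
    · rintro ⟨p, z, hz, hzj⟩ ⟨p', z', hz', hzj'⟩ h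
      have h' : D.incl p z = D.incl p' z' := congrArg Subtype.val h
      obtain rfl := D.incl_inj hz hz' h'
      obtain rfl := D.incl_injective p h'
      rfl
    · rintro ⟨y, hy, hyj⟩
      obtain ⟨p, z, hz, rfl⟩ := D.exists_eq_incl y hy
      exact ⟨⟨p, z, hz, by rw [pointType_incl hz]; exact congrArg some hyj⟩, rfl⟩
  have hmap : ∀ p, @Measure.map _ _ (borel (D p).carrier) _ (D.incl p) ((D p).mass j) =
      Measure.sum fun v : {z : (D p).carrier // z ≠ (D p).root ∧
        nodeType (node σ s c₀ p) = some j} => Measure.dirac (D.incl p v.1) := by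
    intro p
    let _ : MeasurableSpace (D p).carrier := borel _
    have hmeas : Measurable (D.incl p) := borel_measurable (D.isometry_incl p).continuous
    have hm : (D p).mass j = Measure.sum fun v : {z : (D p).carrier // z ≠ (D p).root ∧
        nodeType (node σ s c₀ p) = some j} => Measure.dirac v.1 :=
      mass_nodeSpace (node σ s c₀ p) j
    rw [hm, Measure.map_sum hmeas.aemeasurable]
    simp only [Measure.map_dirac' hmeas]
  change (Measure.sum fun p : List ℕ =>
    @Measure.map _ _ (borel (D p).carrier) _ (D.incl p) ((D p).mass j)) = _
  simp only [hmap]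
  ext S hS
  rw [Measure.sum_apply _ hS, Measure.sum_apply _ hS, ← e.tsum_eq, ENNReal.tsum_sigma']
  refine tsum_congr fun p => ?_
  rw [Measure.sum_apply _ hS]
  rfl

/-- `y` is the child number `k` of type `j` of the vertex number `m` (counted from `0`, with tree of
descendants `κ`) of the subdecoration `c` of type `i` at `p`. It lies in the same subdecoration if
`j = i`; otherwise it is the first vertex of the subdecoration attached at the slot of the child. -/
def IsKid (σ : SortRule d) (s : Stream d) {i₀ : Fin d} (c₀ : Sample d i₀) (p : List ℕ) {i : Fin d}
    (c : Sample d i) (m : ℕ) (κ : FTree d) (j : Fin d) (k : ℕ)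
    (y : (nodeDecoration σ s c₀).GluedStar) : Prop :=
  (j = i ∧ y = point σ s c₀ p (FTree.kidPos i κ m k + 1)) ∨
    ∃ (hj : j ≠ i) (t : Fin (c.path.slots j).length),
      (c.perm ⟨j, hj⟩ t : ℕ) = blockPos (fun κ => κ.kids j) ((treeAt σ s c₀ p).comp i) m k ∧
        y = point σ s c₀ (p ++ [(j : ℕ) + t * d]) 1

section IsKid

variable {p : List ℕ} {i : Fin d} {c : Sample d i} {m : ℕ} {κ : FTree d} {j : Fin d} {k k' : ℕ}
  {y y' : (nodeDecoration σ s c₀).GluedStar}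

theorem kidPos_lt_nodeSize (h : Realizes σ s [] i₀ c₀ τ) (hn : node σ s c₀ p = some ⟨i, c⟩)
    (hκ : ((treeAt σ s c₀ p).comp i)[m]? = some κ) (hk : k < κ.off i) :
    FTree.kidPos i κ m k + 1 ≤ nodeSize (node σ s c₀ p) := by
  have hk' : k < (κ.kids i).length := by rwa [FTree.length_kids]
  rw [nodeSize_eq h hn]
  exact (List.getElem?_eq_some_iff.mp
    (FTree.comp_kidPos hκ (List.getElem?_eq_getElem hk'))).1

theorem exists_isKid (h : Realizes σ s [] i₀ c₀ τ) (hn : node σ s c₀ p = some ⟨i, c⟩)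
    (hκ : ((treeAt σ s c₀ p).comp i)[m]? = some κ) (hk : k < κ.off j) :
    ∃ y, IsKid σ s c₀ p c m κ j k y := by
  by_cases hj : j = i
  · exact ⟨_, Or.inl ⟨hj, rfl⟩⟩
  · have hlt : blockPos (fun κ => κ.kids j) ((treeAt σ s c₀ p).comp i) m k <
        (c.path.slots j).length := by
      rw [(realizes_iff.mp (h.treeAt hn)).1, FTree.length_slots i _ hj]
      exact blockPos_lt_length _ hκ (by rwa [FTree.length_kids])
    exact ⟨_, Or.inr ⟨hj, (c.perm ⟨j, hj⟩).symm ⟨_, hlt⟩, by rw [Equiv.apply_symm_apply], rfl⟩⟩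

theorem IsKid.unique (h : IsKid σ s c₀ p c m κ j k y) (h' : IsKid σ s c₀ p c m κ j k y') :
    y = y' := by
  rcases h with ⟨hj, rfl⟩ | ⟨hj, t, ht, rfl⟩
  · rcases h' with ⟨-, rfl⟩ | ⟨hj', -⟩
    · rfl
    · exact absurd hj hj'
  · rcases h' with ⟨hj', -⟩ | ⟨_, t', ht', rfl⟩
    · exact absurd hj' hj
    · obtain rfl : t = t' := (c.perm ⟨j, hj⟩).injective (Fin.ext (ht.trans ht'.symm))
      rfl

theorem IsKid.spec (h : Realizes σ s [] i₀ c₀ τ) (hn : node σ s c₀ p = some ⟨i, c⟩)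
    (hκ : ((treeAt σ s c₀ p).comp i)[m]? = some κ) (hk : k < κ.off j)
    (hy : IsKid σ s c₀ p c m κ j k y) : y ≠ (nodeDecoration σ s c₀).starRoot ∧
      gluedPar σ s c₀ y = point σ s c₀ p (m + 1) ∧ pointType y = j ∧
        (κ.kids j)[k]? = some (pointTree y) := by
  rcases hy with ⟨rfl, rfl⟩ | ⟨hj, t, ht, rfl⟩
  · have hle := kidPos_lt_nodeSize h hn hκ hk
    refine ⟨point_ne_root (Nat.le_add_left 1 _) hle, gluedPar_kidPos h hn hκ hk hle,
      pointType_point (Nat.le_add_left 1 _) hle hn, ?_⟩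
    have hk' : k < (κ.kids j).length := by rwa [FTree.length_kids]
    rw [← pointTree_point h hle hn]
    rw [FTree.comp_kidPos hκ (List.getElem?_eq_getElem hk'), List.getElem?_eq_getElem hk']
  · have hn' := node_append_letter hn hj t
    have hle := one_le_nodeSize h hn'
    obtain ⟨h1, h2⟩ := attached_spec h hn hj t hκ hk ht
    refine ⟨point_ne_root le_rfl hle, h2, pointType_point le_rfl hle hn', ?_⟩
    rw [h1, ← pointTree_point h hle hn', FTree.comp_zero]

theorem IsKid.inj (h : Realizes σ s [] i₀ c₀ τ) (hn : node σ s c₀ p = some ⟨i, c⟩)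
    (hκ : ((treeAt σ s c₀ p).comp i)[m]? = some κ) (hk : k < κ.off j) (hk' : k' < κ.off j)
    (hy : IsKid σ s c₀ p c m κ j k y) (hy' : IsKid σ s c₀ p c m κ j k' y) : k = k' := by
  rcases hy with ⟨rfl, rfl⟩ | ⟨hj, t, ht, rfl⟩
  · rcases hy' with ⟨-, heq⟩ | ⟨hj', -⟩
    · have h1 := (point_inj (Nat.le_add_left 1 _) (kidPos_lt_nodeSize h hn hκ hk)
        (Nat.le_add_left 1 _) (kidPos_lt_nodeSize h hn hκ hk') heq).2
      rcases lt_trichotomy k k' with hlt | rfl | hlt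
      · have := FTree.kidPos_strictMono m hlt hk'.le
        omega
      · rfl
      · have := FTree.kidPos_strictMono m hlt hk.le
        omega
    · exact absurd rfl hj'
  · rcases hy' with ⟨hj', -⟩ | ⟨_, t', ht', heq⟩
    · exact absurd hj' hj
    · have h1 := (point_inj le_rfl (one_le_nodeSize h (node_append_letter hn hj t)) le_rfl
        (one_le_nodeSize h (node_append_letter hn hj t')) heq).1
      have h2 := List.singleton_inj.mp (List.append_cancel_left h1)
      have h3 : (t : ℕ) = t' := Nat.eq_of_mul_eq_mul_right j.pos (Nat.add_left_cancel h2)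
      obtain rfl := Fin.ext h3
      simp only [blockPos] at ht ht'
      omega

/-- Each point other than the root and the point joined to it is a child. -/
theorem exists_eq_isKid (h : Realizes σ s [] i₀ c₀ τ)
    (y : (nodeDecoration σ s c₀).GluedStar) (hy : y ≠ (nodeDecoration σ s c₀).starRoot) :
    y = point σ s c₀ [] 1 ∨ ∃ p i, ∃ c : Sample d i, ∃ m κ j k, node σ s c₀ p = some ⟨i, c⟩ ∧
      ((treeAt σ s c₀ p).comp i)[m]? = some κ ∧ k < κ.off j ∧ IsKid σ s c₀ p c m κ j k y := by
  obtain ⟨⟨p, t⟩, h1, h2, rfl⟩ := exists_eq_point y hy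
  change 1 ≤ t at h1
  change t ≤ nodeSize (node σ s c₀ p) at h2
  change point σ s c₀ p t = _ ∨ ∃ p' i, ∃ c : Sample d i, ∃ m κ j k, _ ∧ _ ∧ _ ∧
    IsKid σ s c₀ p' c m κ j k (point σ s c₀ p t)
  obtain ⟨i, c, hn⟩ := exists_node_of_le_nodeSize h1 h2
  obtain ⟨t, rfl⟩ := Nat.exists_eq_add_of_le' h1
  by_cases ht : t = 0
  · subst ht
    rcases List.eq_nil_or_concat p with rfl | ⟨p, ℓ, rfl⟩
    · exact Or.inl rfl
    · rw [List.concat_eq_append] at hn ⊢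
      obtain ⟨i', c', hn', j, hj, t, rfl⟩ := exists_parent_of_node hn
      have hlt : (c'.perm ⟨j, hj⟩ t : ℕ) < ((treeAt σ s c₀ p).slotTrees i' j).length := by
        rw [← FTree.length_slots i' _ hj, ← (realizes_iff.mp (h.treeAt hn')).1]
        exact (c'.perm ⟨j, hj⟩ t).2
      obtain ⟨m, κ, k, h3, h4, h5⟩ := exists_eq_blockPos _ _ hlt
      exact Or.inr ⟨p, i', c', m, κ, j, k, hn', h3, by rwa [FTree.length_kids] at h4,
        Or.inr ⟨hj, t, h5, rfl⟩⟩
  · obtain ⟨m, κ, k, h3, h4, rfl⟩ := FTree.exists_eq_kidPos i (treeAt σ s c₀ p) (t := t) ht (by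
      rw [← nodeSize_eq h hn]
      exact h2)
    exact Or.inr ⟨p, i, c, m, κ, i, k, hn, h3, h4, Or.inl ⟨rfl, rfl⟩⟩

end IsKid

/-- A decoration realizing a finite tree glues to the planted tree. -/
def Realizes.coding (h : Realizes σ s [] i₀ c₀ τ) : Coding (nodeDecoration σ s c₀).star i₀ τ :=
  have hn₀ : node σ s c₀ [] = some ⟨i₀, c₀⟩ := rfl
  have hle := one_le_nodeSize h hn₀
  have hpar : ∀ {p : List ℕ} {i : Fin d} {c : Sample d i} {m : ℕ} {κ : FTree d},
      node σ s c₀ p = some ⟨i, c⟩ → ((MBGW.treeAt σ s c₀ p).comp i)[m]? = some κ →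
        m + 1 ≤ nodeSize (node σ s c₀ p) := fun hn hκ => by
    rw [nodeSize_eq h hn]
    exact (List.getElem?_eq_some_iff.mp hκ).1
  have htop : gluedPar σ s c₀ (point σ s c₀ [] 1) = (nodeDecoration σ s c₀).starRoot :=
    gluedPar_point_one hn₀ hle
  Coding.ofChildren (gluedPar σ s c₀) pointType pointTree
    ((nodeDecoration σ s c₀).isTreeMetric_star _ fun p => isTreeMetric_nodeSpace (node σ s c₀ p))
    mass_star (point σ s c₀ [] 1) (point_ne_root le_rfl hle) htop
    (by
      have h1 := pointTree_point h hle hn₀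
      rw [FTree.comp_zero, Option.some_inj] at h1
      exact h1.symm.trans ((h.treeAt hn₀).unique h))
    (pointType_point le_rfl hle hn₀)
    -- every other point is a child of a point other than the root
    (by
      intro y hy hyp
      rcases exists_eq_isKid h y hy with rfl | ⟨p, i, c, m, κ, j, k, hn, hκ, hk, hkid⟩
      · rfl
      · refine absurd ?_ (point_ne_root (Nat.le_add_left 1 m) (hpar hn hκ))
        exact (hkid.spec h hn hκ hk).2.1.symm.trans hyp)
    (by
      intro x hx j
      obtain ⟨⟨p, m⟩, h1, h2, rfl⟩ := exists_eq_point x hx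
      change 1 ≤ m at h1
      change m ≤ nodeSize (node σ s c₀ p) at h2
      obtain ⟨i, c, hn⟩ := exists_node_of_le_nodeSize h1 h2
      obtain ⟨m, rfl⟩ := Nat.exists_eq_add_of_le' h1
      have hκ := pointTree_point h h2 hn
      change ∃ e : ℕ → (nodeDecoration σ s c₀).GluedStar,
        (∀ k < (pointTree (point σ s c₀ p (m + 1))).off j, _) ∧ _
      generalize hκ' : pointTree (point σ s c₀ p (m + 1)) = κ at hκ
      have hex : ∀ k, ∃ y, k < κ.off j → IsKid σ s c₀ p c m κ j k y := fun k => by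
        by_cases hk : k < κ.off j
        · obtain ⟨y, hy⟩ := exists_isKid h hn hκ hk
          exact ⟨y, fun _ => hy⟩
        · exact ⟨(nodeDecoration σ s c₀).starRoot, fun hk' => absurd hk' hk⟩
      choose e he using hex
      refine ⟨e, fun k hk => (he k hk).spec h hn hκ hk, fun k hk k' hk' heq => ?_,
        fun y hy hyp hyj => ?_⟩
      · exact IsKid.inj h hn hκ hk hk' (he k hk) (heq ▸ he k' hk')
      · rcases exists_eq_isKid h y hy with rfl | ⟨p', i', c', m', κ₁, j', k, hn', hκ₁, hk, hkid⟩
        · exact absurd (hyp.symm.trans htop) hx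
        · obtain ⟨-, h4, h5, -⟩ := hkid.spec h hn' hκ₁ hk
          obtain ⟨rfl, h6⟩ := point_inj (Nat.le_add_left 1 m') (hpar hn' hκ₁)
            (Nat.le_add_left 1 m) h2 (h4.symm.trans hyp)
          obtain rfl : m' = m := Nat.add_right_cancel h6
          rw [hn] at hn'
          obtain ⟨rfl, hc⟩ := Sigma.mk.inj (Option.some_inj.mp hn')
          obtain rfl := eq_of_heq hc
          obtain rfl : κ = κ₁ := Option.some_inj.mp (hκ.symm.trans hκ₁)
          obtain rfl : j' = j := h5.symm.trans hyj
          exact ⟨k, hk, hkid.unique (he k hk)⟩)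

end GluedCoding

/-! ### Comparison of the laws -/

section Laws

variable {d : ℕ}

theorem Realizes.coding_glued {σ : SortRule d} {i₀ : Fin d} {x : Samples d i₀} {τ : FTree d}
    (h : Realizes σ x.2 [] i₀ x.1 τ) :
    (decoration σ x).glued.IsCompactFinite ∧ ∃ X : PMMSpace d, Nonempty (Coding X i₀ τ) ∧
      (decoration σ x).glued.cls = X.cls := by
  have : Finite (nodeDecoration σ x.2 x.1).GluedStar := h.coding.finite
  have hiso := (nodeDecoration σ x.2 x.1).star_iso_glued
  rw [show decoration σ x = nodeDecoration σ x.2 x.1 from decoration_eq σ x.2 x.1]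
  exact ⟨hiso.isCompactFinite h.coding.isCompactFinite, _, ⟨h.coding⟩, (Quotient.sound hiso).symm⟩

theorem measurableSet_samples_realizes (σ : SortRule d) (i₀ : Fin d) (τ : FTree d) :
    MeasurableSet {x : Samples d i₀ | Realizes σ x.2 [] i₀ x.1 τ} := by
  have : {x : Samples d i₀ | Realizes σ x.2 [] i₀ x.1 τ} =
      ⋃ c : Sample d i₀, {c} ×ˢ {s | Realizes σ s [] i₀ c τ} := by
    ext x
    simp
  rw [this]
  exact MeasurableSet.iUnion fun c =>
    (measurableSet_singleton c).prod (measurableSet_realizes σ [] i₀ c τ)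

theorem samplesLaw_realizes (φ : Fin d → PMF (Fin d → ℕ)) (σ : SortRule d) (i₀ : Fin d)
    (τ : FTree d) : samplesLaw φ i₀ {x | Realizes σ x.2 [] i₀ x.1 τ} = FTree.weight φ τ i₀ := by
  rw [← lintegral_realizeProb φ σ i₀ τ]
  exact Measure.prod_apply (measurableSet_samples_realizes σ i₀ τ)

theorem pairwise_disjoint_realizes (σ : SortRule d) (i₀ : Fin d) :
    Pairwise (Function.onFun Disjoint fun τ => {x : Samples d i₀ | Realizes σ x.2 [] i₀ x.1 τ}) :=
  fun _ _ hne => Set.disjoint_left.mpr fun _ h h' => hne (Realizes.unique h h')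

/-- A probability measure carries disjoint events of the probabilities of the finite trees. -/
theorem tsum_weight_le_one (φ : Fin d → PMF (Fin d → ℕ)) (σ : SortRule d) (i : Fin d) :
    ∑' τ : FTree d, FTree.weight φ τ i ≤ 1 := by
  have : IsProbabilityMeasure (samplesLaw φ i) := by
    unfold samplesLaw
    infer_instance
  simp only [← samplesLaw_realizes φ σ i]
  rw [← measure_iUnion (pairwise_disjoint_realizes σ i) fun τ =>
    measurableSet_samples_realizes σ i τ]
  exact prob_le_one

/-- A random element which is constant on each of countably many disjoint events of total
probability one is measurable for every σ-field, and its law is atomic. -/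
theorem aemeasurable_map_of_partition {Ω ι C : Type*} [MeasurableSpace Ω] [MeasurableSpace C]
    [Countable ι] {P : Measure Ω} [IsProbabilityMeasure P] {E : ι → Set Ω} {w : ι → ℝ≥0∞}
    {X : Ω → C} {x : ι → C} (hE : ∀ n, MeasurableSet (E n))
    (hd : Pairwise (Function.onFun Disjoint E)) (hP : ∀ n, P (E n) = w n) (hw : ∑' n, w n = 1)
    (hX : ∀ n, ∀ ω ∈ E n, X ω = x n) :
    (∀ᵐ ω ∂P, ∃ n, ω ∈ E n) ∧ AEMeasurable X P ∧
      P.map X = Measure.sum fun n => w n • Measure.dirac (x n) := by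
  have hae : ∀ᵐ ω ∂P, ω ∈ ⋃ n, E n := by
    refine (mem_ae_iff_prob_eq_one (MeasurableSet.iUnion hE)).mpr ?_
    rw [measure_iUnion hd hE]
    simp only [hP, hw]
  have hres : P = Measure.sum fun n => P.restrict (E n) := by
    rw [← Measure.restrict_iUnion hd hE, Measure.restrict_eq_self_of_ae_mem hae]
  have hXn : ∀ n, X =ᵐ[P.restrict (E n)] fun _ => x n := fun n =>
    (ae_restrict_iff' (hE n)).mpr (Filter.Eventually.of_forall (hX n))
  have hm : AEMeasurable X P := by
    rw [hres]
    exact aemeasurable_sum_measure_iff.mpr fun n => aemeasurable_const.congr (hXn n).symm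
  refine ⟨by simpa using hae, hm, ?_⟩
  conv_lhs => rw [hres]
  rw [Measure.map_sum (by rwa [← hres])]
  congr 1
  funext n
  rw [Measure.map_congr (hXn n), Measure.map_const, Measure.restrict_apply_univ, hP]

end Laws

end

end MBGW

theorem lemma2p7 {d : ℕ} (φ : Fin d → PMF (Fin d → ℕ)) (hφ : MBGW.IsSubcriticalOrCritical φ)
    (i₀ : Fin d) {Ω : Type*} [MeasurableSpace Ω] (P : Measure Ω) [IsProbabilityMeasure P]
    (T : Ω → MBGW.MultitypeTree d) (hT : MBGW.IsMBGW φ i₀ P T) (σ : MBGW.SortRule d) :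
    IdentDistrib (fun s : MBGW.Samples d i₀ => (MBGW.decoration σ s).glued.cls)
        (fun ω => (T ω).planted.cls) (MBGW.samplesLaw φ i₀) P ∧
      (∀ᵐ s ∂(MBGW.samplesLaw φ i₀), (MBGW.decoration σ s).glued.IsCompactFinite) ∧
      (∀ᵐ ω ∂P, (T ω).planted.IsCompactFinite) := by
  classical
  have hw := MBGW.tsum_weight_eq_one hφ (fun i => MBGW.tsum_weight_le_one φ σ i) i₀
  have : IsProbabilityMeasure (MBGW.samplesLaw φ i₀) := by
    unfold MBGW.samplesLaw
    infer_instance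
  -- all the spaces coded by the same finite tree lie in one isomorphism class
  obtain ⟨x, hx⟩ : ∃ x : MBGW.FTree d → MBGW.PMMClass d, ∀ (τ : MBGW.FTree d) (X : MBGW.PMMSpace d),
      Nonempty (MBGW.Coding X i₀ τ) → X.cls = x τ := by
    refine ⟨fun τ => if h : ∃ X, Nonempty (MBGW.Coding X i₀ τ) then h.choose.cls
      else (MBGW.trivialSpace d).cls, fun τ X hX => ?_⟩
    have h : ∃ X, Nonempty (MBGW.Coding X i₀ τ) := ⟨X, hX⟩
    simp only [dif_pos h]
    exact Quotient.sound (hX.some.iso h.choose_spec.some)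
  obtain ⟨hae, hm, hmap⟩ := MBGW.aemeasurable_map_of_partition (x := x)
    (X := fun s : MBGW.Samples d i₀ => (MBGW.decoration σ s).glued.cls)
    (fun τ => MBGW.measurableSet_samples_realizes σ i₀ τ) (MBGW.pairwise_disjoint_realizes σ i₀)
    (fun τ => MBGW.samplesLaw_realizes φ σ i₀ τ) hw (fun τ s hs => by
      obtain ⟨-, X, hX, hcls⟩ := hs.coding_glued
      exact hcls.trans (hx τ X hX))
  obtain ⟨hae', hm', hmap'⟩ := MBGW.aemeasurable_map_of_partition (x := x) (P := P)
    (X := fun ω => (T ω).planted.cls) (fun τ => hT.measurableSet_unfolds τ)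
    (fun τ τ' hne => Set.disjoint_left.mpr fun ω h h' => hne (h.2.unique h'.2))
    (fun τ => hT.prob_unfolds τ) hw
    (fun τ ω hω => hx τ _ ⟨(T ω).coding hω.1 hω.2⟩)
  refine ⟨⟨hm, hm', hmap.trans hmap'.symm⟩, hae.mono fun s hs => ?_, hae'.mono fun ω hω => ?_⟩
  · obtain ⟨τ, hτ⟩ := hs
    exact hτ.coding_glued.1
  · obtain ⟨τ, hτ⟩ := hω
    exact ((T ω).coding hτ.1 hτ.2).isCompactFinite
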